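/- **Setting.** Let $\mathcal S$ be a Polish space, $\mathbb N=\{1,2,\dots\}$, let $K:(\mathcal S\times\mathbb N)^2\to[0,\infty)$ be measurable and symmetric, and let $\Upsilon$ be a Markov kernel from $(\mathcal S\times\mathbb N)^2$ to $\mathcal S$ that is symmetric in its two arguments in $\mathcal S\times\mathbb N$. For a finite label set $A$ and $\mathbf x=(x_i)_{i\in A}\in\mathcal S^A$, let $\mathbb P_{\mathbf x}$ be the law of the labelled coagulation process $Z_t=(X^{(t)}_C,C)_{C\in P_t}$, $t\ge 0$: $P_t$ is a partition of $A$ with $P_0=\{\{i\}:i\in A\}$, $X^{(0)}_{\{i\}}=x_i$, and $Z$ is the continuous-time Markov jump process in which each unordered pair $\{C,D\}$ of distinct blocks, independently of the others, is replaced by the block $C\cup D$ at rate $K((X_C,|C|),(X_D,|D|))$, the new block being placed at a random site with law $\Upsilon((X_C,|C|),(X_D,|D|),\cdot)$. For a probability measure $\mu$ on $\mathcal S$ and $\gamma>0$, let $\mathbb P_{\mathrm{Poi}_{\gamma\mu}}$ (with expectation $\mathbb E_{\mathrm{Poi}_{\gamma\mu}}$) be the law of $Z$ when the number of atoms is Poisson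 distributed with parameter $\gamma$ and, given this number, the initial sites of the atoms are i.i.d. with law $\mu$. Put $\Xi_t=\sum_{C\in P_t}\delta_{(X_C^{(t)},|C|)}$. Fix $T>0$. Let $\Gamma_T$ be the set of càdlàg, piecewise constant paths $\xi=(\xi_t)_{t\in[0,T]}$ with finitely many jumps, with values in the finite $\mathbb N_0$-valued measures on $\mathcal S\times\mathbb N$, such that $\xi_0$ is concentrated on $\mathcal S\times\{1\}$ and every jump is of the form $\phi\mapsto\phi-\delta_{(x,m)}-\delta_{(x',m')}+\delta_{(z,m+m')}$. Let $\Gamma_T^{(1)}$ be the set of those $\xi\in\Gamma_T$ with $\xi_T(\mathcal S\times\mathbb N)=1$, equipped with the $\sigma$-algebra generated by the maps $\xi\mapsto\xi_t(B)$, let $\mathcal M(\Gamma_T^{(1)})$ be the set of finite measures on $\Gamma_T^{(1)}$ with the $\sigma$-algebra generated by $\nu\mapsto\nu(B)$, and write $|\xi_0|=\xi_0(\mathcal S\times\mathbb N)$ for the number of atoms of $\xi$. For $C\in P_T$ let $\Xi^{(T,C)}_t=\sum_{\widetilde C\in P_t,\ \widetilde C\subset C}\delta_{(X^{(t)}_{\widetilde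 C},|\widetilde C|)}$, $t\in[0,T]$, and for $N\in\mathbb N$ let $$\mathcal V_N^{(T)}=\frac1N\sum_{C\in P_T}\delta_{\Xi^{(T,C)}}.$$ For $b\in(0,\infty)$ let $M^{(T)}_{b\mu,N}$ be the measure on $\Gamma_T^{(1)}$ given by $$M^{(T)}_{b\mu,N}(\mathrm d\xi)=N^{|\xi_0|-1}\,\mathrm e\;\mathbb P_{\mathrm{Poi}_{b\mu}}\big((\Xi_t)_{t\in[0,T]}\in\mathrm d\xi\big),\qquad \xi\in\Gamma_T^{(1)},$$ write $|M^{(T)}_{b\mu,N}|$ for its total mass, and for $\xi,\xi'\in\Gamma_T^{(1)}$ let $$R^{(T)}(\xi,\xi')=\int_0^T\langle\xi_t,K\xi'_t\rangle\,\mathrm dt,\qquad \langle\phi,K\psi\rangle=\int\!\!\int K(p,q)\,\psi(\mathrm dq)\,\phi(\mathrm dp).$$ **Theorem 2.1 (Poissonian description of the empirical measure).** Fix a probability measure $\mu$ on $\mathcal S$, $T>0$, $N\in\mathbb N$ and a bounded measurable function $f:\mathcal M(\Gamma_T^{(1)})\to[0,\infty)$. Then, for any $b\in(0,\infty)$, the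 measure $M^{(T)}_{b\mu,N}$ is finite and, for any Poisson point process $Y_N=\sum_{i\in I}\delta_{\Xi_i}$ on $\Gamma_T^{(1)}$ with intensity measure $N M^{(T)}_{b\mu,N}$ (with expectation denoted by $\mathtt E_{NM^{(T)}_{b\mu,N}}$), $$\mathbb E_{\mathrm{Poi}_{N\mu}}\big[f(\mathcal V_N^{(T)})\big]=\mathrm e^{N(|M^{(T)}_{b\mu,N}|-1)}\;\mathtt E_{NM^{(T)}_{b\mu,N}}\Big[\mathrm e^{-\frac12\sum_{i,j\in I:\,i\neq j}R^{(T)}(\Xi_i,\Xi_j)}\;\mathrm e^{(b-1)|I|}\;b^{-\sum_{i\in I}|\Xi_{i,0}|}\;f\big(\tfrac1N Y_N\big)\Big],$$ where $|I|$ is the number of points of $Y_N$ and $|\Xi_{i,0}|$ is the number of atoms of $\Xi_i$ at time $0$; both expectations are well-defined and finite. -/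

import Mathlib

open MeasureTheory ProbabilityTheory
open scoped NNReal ENNReal

noncomputable section

namespace Coag

/-- The discrete σ-algebra on the set of masses. -/
instance instMeasurableSpacePNat : MeasurableSpace ℕ+ := ⊤

/-- The position-mass space `S × ℕ` of a particle, with masses `1, 2, 3, …`. -/
abbrev Particle (S : Type*) := S × ℕ+

/-! ### The labelled coagulation process -/

section Labelled

variable {ι S : Type*} [Fintype ι] [DecidableEq ι] [MeasurableSpace S]

/-- A state `(X_C, C)_{C ∈ P}` of the labelled process with atoms labelled by `ι`: the value at a
label set `C` is `Sum.inl x` if `C` is a block of the current partition `P` and the particle `C`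
sits at `x`, and it is `Sum.inr ()` if `C` is not a block of `P`. -/
abbrev State (ι S : Type*) := Finset ι → S ⊕ Unit

/-- The mass `|C|` of a particle `C` (particles are non-empty label sets). -/
def mass (C : Finset ι) : ℕ+ := C.card.toPNat'

/-- The monodispersed initial state: the blocks are the singletons, the atom `i` sits at `x i`. -/
def initState (x : ι → S) : State ι S :=
  open Classical in
  fun C => if h : ∃ i, C = {i} then Sum.inl (x h.choose) else Sum.inr ()

/-- The state after the particles `C` and `D` have coagulated into `C ∪ D`, placed at `u`. -/
def merge (z : State ι S) (C D : Finset ι) (u : S) : State ι S :=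
  fun E => if E = C ∪ D then Sum.inl u else if E = C ∨ E = D then Sum.inr () else z E

/-- The rate `K((X_C,|C|),(X_D,|D|))` at which `C` and `D` coagulate in the state `z`
(it is zero if `C`, `D` are not two distinct particles of `z`). -/
def pairRate (K : Particle S → Particle S → ℝ≥0) (z : State ι S) (C D : Finset ι) : ℝ≥0 :=
  match z C, z D with
  | Sum.inl x, Sum.inl y => if C = D then 0 else K (x, mass C) (y, mass D)
  | _, _ => 0

/-- The total coagulation rate: the sum of the pair rates over unordered pairs of particles.
The sum below runs over ordered pairs and so counts every unordered pair twice. -/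
def totalRate (K : Particle S → Particle S → ℝ≥0) (z : State ι S) : ℝ≥0 :=
  (∑ C, ∑ D, pairRate K z C D) / 2

/-- The law of the location of the particle resulting from the coagulation of `C` and `D`. -/
def placement (Υ : Kernel (Particle S × Particle S) S) (z : State ι S) (C D : Finset ι) :
    Measure S :=
  match z C, z D with
  | Sum.inl x, Sum.inl y => Υ ((x, mass C), (y, mass D))
  | _, _ => 0

/-- Prepend an entry to a sequence. -/
def consSeq {α : Type*} (a : α) (w : ℕ → α) : ℕ → α
  | 0 => a
  | k + 1 => w k

/-- A realisation of the labelled process, recorded as the sequence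
`(holding time, state)` of the successively visited states. An absorbing state has
holding time `∞`. -/
abbrev JumpRecord (ι S : Type*) := ℕ → ℝ≥0∞ × State ι S

/-- The law of the labelled coagulation process started in the state `z` (jump chain and holding
times). If the total rate `r` in `z` vanishes, the process stays in `z` forever. Otherwise it stays
in `z` for an exponential time of parameter `r`; independently of this time, the unordered pair
`{C, D}` is chosen with probability `K((X_C,|C|),(X_D,|D|)) / r` (that is, each of the ordered pairs
`(C, D)`, `(D, C)` with half this probability) and is replaced by `C ∪ D`, located at a
`Υ((X_C,|C|),(X_D,|D|), ·)`-distributed site; then the process starts afresh from the new state.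
Each jump lowers the number of particles by one, and there are no jumps from states with one
particle, so it suffices that the recursion parameter is at least the number of particles. -/
def jumpLaw (K : Particle S → Particle S → ℝ≥0) (Υ : Kernel (Particle S × Particle S) S) :
    ℕ → State ι S → Measure (JumpRecord ι S)
  | 0, z => Measure.dirac fun _ => (∞, z)
  | n + 1, z =>
    if totalRate K z = 0 then Measure.dirac fun _ => (∞, z)
    else
      (((expMeasure (totalRate K z)).map ENNReal.ofReal).prod
        (∑ C, ∑ D, (pairRate K z C D / (2 * totalRate K z)) •
          (placement Υ z C D).bind fun u => jumpLaw K Υ n (merge z C D u))).map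
        fun p => consSeq (p.1, z) p.2

/-- The law `P_x` of the labelled coagulation process with initial atom configuration `x`. -/
def labelledLaw (K : Particle S → Particle S → ℝ≥0) (Υ : Kernel (Particle S × Particle S) S)
    (x : ι → S) : Measure (JumpRecord ι S) :=
  jumpLaw K Υ (Fintype.card ι) (initState x)

/-- The state `Z_t` of the process at time `t`: the state visited during the `k`-th holding
interval, where `k` is minimal such that `t` lies before the end of this interval. -/
def stateAt (w : JumpRecord ι S) (t : ℝ) : State ι S :=
  (w (sInf {k : ℕ | ENNReal.ofReal t < ∑ l ∈ Finset.range (k + 1), (w l).1})).2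

/-- The point measure `∑ δ_{(X_D, |D|)}` over the particles `D ⊆ C` of the state `z`. -/
def subConfig (z : State ι S) (C : Finset ι) : Measure (Particle S) :=
  ∑ D ∈ C.powerset,
    match z D with
    | Sum.inl x => Measure.dirac (x, mass D)
    | Sum.inr _ => 0

end Labelled

/-! ### Coagulation trajectories -/

section Trajectories

variable {S : Type*} [MeasurableSpace S]

/-- The time interval `[0,T]`. -/
abbrev TimeInt (T : ℝ≥0) := Set.Icc (0 : ℝ) T

/-- Time zero. -/
def time0 (T : ℝ≥0) : TimeInt T := ⟨0, le_rfl, T.2⟩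

/-- The final time. -/
def timeT (T : ℝ≥0) : TimeInt T := ⟨T, T.2, le_rfl⟩

/-- A coagulation step `φ ↦ ψ = φ - δ_{(x,m)} - δ_{(x',m')} + δ_{(z,m+m')}`. -/
def IsStep (φ ψ : Measure (Particle S)) : Prop :=
  ∃ (x x' z : S) (m m' : ℕ+),
    ψ + Measure.dirac (x, m) + Measure.dirac (x', m') = φ + Measure.dirac (z, m + m')

/-- The set `Γ_T` of coagulation trajectories on `[0,T]`: paths with values in the finite point
measures (finite measures with values in `{0, 1, 2, …}`) on `S × ℕ` that start with particles of
mass one only and that are right-continuous and piecewise constant (constant on `[s_i, s_{i+1})`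
for finitely many times `0 = s_0 < s_1 < … < s_r ≤ T`, and on `[s_r, T]`), with a coagulation step
at each of the times `s_1, …, s_r`. -/
def IsTrajectory (T : ℝ≥0) (ξ : TimeInt T → Measure (Particle S)) : Prop :=
  (∀ t B, MeasurableSet B → ∃ n : ℕ, ξ t B = n) ∧
  ξ (time0 T) {p | p.2 ≠ 1} = 0 ∧
  ∃ (r : ℕ) (s : Fin (r + 1) → TimeInt T), StrictMono s ∧ s 0 = time0 T ∧
    (∀ i t, s i ≤ t → (∀ j, i < j → t < s j) → ξ t = ξ (s i)) ∧
    ∀ i : Fin r, IsStep (ξ (s i.castSucc)) (ξ (s i.succ))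

/-- The space `Γ_T^{(1)}` of one-particle coagulation trajectories on `[0,T]`: those which consist
of exactly one particle at time `T`. It carries the σ-algebra generated by the evaluations
`ξ ↦ ξ_t(B)`, `t ∈ [0,T]`, `B ⊆ S × ℕ` measurable. -/
abbrev Traj1 (S : Type*) [MeasurableSpace S] (T : ℝ≥0) :=
  {ξ : TimeInt T → Measure (Particle S) // IsTrajectory T ξ ∧ ξ (timeT T) Set.univ = 1}

/-- The number `|ξ_0|` of atoms of a trajectory. -/
def numAtoms {T : ℝ≥0} (ξ : Traj1 S T) : ℝ := (ξ.1 (time0 T) Set.univ).toReal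

/-- The interaction `R(ξ, ξ') = ∫_0^T ⟨ξ_t, K ξ'_t⟩ dt`. -/
def interaction {T : ℝ≥0} (K : Particle S → Particle S → ℝ≥0) (ξ ξ' : Traj1 S T) : ℝ :=
  (∫⁻ t : TimeInt T, ∫⁻ p, ∫⁻ q, (K p q : ℝ≥0∞) ∂(ξ'.1 t) ∂(ξ.1 t)
    ∂((volume : Measure ℝ).comap Subtype.val)).toReal

/-- The Dirac measure at the path `ξ` if `ξ ∈ Γ_T^{(1)}`, and the zero measure otherwise. -/
def diracTraj1 (T : ℝ≥0) (ξ : TimeInt T → Measure (Particle S)) : Measure (Traj1 S T) :=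
  open Classical in
  if h : IsTrajectory T ξ ∧ ξ (timeT T) Set.univ = 1 then Measure.dirac ⟨ξ, h⟩ else 0

/-- The subprocess `Ξ^{(T,C)}` on `[0,T]` that follows the atoms with labels in `C`. -/
def history {ι : Type*} [Fintype ι] [DecidableEq ι] (T : ℝ≥0) (w : JumpRecord ι S)
    (C : Finset ι) : TimeInt T → Measure (Particle S) :=
  fun t => subConfig (stateAt w t) C

/-- The process `Ξ` on `[0,T]` of the whole (unlabelled) configuration. -/
def wholeConfig {ι : Type*} [Fintype ι] [DecidableEq ι] (T : ℝ≥0) (w : JumpRecord ι S) :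
    TimeInt T → Measure (Particle S) :=
  history T w Finset.univ

/-- The normalised empirical measure `V_N = (1/N) ∑_{C ∈ P_T} δ_{Ξ^{(T,C)}}` of the trajectories of
the particles present at time `T`. (For `C ∈ P_T` the path `Ξ^{(T,C)}` lies in `Γ_T^{(1)}` outside
a null set.) -/
def empirical {ι : Type*} [Fintype ι] [DecidableEq ι] (N : ℕ) (T : ℝ≥0) (w : JumpRecord ι S) :
    Measure (Traj1 S T) :=
  (N : ℝ≥0∞)⁻¹ • ∑ C : Finset ι,
    match stateAt w T C with
    | Sum.inl _ => diracTraj1 T (history T w C)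
    | Sum.inr _ => 0

/-- The law `P_{Poi_{γ μ}}` of the labelled process under poissonised initial conditions, for a
probability measure `μ` and `γ ≥ 0`: the number `n` of atoms is Poisson distributed with
parameter `γ`, the atoms `x_1, …, x_n` are i.i.d. with law `μ`, and given the atoms the process has
the law `P_x`. A sample consists of `n` and of the realisation of the process. -/
def poissonisedLaw (K : Particle S → Particle S → ℝ≥0) (Υ : Kernel (Particle S × Particle S) S)
    (γ : ℝ≥0) (μ : Measure S) : Measure (Σ n : ℕ, JumpRecord (Fin n) S) :=
  (poissonMeasure γ).bind fun n =>
    ((Measure.pi fun _ : Fin n => μ).bind fun x => labelledLaw K Υ x).map (Sigma.mk n)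

/-- The reference measure `M_{bμ,N}(dξ) = N^{|ξ_0| - 1} e P_{Poi_{bμ}}(Ξ ∈ dξ)` on `Γ_T^{(1)}`:
the law of `Ξ` on `[0,T]` is restricted to `Γ_T^{(1)}`, and multiplied by the density. -/
def refMeasure (K : Particle S → Particle S → ℝ≥0) (Υ : Kernel (Particle S × Particle S) S)
    (b : ℝ≥0) (μ : Measure S) (N : ℕ) (T : ℝ≥0) : Measure (Traj1 S T) :=
  ((poissonisedLaw K Υ b μ).bind fun w => diracTraj1 T (wholeConfig T w.2)).withDensity
    fun ξ => ENNReal.ofReal ((N : ℝ) ^ (numAtoms ξ - 1) * Real.exp 1)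

end Trajectories

/-! ### Poisson point processes -/

section Poisson

variable {X Ω : Type*} [MeasurableSpace X] [MeasurableSpace Ω]

/-- The point measure `∑_{i < n} δ_{x_i}`. -/
def pointMeasure (n : ℕ) (x : ℕ → X) : Measure X :=
  ∑ i ∈ Finset.range n, Measure.dirac (x i)

/-- The finite random collection of points `Y = ∑_{i < n} δ_{x_i}`, with `n` and the `x_i` random,
is under `Q` a Poisson point process with finite intensity measure `M`: the numbers of points in
measurable sets `A` are Poisson distributed with parameter `M(A)`, and the numbers of points in
pairwise disjoint measurable sets are independent. -/
structure IsPoissonPointProcess (M : Measure X) (Q : Measure Ω) (n : Ω → ℕ) (x : ℕ → Ω → X) :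
    Prop where
  measurable_number : Measurable n
  measurable_point : ∀ i, Measurable (x i)
  law_count : ∀ A : Set X, MeasurableSet A →
    Q.map (fun ω => pointMeasure (n ω) (fun i => x i ω) A) =
      (poissonMeasure (M A).toNNReal).map (fun k : ℕ => (k : ℝ≥0∞))
  indep_count : ∀ (m : ℕ) (A : Fin m → Set X), (∀ i, MeasurableSet (A i)) →
    Pairwise (fun i j => Disjoint (A i) (A j)) →
    iIndepFun (fun i ω => pointMeasure (n ω) (fun j => x j ω) (A i)) Q

end Poisson

end Coag

end

noncomputable section

set_option linter.unusedSectionVars false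

namespace Coag

/-! ### The jump law as a measurable kernel; decomposition at the first jump. -/

section JumpLaw

variable {ι S : Type*} [Fintype ι] [DecidableEq ι] [MeasurableSpace S]
variable {K : Particle S → Particle S → ℝ≥0} {Υ : Kernel (Particle S × Particle S) S}

/-! Both expectations are multiples of one series, `poissonSeries`: the sum over `k` of `1/k!` times
the integral of `exp(-∑_{i<j} R(ξ_i,ξ_j)) f((1/N) ∑ δ_{ξ_i})` against the `k`-fold product of a
measure `singleTraj`. Under `singleTraj`, a one-particle trajectory with `n` atoms carries the
weight `N^n/n!`.

The left-hand side rests on decoupling (`lintegral_law_glue`). Split the atoms into two groups. As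
long as no particle has atoms of both groups, the total rate is the sum of the rates within the
groups plus the cross rate. The two groups therefore evolve as independent processes, and the
absence of cross coagulations costs the density `exp(-∫ crossRate dt)`. The proof decomposes at the
first jump. For the pair of independent processes this is a competition of two exponential clocks,
the loser starting afresh by lack of memory. Induction on the number of particles handles the rest.

If one group is a single particle at time `T`, the integrated cross rate is the sum of the
interactions of its history with the histories of the other particles, because `⟨φ, Kψ⟩` is bilinear
and each earlier particle lies in exactly one final particle. With i.i.d. initial sites only the
size of the group matters, and `N^n/n!` times the binomial coefficient factorises. Marking one of
the `k+1` final particles then gives a recursion from `k` to `k+1` particles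
(`lintegral_historyLaw_succ`). Iterating it (`lintegral_historyLaw_eq`) gives a density with respect
to a product measure, with `k!` in front; summing over `k` gives `e^{-N}` times the series
(`lintegral_empirical`).

For the right-hand side, a Poisson process with finite intensity `M` has the law of the mixture over
`k` of `e^{-|M|}/k!` times the image of `M^k` (`IsPoissonPointProcess.map_eq`, by characteristic
functionals). The intensity `N M_{bμ,N}` has the density `e^{1-b} b^n` with respect to `singleTraj`
(`smul_refMeasure_eq`). The factors `e^{(b-1)|I|}` and `b^{-∑|Ξ_{i,0}|}` cancel exactly this
density, so the expectation is `e^{-N|M_{bμ,N}|}` times the same series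
(`lintegral_tiltedFunctional`).

Measurability needs separate care, since trajectories form a subset of a product space over an
uncountable time set, and nothing is proved about measurability of that subset. Functionals are
therefore defined on all paths of measures, through values at countably many times, and transported
along the inclusion of trajectories into paths. -/

/-- A function of a pair of sums is measurable if its four branches are. -/
theorem measurable_sum_prod_sum {α β γ δ ε : Type*} [MeasurableSpace α] [MeasurableSpace β]
    [MeasurableSpace γ] [MeasurableSpace δ] [MeasurableSpace ε] {f : (α ⊕ β) × (γ ⊕ δ) → ε}
    (h1 : Measurable fun p : α × γ => f (Sum.inl p.1, Sum.inl p.2))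
    (h2 : Measurable fun p : α × δ => f (Sum.inl p.1, Sum.inr p.2))
    (h3 : Measurable fun p : β × γ => f (Sum.inr p.1, Sum.inl p.2))
    (h4 : Measurable fun p : β × δ => f (Sum.inr p.1, Sum.inr p.2)) : Measurable f := by
  have h : Measurable fun q : ((α × γ) ⊕ (α × δ)) ⊕ ((β × γ) ⊕ (β × δ)) =>
      Sum.elim (Sum.elim (fun p : α × γ => f (Sum.inl p.1, Sum.inl p.2))
        (fun p : α × δ => f (Sum.inl p.1, Sum.inr p.2)))
        (Sum.elim (fun p : β × γ => f (Sum.inr p.1, Sum.inl p.2))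
        (fun p : β × δ => f (Sum.inr p.1, Sum.inr p.2))) q :=
    (h1.sumElim h2).sumElim (h3.sumElim h4)
  intro s hs
  have h12 := h hs
  have e : f ⁻¹' s = (MeasurableEquiv.sumProdSum α β γ δ) ⁻¹'
      ((MeasurableEquiv.sumProdSum α β γ δ).symm ⁻¹' (f ⁻¹' s)) := by
    ext x; simp
  rw [e]
  refine (MeasurableEquiv.measurable _) ?_
  convert h12 using 1
  ext x
  rcases x with (⟨x, y⟩ | ⟨x, y⟩) | (⟨x, y⟩ | ⟨x, y⟩) <;> rfl

theorem measurable_pairRate (hK : Measurable (Function.uncurry K)) (C D : Finset ι) :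
    Measurable fun z : State ι S => pairRate K z C D := by
  have h : Measurable fun p : (S ⊕ Unit) × (S ⊕ Unit) =>
      (match p.1, p.2 with
      | Sum.inl x, Sum.inl y => if C = D then 0 else K (x, mass C) (y, mass D)
      | _, _ => 0 : ℝ≥0) := by
    apply measurable_sum_prod_sum
    · by_cases hCD : C = D
      · simp [hCD]
      · simp only [hCD, if_false]
        exact hK.comp (f := fun p : S × S => ((p.1, mass C), (p.2, mass D))) (by fun_prop)
    all_goals exact measurable_const
  exact h.comp (f := fun z : State ι S => (z C, z D)) (by fun_prop)

theorem measurable_totalRate (hK : Measurable (Function.uncurry K)) :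
    Measurable fun z : State ι S => totalRate K z := by
  unfold totalRate
  exact (Finset.measurable_fun_sum _ fun C _ => Finset.measurable_fun_sum _ fun D _ =>
    measurable_pairRate hK C D).div_const 2

theorem measurable_placement (C D : Finset ι) :
    Measurable fun z : State ι S => placement Υ z C D := by
  have h : Measurable fun p : (S ⊕ Unit) × (S ⊕ Unit) =>
      (match p.1, p.2 with
      | Sum.inl x, Sum.inl y => Υ ((x, mass C), (y, mass D))
      | _, _ => 0 : Measure S) := by
    apply measurable_sum_prod_sum
    · exact Υ.measurable.comp (f := fun p : S × S => ((p.1, mass C), (p.2, mass D))) (by fun_prop)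
    all_goals exact measurable_const
  exact h.comp (f := fun z : State ι S => (z C, z D)) (by fun_prop)

theorem measurable_merge (C D : Finset ι) :
    Measurable fun p : State ι S × S => merge p.1 C D p.2 := by
  refine measurable_pi_lambda _ fun E => ?_
  unfold merge
  split_ifs
  · exact measurable_inl.comp measurable_snd
  · exact measurable_const
  · exact (measurable_pi_apply E).comp measurable_fst

theorem measurable_consSeq {α : Type*} [MeasurableSpace α] :
    Measurable fun p : α × (ℕ → α) => consSeq p.1 p.2 := by
  refine measurable_pi_lambda _ fun k => ?_
  cases k with
  | zero => exact measurable_fst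
  | succ k => exact (measurable_pi_apply k).comp measurable_snd

/-- The placement law as a kernel. -/
def placementKernel (Υ : Kernel (Particle S × Particle S) S) (C D : Finset ι) :
    Kernel (State ι S) S := ⟨fun z => placement Υ z C D, measurable_placement C D⟩

theorem placement_apply_univ_le [IsMarkovKernel Υ] (z : State ι S) (C D : Finset ι) :
    placement Υ z C D Set.univ ≤ 1 := by
  unfold placement
  split <;> simp

instance [IsMarkovKernel Υ] (C D : Finset ι) : IsFiniteKernel (placementKernel (ι := ι) Υ C D) :=
  ⟨1, by simp, fun z => placement_apply_univ_le z C D⟩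

/-- Outside pairs of particles the placement is the zero measure; a nonzero rate excludes this case,
so no mass is lost at a jump. -/
theorem placement_apply_univ [IsMarkovKernel Υ] {z : State ι S} {C D : Finset ι}
    (h : pairRate K z C D ≠ 0) : placement Υ z C D Set.univ = 1 := by
  unfold placement
  unfold pairRate at h
  split <;> simp_all

theorem sum_pairRate (z : State ι S) :
    ∑ C, ∑ D, pairRate K z C D = 2 * totalRate K z := by
  unfold totalRate
  rw [mul_div_cancel₀]
  norm_num

/-- The integral against the exponential law. -/
theorem lintegral_expMeasure (r : ℝ) (f : ℝ → ℝ≥0∞) (hf : Measurable f) :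
    ∫⁻ s, f s ∂(expMeasure r) =
      ∫⁻ s in Set.Ioi 0, ENNReal.ofReal (r * Real.exp (-(r * s))) * f s := by
  have h : expMeasure r = volume.withDensity (exponentialPDF r) := rfl
  have hm : Measurable (exponentialPDF r) := (measurable_exponentialPDFReal r).ennreal_ofReal
  rw [h, lintegral_withDensity_eq_lintegral_mul _ hm hf,
    ← setLIntegral_congr (Ioi_ae_eq_Ici (a := (0 : ℝ)) (μ := volume)).symm,
    ← lintegral_indicator measurableSet_Ici]
  refine lintegral_congr fun s => ?_
  by_cases hs : 0 ≤ s
  · simp [Set.indicator, hs, exponentialPDF_of_nonneg hs]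
  · simp [Set.indicator, hs, exponentialPDF_of_neg (not_le.1 hs)]

/-- The measure on the future after the first jump, weighted by the jump rates. -/
def jumpMeasure (K : Particle S → Particle S → ℝ≥0) (Υ : Kernel (Particle S × Particle S) S)
    (n : ℕ) (z : State ι S) : Measure (JumpRecord ι S) :=
  ∑ C, ∑ D, (pairRate K z C D / 2) •
    (placement Υ z C D).bind fun u => jumpLaw K Υ n (merge z C D u)

theorem lintegral_jumpMeasure {n : ℕ} (hm : Measurable (jumpLaw K Υ n : State ι S → _))
    (z : State ι S) (F : JumpRecord ι S → ℝ≥0∞) (hF : Measurable F) :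
    ∫⁻ v, F v ∂(jumpMeasure K Υ n z) = ∑ C, ∑ D, ((pairRate K z C D / 2 : ℝ≥0) : ℝ≥0∞) *
      ∫⁻ u, ∫⁻ v, F v ∂(jumpLaw K Υ n (merge z C D u)) ∂(placement Υ z C D) := by
  unfold jumpMeasure
  simp only [lintegral_finsetSum_measure, lintegral_smul_measure]
  refine Finset.sum_congr rfl fun C _ => Finset.sum_congr rfl fun D _ => ?_
  rw [Measure.lintegral_bind _ hF.aemeasurable]
  · rfl
  · exact (hm.comp ((measurable_merge C D).comp measurable_prodMk_left)).aemeasurable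

/-- The parameter `a` will be the pair of the current state and the holding time, on both of which
the integrand depends through the prepended entry. -/
theorem measurable_lintegral_jumpMeasure [IsMarkovKernel Υ] (hK : Measurable (Function.uncurry K))
    {n : ℕ} (hm : Measurable (jumpLaw K Υ n : State ι S → _))
    (hp : ∀ z : State ι S, IsProbabilityMeasure (jumpLaw K Υ n z)) {α : Type*} [MeasurableSpace α]
    {g : α → State ι S} (hg : Measurable g)
    {F : α → JumpRecord ι S → ℝ≥0∞} (hF : Measurable (Function.uncurry F)) :
    Measurable fun a => ∫⁻ v, F a v ∂(jumpMeasure K Υ n (g a)) := by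
  have hF' : ∀ a, Measurable (F a) := fun a => hF.comp measurable_prodMk_left
  simp_rw [fun a => lintegral_jumpMeasure hm (g a) (F a) (hF' a)]
  refine Finset.measurable_fun_sum _ fun C _ => Finset.measurable_fun_sum _ fun D _ => ?_
  refine Measurable.mul ?_ ?_
  · exact (((measurable_pairRate hK C D).comp hg).div_const 2).coe_nnreal_ennreal
  · let κ : Kernel (State ι S) (JumpRecord ι S) := ⟨jumpLaw K Υ n, hm⟩
    have : IsMarkovKernel κ := ⟨hp⟩
    let κ' : Kernel (α × S) (JumpRecord ι S) := κ.comap (fun p => merge (g p.1) C D p.2)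
      ((measurable_merge C D).comp
        ((hg.comp measurable_fst).prodMk measurable_snd))
    have h1 : Measurable fun p : α × S => ∫⁻ v, F p.1 v ∂(κ' p) := by
      refine Measurable.lintegral_kernel_prod_right (κ := κ') (f := fun p v => F p.1 v) ?_
      exact hF.comp (f := fun q : (α × S) × JumpRecord ι S => (q.1.1, q.2)) (by fun_prop)
    let π : Kernel α S := (placementKernel (ι := ι) Υ C D).comap g hg
    exact Measurable.lintegral_kernel_prod_right (κ := π)
      (f := fun a u => ∫⁻ v, F a v ∂(κ' (a, u))) h1

/-- Each unordered pair contributes twice half its rate, and laws and placements have mass one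
wherever the rate is positive. -/
theorem jumpMeasure_univ [IsMarkovKernel Υ] {n : ℕ}
    (hm : Measurable (jumpLaw K Υ n : State ι S → _))
    (hp : ∀ z : State ι S, IsProbabilityMeasure (jumpLaw K Υ n z)) (z : State ι S) :
    jumpMeasure K Υ n z Set.univ = totalRate K z := by
  rw [← lintegral_one, lintegral_jumpMeasure hm _ _ measurable_const]
  have : ∀ C D, ((pairRate K z C D / 2 : ℝ≥0) : ℝ≥0∞) *
      ∫⁻ u, ∫⁻ v, 1 ∂(jumpLaw K Υ n (merge z C D u)) ∂(placement Υ z C D) =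
      ((pairRate K z C D / 2 : ℝ≥0) : ℝ≥0∞) := by
    intro C D
    by_cases h : pairRate K z C D = 0
    · simp [h]
    · simp [placement_apply_univ h]
  simp_rw [this]
  simp_rw [← ENNReal.ofNNReal_finsetSum, ← Finset.sum_div, sum_pairRate]
  rw [mul_div_cancel_left₀]
  norm_num

/-- The factor `r` of the exponential density cancels the normalisation `1/r` of the jump
probabilities. There remain the survival probability `e^{-rs}` and the unnormalised rates, a form in
which rates of different processes can be added. -/
theorem lintegral_jumpLaw_succ [IsMarkovKernel Υ] {n : ℕ}
    (hm : Measurable (jumpLaw K Υ n : State ι S → _))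
    (hp : ∀ z : State ι S, IsProbabilityMeasure (jumpLaw K Υ n z)) (z : State ι S)
    (hz : totalRate K z ≠ 0) (F : JumpRecord ι S → ℝ≥0∞) (hF : Measurable F) :
    ∫⁻ w, F w ∂(jumpLaw K Υ (n + 1) z) =
      ∫⁻ s in Set.Ioi (0 : ℝ), ENNReal.ofReal (Real.exp (-(totalRate K z * s))) *
        ∫⁻ v, F (consSeq (ENNReal.ofReal s, z) v) ∂(jumpMeasure K Υ n z) := by
  have hr : (0 : ℝ) < totalRate K z := by positivity
  rw [jumpLaw, if_neg hz]
  have e1 : (∑ C, ∑ D, (pairRate K z C D / (2 * totalRate K z)) •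
      (placement Υ z C D).bind fun u => jumpLaw K Υ n (merge z C D u)) =
      (totalRate K z)⁻¹ • jumpMeasure K Υ n z := by
    unfold jumpMeasure
    simp_rw [Finset.smul_sum, smul_smul]
    refine Finset.sum_congr rfl fun C _ => Finset.sum_congr rfl fun D _ => ?_
    congr 1
    field_simp
  have : IsFiniteMeasure (jumpMeasure K Υ n z) := ⟨by rw [jumpMeasure_univ hm hp]; simp⟩
  have hc : Measurable fun p : ℝ≥0∞ × JumpRecord ι S => consSeq (p.1, z) p.2 :=
    measurable_consSeq.comp ((measurable_fst.prodMk measurable_const).prodMk measurable_snd)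
  have : IsProbabilityMeasure (expMeasure (totalRate K z)) := isProbabilityMeasure_expMeasure hr
  have hFc : Measurable fun p : ℝ≥0∞ × JumpRecord ι S => F (consSeq (p.1, z) p.2) := hF.comp hc
  rw [e1, lintegral_map hF hc, lintegral_prod _ hFc.aemeasurable, lintegral_map _
    ENNReal.measurable_ofReal, lintegral_expMeasure _]
  · refine lintegral_congr fun s => ?_
    rw [lintegral_smul_measure, ENNReal.smul_def, smul_eq_mul, ← mul_assoc]
    congr 1
    rw [ENNReal.ofReal_mul hr.le, mul_comm, ← mul_assoc, ENNReal.coe_inv hz,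
      ENNReal.ofReal_coe_nnreal, ENNReal.inv_mul_cancel (by simpa using hz) (by simp), one_mul]
  · exact (Measurable.lintegral_prod_right' hFc).comp ENNReal.measurable_ofReal
  · exact Measurable.lintegral_prod_right' hFc

/-- The two claims are proved together, since measurability at `n + 1` uses that the laws at `n`
form a Markov kernel. -/
theorem measurable_jumpLaw_and_prob [IsMarkovKernel Υ] (hK : Measurable (Function.uncurry K))
    (n : ℕ) : Measurable (jumpLaw K Υ n : State ι S → _) ∧
      ∀ z : State ι S, IsProbabilityMeasure (jumpLaw K Υ n z) := by
  induction n with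
  | zero =>
    refine ⟨?_, fun z => by unfold jumpLaw; infer_instance⟩
    have : (jumpLaw K Υ 0 : State ι S → _) = fun z => Measure.dirac fun _ => (∞, z) := by
      funext z; rw [jumpLaw]
    rw [this]
    exact Measure.measurable_dirac.comp (by fun_prop)
  | succ n ih =>
    obtain ⟨hm, hp⟩ := ih
    have hset : MeasurableSet {z : State ι S | totalRate K z = 0} :=
      measurable_totalRate hK (measurableSet_singleton 0)
    constructor
    · refine Measure.measurable_of_measurable_coe _ fun B hB => ?_
      have : (fun z : State ι S => jumpLaw K Υ (n + 1) z B) = fun z =>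
          if totalRate K z = 0 then Measure.dirac (fun _ => (∞, z) : JumpRecord ι S) B else
          ∫⁻ s in Set.Ioi (0 : ℝ), ENNReal.ofReal (Real.exp (-(totalRate K z * s))) *
          ∫⁻ v, B.indicator 1 (consSeq (ENNReal.ofReal s, z) v) ∂(jumpMeasure K Υ n z) := by
        funext z
        split_ifs with h
        · rw [jumpLaw, if_pos h]
        · rw [← lintegral_jumpLaw_succ hm hp z h _ (measurable_one.indicator hB),
            lintegral_indicator_one hB]
      rw [this]
      refine Measurable.ite hset ?_ ?_
      · exact Measure.measurable_measure.1 Measure.measurable_dirac B hB |>.comp (by fun_prop)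
      · refine Measurable.lintegral_prod_right' (f := fun p : State ι S × ℝ =>
          ENNReal.ofReal (Real.exp (-(totalRate K p.1 * p.2))) *
          ∫⁻ v, B.indicator 1 (consSeq (ENNReal.ofReal p.2, p.1) v) ∂(jumpMeasure K Υ n p.1)) ?_
        refine Measurable.mul ?_ ?_
        · have h2 : Measurable fun p : State ι S × ℝ => (totalRate K p.1 : ℝ) :=
            ((measurable_totalRate hK).comp measurable_fst).coe_nnreal_real
          fun_prop
        · refine measurable_lintegral_jumpMeasure hK hm hp measurable_fst ?_
          refine (measurable_one.indicator hB).comp (f := fun q : (State ι S × ℝ) × JumpRecord ι S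
            => consSeq (ENNReal.ofReal q.1.2, q.1.1) q.2) ?_
          exact measurable_consSeq.comp (f := fun q : (State ι S × ℝ) × JumpRecord ι S
            => ((ENNReal.ofReal q.1.2, q.1.1), q.2)) (by fun_prop)
    · intro z
      by_cases h : totalRate K z = 0
      · rw [jumpLaw, if_pos h]; infer_instance
      · constructor
        have hr : (0 : ℝ) < totalRate K z := by positivity
        rw [← lintegral_one, lintegral_jumpLaw_succ hm hp z h _ measurable_const]
        simp only [lintegral_one, jumpMeasure_univ hm hp]
        have := (isProbabilityMeasure_expMeasure hr).measure_univ
        rw [← lintegral_one, lintegral_expMeasure _ _ measurable_const] at this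
        rw [← this]
        refine lintegral_congr fun s => ?_
        rw [ENNReal.ofReal_mul hr.le, mul_one, mul_comm, ENNReal.ofReal_coe_nnreal]

/-! ### The number of particles and the stabilised law -/

/-- The set of blocks of a state. -/
def blocks (z : State ι S) : Finset (Finset ι) := Finset.univ.filter fun C => (z C).isLeft

theorem mem_blocks {z : State ι S} {C : Finset ι} : C ∈ blocks z ↔ (z C).isLeft := by
  simp [blocks]

/-- The decreasing quantity of all inductions over jumps. Only an inequality is available, because
`z` need not be a partition and `C ∪ D` may already be a block. -/
theorem blocks_merge_card_lt {z : State ι S} {C D : Finset ι} (hC : C ∈ blocks z)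
    (hD : D ∈ blocks z) (hCD : C ≠ D) (u : S) : (blocks (merge z C D u)).card < (blocks z).card := by
  have hsub : blocks (merge z C D u) ⊆ insert (C ∪ D) (((blocks z).erase C).erase D) := by
    intro E hE
    rw [mem_blocks, merge] at hE
    split_ifs at hE with h1 h2
    · simp [h1]
    · simp at hE
    · push Not at h2
      simp [h2, mem_blocks, hE]
  have h1 : (((blocks z).erase C).erase D).card + 2 = (blocks z).card := by
    have hD' : D ∈ (blocks z).erase C := Finset.mem_erase.2 ⟨hCD.symm, hD⟩
    rw [← Finset.card_erase_add_one hC, ← Finset.card_erase_add_one hD']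
  have := Finset.card_le_card hsub
  have := Finset.card_insert_le (C ∪ D) (((blocks z).erase C).erase D)
  omega

theorem pairRate_ne_zero {z : State ι S} {C D : Finset ι} (h : pairRate K z C D ≠ 0) :
    C ∈ blocks z ∧ D ∈ blocks z ∧ C ≠ D := by
  unfold pairRate at h
  simp only [mem_blocks]
  split at h <;> simp_all

/-- Every jump of positive rate removes a block, so the recursion reaches an absorbing state before
its parameter is exhausted. -/
theorem jumpLaw_succ_eq (n : ℕ) (z : State ι S) (h : (blocks z).card ≤ n) :
    jumpLaw K Υ (n + 1) z = jumpLaw K Υ n z := by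
  induction n generalizing z with
  | zero =>
    have : totalRate K z = 0 := by
      unfold totalRate
      have : ∀ C D, pairRate K z C D = 0 := by
        intro C D
        by_contra hne
        have := (pairRate_ne_zero hne).1
        simp only [nonpos_iff_eq_zero, Finset.card_eq_zero] at h
        simp [h] at this
      simp [this]
    rw [jumpLaw.eq_2, if_pos this, jumpLaw]
  | succ n ih =>
    rw [jumpLaw, jumpLaw]
    have e : ∀ C D, (pairRate K z C D / (2 * totalRate K z)) • (placement Υ z C D).bind
        (fun u => jumpLaw K Υ (n + 1) (merge z C D u)) =
        (pairRate K z C D / (2 * totalRate K z)) • (placement Υ z C D).bind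
        (fun u => jumpLaw K Υ n (merge z C D u)) := by
      intro C D
      by_cases hne : pairRate K z C D = 0
      · simp [hne]
      · obtain ⟨hC, hD, hCD⟩ := pairRate_ne_zero hne
        congr 2
        funext u
        exact ih _ (by have := blocks_merge_card_lt hC hD hCD u; omega)
    simp_rw [e]

theorem jumpLaw_eq_of_le {m n : ℕ} (z : State ι S) (h : (blocks z).card ≤ n) (hmn : n ≤ m) :
    jumpLaw K Υ m z = jumpLaw K Υ n z := by
  induction m, hmn using Nat.le_induction with
  | base => rfl
  | succ m hm ih => rw [jumpLaw_succ_eq _ _ (h.trans hm), ih]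

/-- The law of the process started in `z`. -/
def law (K : Particle S → Particle S → ℝ≥0) (Υ : Kernel (Particle S × Particle S) S)
    (z : State ι S) : Measure (JumpRecord ι S) := jumpLaw K Υ (Fintype.card (Finset ι)) z

/-- The number of all label sets bounds the number of blocks of any state, so one recursion
parameter serves all states at once. -/
theorem jumpLaw_eq_law {n : ℕ} (z : State ι S) (h : (blocks z).card ≤ n) :
    jumpLaw K Υ n z = law K Υ z := by
  have hz : (blocks z).card ≤ Fintype.card (Finset ι) := Finset.card_le_univ _
  unfold law
  rw [jumpLaw_eq_of_le z le_rfl h, jumpLaw_eq_of_le z le_rfl hz]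

theorem measurable_law [IsMarkovKernel Υ] (hK : Measurable (Function.uncurry K)) :
    Measurable (law K Υ : State ι S → _) := (measurable_jumpLaw_and_prob hK _).1

theorem isProbabilityMeasure_law [IsMarkovKernel Υ] (hK : Measurable (Function.uncurry K))
    (z : State ι S) : IsProbabilityMeasure (law K Υ z) := (measurable_jumpLaw_and_prob hK _).2 z

/-- The measure on the future after the first jump from `z`, weighted by the jump rates. -/
def future (K : Particle S → Particle S → ℝ≥0) (Υ : Kernel (Particle S × Particle S) S)
    (z : State ι S) : Measure (JumpRecord ι S) := jumpMeasure K Υ (Fintype.card (Finset ι)) z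

theorem lintegral_future [IsMarkovKernel Υ] (hK : Measurable (Function.uncurry K))
    (z : State ι S) (F : JumpRecord ι S → ℝ≥0∞) (hF : Measurable F) :
    ∫⁻ v, F v ∂(future K Υ z) = ∑ C, ∑ D, ((pairRate K z C D / 2 : ℝ≥0) : ℝ≥0∞) *
      ∫⁻ u, ∫⁻ v, F v ∂(law K Υ (merge z C D u)) ∂(placement Υ z C D) :=
  lintegral_jumpMeasure (measurable_jumpLaw_and_prob hK _).1 _ _ hF

theorem future_univ [IsMarkovKernel Υ] (hK : Measurable (Function.uncurry K)) (z : State ι S) :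
    future K Υ z Set.univ = totalRate K z :=
  jumpMeasure_univ (measurable_jumpLaw_and_prob hK _).1 (measurable_jumpLaw_and_prob hK _).2 _

theorem isFiniteMeasure_future [IsMarkovKernel Υ] (hK : Measurable (Function.uncurry K))
    (z : State ι S) : IsFiniteMeasure (future K Υ z) := ⟨by rw [future_univ hK]; simp⟩

theorem law_of_totalRate_eq_zero {z : State ι S} (h : totalRate K z = 0) :
    law K Υ z = Measure.dirac fun _ => (∞, z) := by
  unfold law
  cases Fintype.card (Finset ι) with
  | zero => rfl
  | succ n => rw [jumpLaw, if_pos h]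

/-- The renewal equation. Raising the recursion parameter by one does not change the law, so the
same `law` stands on both sides after unfolding one jump. -/
theorem lintegral_law [IsMarkovKernel Υ] (hK : Measurable (Function.uncurry K)) (z : State ι S)
    (hz : totalRate K z ≠ 0) (F : JumpRecord ι S → ℝ≥0∞) (hF : Measurable F) :
    ∫⁻ w, F w ∂(law K Υ z) =
      ∫⁻ s in Set.Ioi (0 : ℝ), ENNReal.ofReal (Real.exp (-(totalRate K z * s))) *
        ∫⁻ v, F (consSeq (ENNReal.ofReal s, z) v) ∂(future K Υ z) := by
  have h : law K Υ z = jumpLaw K Υ (Fintype.card (Finset ι) + 1) z :=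
    (jumpLaw_eq_law z ((Finset.card_le_univ _).trans (Nat.le_succ _))).symm
  rw [h, lintegral_jumpLaw_succ (measurable_jumpLaw_and_prob hK _).1
    (measurable_jumpLaw_and_prob hK _).2 z hz F hF]
  rfl

end JumpLaw

/-! ### Induction over jumps; the path of a record and its almost sure structure. -/

section Realisations

variable {ι S : Type*} [Fintype ι] [DecidableEq ι] [MeasurableSpace S]
variable {K : Particle S → Particle S → ℝ≥0} {Υ : Kernel (Particle S × Particle S) S}

theorem ae_future [IsMarkovKernel Υ] (hK : Measurable (Function.uncurry K)) {z : State ι S}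
    {P : JumpRecord ι S → Prop} (hP : MeasurableSet {w | P w})
    (h : ∀ C D u, C ∈ blocks z → D ∈ blocks z → C ≠ D →
      ∀ᵐ v ∂(law K Υ (merge z C D u)), P v) : ∀ᵐ v ∂(future K Υ z), P v := by
  rw [Filter.Eventually, mem_ae_iff, ← lintegral_indicator_one hP.compl,
    lintegral_future hK _ _ (measurable_one.indicator hP.compl)]
  refine Finset.sum_eq_zero fun C _ => Finset.sum_eq_zero fun D _ => ?_
  by_cases hne : pairRate K z C D = 0
  · simp [hne]
  · obtain ⟨hC, hD, hCD⟩ := pairRate_ne_zero hne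
    simp_rw [lintegral_indicator_one hP.compl]
    have : ∀ u, law K Υ (merge z C D u) {w | P w}ᶜ = 0 := fun u => h C D u hC hD hCD
    simp [this]

/-- An induction principle for almost sure properties: by induction on the number of blocks it
suffices to treat constant records and the prepending of one jump. -/
theorem ae_law [IsMarkovKernel Υ] (hK : Measurable (Function.uncurry K))
    {P : State ι S → JumpRecord ι S → Prop} (hP : ∀ z, MeasurableSet {w | P z w})
    (h0 : ∀ z, P z fun _ => (∞, z))
    (h1 : ∀ z C D u s v, 0 < s → C ∈ blocks z → D ∈ blocks z → C ≠ D → P (merge z C D u) v →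
      P z (consSeq (ENNReal.ofReal s, z) v)) (z : State ι S) : ∀ᵐ w ∂(law K Υ z), P z w := by
  induction hn : (blocks z).card using Nat.strong_induction_on generalizing z with
  | _ n ih =>
    by_cases hz : totalRate K z = 0
    · rw [law_of_totalRate_eq_zero hz, ae_dirac_iff (hP z)]
      exact h0 z
    · rw [Filter.Eventually, mem_ae_iff, ← lintegral_indicator_one (hP z).compl,
        lintegral_law hK _ hz _ (measurable_one.indicator (hP z).compl)]
      rw [setLIntegral_congr_fun (g := fun _ => 0) measurableSet_Ioi, lintegral_zero]
      intro s hs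
      have hc : Measurable fun v : JumpRecord ι S => consSeq (ENNReal.ofReal s, z) v :=
        measurable_consSeq.comp (measurable_const.prodMk measurable_id)
      have : ∀ᵐ v ∂(future K Υ z), P z (consSeq (ENNReal.ofReal s, z) v) := by
        refine ae_future hK (hc (hP z)) fun C D u hC hD hCD => ?_
        filter_upwards [ih _ (hn ▸ blocks_merge_card_lt hC hD hCD u) _ rfl] with v hv
        exact h1 z C D u s v hs hC hD hCD hv
      have e : ∫⁻ v, ({w | P z w}ᶜ).indicator 1 (consSeq (ENNReal.ofReal s, z) v)
          ∂(future K Υ z) = 0 := by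
        rw [lintegral_congr_ae (g := fun _ => 0), lintegral_zero]
        filter_upwards [this] with v hv
        simp [hv]
      simp only
      rw [e, mul_zero]

/-! ### The state at a given time -/

theorem measurable_stateAt_uncurry :
    Measurable fun p : ℝ × JumpRecord ι S => stateAt p.2 p.1 := by
  let A : ℕ → Set (ℝ × JumpRecord ι S) := fun k =>
    {p | ENNReal.ofReal p.1 < ∑ l ∈ Finset.range (k + 1), (p.2 l).1}
  have hA : ∀ k, MeasurableSet (A k) := by
    intro k
    refine measurableSet_lt (by fun_prop) ?_
    refine Finset.measurable_fun_sum _ fun l _ => ?_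
    exact measurable_fst.comp ((measurable_pi_apply l).comp measurable_snd)
  have hN : Measurable fun p : ℝ × JumpRecord ι S => sInf {k : ℕ | p ∈ A k} := by
    refine measurable_to_countable' fun n => ?_
    -- The infimum of the empty set of naturals is `0`, so the fibre over `0` also contains the
    -- records whose holding times never exceed the given time.
    have : (fun p : ℝ × JumpRecord ι S => sInf {k : ℕ | p ∈ A k}) ⁻¹' {n} =
        (A n ∩ ⋂ j ∈ Set.Iio n, (A j)ᶜ) ∪ (if n = 0 then ⋂ j, (A j)ᶜ else ∅) := by
      ext p
      simp only [Set.mem_preimage, Set.mem_singleton_iff, Set.mem_union, Set.mem_inter_iff,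
        Set.mem_iInter, Set.mem_Iio, Set.mem_compl_iff]
      constructor
      · intro h
        by_cases hne : {k : ℕ | p ∈ A k}.Nonempty
        · left
          refine ⟨by have := Nat.sInf_mem hne; rwa [h] at this, fun j hj => ?_⟩
          exact Nat.notMem_of_lt_sInf (s := {k | p ∈ A k}) (h ▸ hj)
        · right
          rw [Set.not_nonempty_iff_eq_empty] at hne
          rw [hne, Nat.sInf_empty] at h
          rw [if_pos h.symm]
          simp only [Set.mem_iInter, Set.mem_compl_iff]
          intro j hj
          have : j ∈ {k : ℕ | p ∈ A k} := hj
          rw [hne] at this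
          exact this
      · rintro (⟨h1, h2⟩ | h)
        · refine le_antisymm (Nat.sInf_le h1) ?_
          by_contra hlt
          exact h2 _ (not_le.1 hlt) (Nat.sInf_mem (s := {k | p ∈ A k}) ⟨n, h1⟩)
        · split_ifs at h with hn
          · have : {k : ℕ | p ∈ A k} = ∅ := by
              ext k; simp only [Set.mem_iInter, Set.mem_compl_iff] at h; simp [h k]
            rw [this, Nat.sInf_empty, hn]
          · simp at h
    rw [this]
    refine MeasurableSet.union ((hA n).inter ?_) ?_
    · exact MeasurableSet.biInter (Set.to_countable _) fun j _ => (hA j).compl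
    · split_ifs
      · exact MeasurableSet.iInter fun j => (hA j).compl
      · exact MeasurableSet.empty
  have h2 : Measurable fun q : ℕ × JumpRecord ι S => (q.2 q.1).2 :=
    measurable_from_prod_countable_right fun k => measurable_snd.comp (measurable_pi_apply k)
  exact h2.comp (hN.prodMk measurable_snd)

theorem measurable_stateAt (t : ℝ) : Measurable fun w : JumpRecord ι S => stateAt w t :=
  measurable_stateAt_uncurry.comp measurable_prodMk_left

theorem measurable_path : Measurable fun w : JumpRecord ι S => stateAt w :=
  measurable_pi_lambda _ fun t => measurable_stateAt t

theorem stateAt_of_lt {w : JumpRecord ι S} {t : ℝ} (h : ENNReal.ofReal t < (w 0).1) :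
    stateAt w t = (w 0).2 := by
  unfold stateAt
  have : sInf {k : ℕ | ENNReal.ofReal t < ∑ l ∈ Finset.range (k + 1), (w l).1} = 0 := by
    refine Nat.sInf_eq_zero.2 (Or.inl ?_)
    simpa using h
  rw [this]

theorem stateAt_consSeq_of_lt {s t : ℝ} (hs : 0 < s) (ht : t < s) (z : State ι S)
    (v : JumpRecord ι S) : stateAt (consSeq (ENNReal.ofReal s, z) v) t = z :=
  stateAt_of_lt (w := consSeq (ENNReal.ofReal s, z) v) ((ENNReal.ofReal_lt_ofReal_iff hs).2 ht)

theorem ofReal_lt_ofReal_add_iff {s t : ℝ} (hs : 0 ≤ s) (ht : s ≤ t) (x : ℝ≥0∞) :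
    ENNReal.ofReal t < ENNReal.ofReal s + x ↔ ENNReal.ofReal (t - s) < x := by
  have : ENNReal.ofReal t = ENNReal.ofReal s + ENNReal.ofReal (t - s) := by
    rw [← ENNReal.ofReal_add hs (by linarith)]; congr 1; ring
  rw [this, ENNReal.add_lt_add_iff_left (by simp)]

theorem stateAt_consSeq_of_ge {s t : ℝ} (hs : 0 ≤ s) (ht : s ≤ t) (z : State ι S)
    {v : JumpRecord ι S} (hv : ∃ k, (v k).1 = ∞) :
    stateAt (consSeq (ENNReal.ofReal s, z) v) t = stateAt v (t - s) := by
  unfold stateAt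
  set P : ℕ → Prop := fun k => ENNReal.ofReal t <
    ∑ l ∈ Finset.range (k + 1), (consSeq (ENNReal.ofReal s, z) v l).1
  set Q : ℕ → Prop := fun k => ENNReal.ofReal (t - s) < ∑ l ∈ Finset.range (k + 1), (v l).1
  have hPQ : ∀ k, P (k + 1) ↔ Q k := by
    intro k
    simp only [P, Q]
    rw [Finset.sum_range_succ', add_comm]
    exact ofReal_lt_ofReal_add_iff hs ht _
  have hP0 : ¬ P 0 := by
    simp only [P]
    simpa [consSeq] using ENNReal.ofReal_le_ofReal ht
  -- An infinite holding time is needed here: otherwise both infima could be those of the empty set,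
  -- namely `0`, and the indices would not be shifted by one.
  have hQ : ∃ k, Q k := by
    obtain ⟨k, hk⟩ := hv
    refine ⟨k, ?_⟩
    simp only [Q]
    rw [Finset.sum_range_succ, hk]
    simp
  have : sInf {k | P k} = sInf {k | Q k} + 1 := by
    have hP : ∃ k, P k := hQ.imp' (· + 1) fun k => (hPQ k).2
    apply le_antisymm
    · exact Nat.sInf_le ((hPQ _).2 (Nat.sInf_mem (s := {k | Q k}) hQ))
    · have hm := Nat.sInf_mem (s := {k | P k}) hP
      rcases h : sInf {k | P k} with _ | j
      · rw [h] at hm; exact absurd hm hP0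
      · rw [h] at hm
        exact Nat.succ_le_succ (Nat.sInf_le ((hPQ j).1 hm))
  show (consSeq (ENNReal.ofReal s, z) v (sInf {k | P k})).2 = (v (sInf {k | Q k})).2
  rw [this]
  rfl

/-- Add the time `s` to the first holding time. -/
def delay (s : ℝ) (w : JumpRecord ι S) : JumpRecord ι S :=
  consSeq (ENNReal.ofReal s + (w 0).1, (w 0).2) fun k => w (k + 1)

theorem measurable_delay : Measurable fun p : ℝ × JumpRecord ι S => delay p.1 p.2 := by
  refine measurable_consSeq.comp (Measurable.prodMk (Measurable.prodMk ?_ ?_) ?_)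
  · have : Measurable fun p : ℝ × JumpRecord ι S => (p.2 0).1 :=
      measurable_fst.comp ((measurable_pi_apply 0).comp measurable_snd)
    fun_prop
  · exact measurable_snd.comp ((measurable_pi_apply 0).comp measurable_snd)
  · exact measurable_pi_lambda _ fun k => (measurable_pi_apply (k + 1)).comp measurable_snd

theorem delay_const (s : ℝ) (z : State ι S) :
    delay s (fun _ => (∞, z)) = fun _ => (∞, z) := by
  funext k
  cases k <;> simp [delay, consSeq]

theorem delay_consSeq {s t : ℝ} (hs : 0 ≤ s) (ht : 0 ≤ t) (z : State ι S) (v : JumpRecord ι S) :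
    delay s (consSeq (ENNReal.ofReal t, z) v) = consSeq (ENNReal.ofReal (s + t), z) v := by
  funext k
  cases k <;> simp [delay, consSeq, ENNReal.ofReal_add hs ht]

theorem stateAt_delay_of_lt {s t : ℝ} (hs : 0 < s) (ht : t < s) (w : JumpRecord ι S) :
    stateAt (delay s w) t = (w 0).2 :=
  stateAt_of_lt (w := delay s w)
    (((ENNReal.ofReal_lt_ofReal_iff hs).2 ht).trans_le (le_self_add (a := ENNReal.ofReal s)))

/-- A delay keeps the indices of the entries, so the two index sets coincide even when they are
empty and no infinite holding time is required. -/
theorem stateAt_delay_of_ge {s t : ℝ} (hs : 0 ≤ s) (ht : s ≤ t) (w : JumpRecord ι S) :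
    stateAt (delay s w) t = stateAt w (t - s) := by
  unfold stateAt
  have : {k : ℕ | ENNReal.ofReal t < ∑ l ∈ Finset.range (k + 1), (delay s w l).1} =
      {k : ℕ | ENNReal.ofReal (t - s) < ∑ l ∈ Finset.range (k + 1), (w l).1} := by
    ext k
    simp only [Set.mem_ofPred_eq]
    have e : ∑ l ∈ Finset.range (k + 1), (delay s w l).1 =
        ENNReal.ofReal s + ∑ l ∈ Finset.range (k + 1), (w l).1 := by
      rw [Finset.sum_range_succ', Finset.sum_range_succ' (fun l => (w l).1)]
      simp only [delay, consSeq]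
      ring
    rw [e]
    exact ofReal_lt_ofReal_add_iff hs ht _
  rw [this]
  rcases sInf {k : ℕ | ENNReal.ofReal (t - s) < ∑ l ∈ Finset.range (k + 1), (w l).1} with _ | k <;>
    rfl

/-! ### Almost sure properties of the realisations -/

/-- The records that arise from the state `z` by successive coagulations, with positive holding
times, up to an infinite holding time. -/
inductive IsRealisation : State ι S → JumpRecord ι S → Prop
  | stay (z : State ι S) (w : JumpRecord ι S) (h : w 0 = (∞, z)) : IsRealisation z w
  | jump (z : State ι S) (C D : Finset ι) (u : S) (s : ℝ) (v : JumpRecord ι S) (hs : 0 < s)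
      (hC : C ∈ blocks z) (hD : D ∈ blocks z) (hCD : C ≠ D)
      (hv : IsRealisation (merge z C D u) v) :
      IsRealisation z (consSeq (ENNReal.ofReal s, z) v)

/-- `z'` arises from `z` by a coagulation. -/
def IsMerge (z z' : State ι S) : Prop :=
  ∃ C D, C ∈ blocks z ∧ D ∈ blocks z ∧ C ≠ D ∧ (z' (C ∪ D)).isLeft ∧
    ∀ E, E ≠ C ∪ D → z' E = if E = C ∨ E = D then Sum.inr () else z E

theorem isMerge_merge {z : State ι S} {C D : Finset ι} (hC : C ∈ blocks z) (hD : D ∈ blocks z)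
    (hCD : C ≠ D) (u : S) : IsMerge z (merge z C D u) :=
  ⟨C, D, hC, hD, hCD, by simp [merge], fun E hE => by simp [merge, hE]⟩

theorem IsMerge.exists_eq {z z' : State ι S} (h : IsMerge z z') :
    ∃ C D u, C ∈ blocks z ∧ D ∈ blocks z ∧ C ≠ D ∧ z' = merge z C D u := by
  obtain ⟨C, D, hC, hD, hCD, hl, h⟩ := h
  obtain ⟨u, hu⟩ := Sum.isLeft_iff.1 hl
  refine ⟨C, D, u, hC, hD, hCD, funext fun E => ?_⟩
  by_cases hE : E = C ∪ D
  · simp [merge, hE, hu]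
  · rw [h E hE]; simp [merge, hE]

instance instMeasurableEqSum {α β : Type*} [MeasurableSpace α] [MeasurableSpace β]
    [MeasurableEq α] [MeasurableEq β] : MeasurableEq (α ⊕ β) := by
  constructor
  have : Measurable fun p : (α ⊕ β) × (α ⊕ β) => p.1 = p.2 := by
    apply measurable_sum_prod_sum
    · simp only [Sum.inl.injEq]; exact Measurable.eq measurable_fst measurable_snd
    · simp
    · simp
    · simp only [Sum.inr.injEq]; exact Measurable.eq measurable_fst measurable_snd
  exact measurableSet_setOfPred.2 this

theorem measurableSet_isLeft {α β : Type*} [MeasurableSpace α] [MeasurableSpace β] :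
    MeasurableSet {x : α ⊕ β | x.isLeft} := by
  have : {x : α ⊕ β | x.isLeft} = Set.range Sum.inl := by
    ext x; cases x <;> simp
  rw [this]
  exact measurableSet_range_inl

theorem measurableSet_mem_blocks (C : Finset ι) : MeasurableSet {z : State ι S | C ∈ blocks z} := by
  simp_rw [mem_blocks]
  exact measurableSet_isLeft.preimage (measurable_pi_apply C)

/-- `IsMerge` asks only that `C ∪ D` be occupied and does not quantify over its site, so the set is
built by finitely many operations indexed by label sets. Equality of the other coordinates is
measurable because the diagonal of `S` is. -/
theorem measurableSet_isMerge [MeasurableEq S] :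
    MeasurableSet {p : State ι S × State ι S | IsMerge p.1 p.2} := by
  unfold IsMerge
  simp only [Set.ofPred_exists, Set.ofPred_and, Set.ofPred_forall]
  refine MeasurableSet.iUnion fun C => MeasurableSet.iUnion fun D => ?_
  refine ((measurableSet_mem_blocks C).preimage measurable_fst).inter
    (((measurableSet_mem_blocks D).preimage measurable_fst).inter
    ((MeasurableSet.iInter fun _ => MeasurableSet.const False).inter (MeasurableSet.inter ?_ ?_)))
  · exact measurableSet_isLeft.preimage ((measurable_pi_apply (C ∪ D)).comp measurable_snd)
  · refine MeasurableSet.iInter fun E => MeasurableSet.iInter fun _ => ?_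
    refine measurableSet_eq_fun ((measurable_pi_apply E).comp measurable_snd) ?_
    split_ifs
    · exact measurable_const
    · exact (measurable_pi_apply E).comp measurable_fst

/-- A measurable description of the realisations. -/
def StepsAreMerges (z : State ι S) (w : JumpRecord ι S) : Prop :=
  (w 0).2 = z ∧ ∀ k, (w k).1 ≠ 0 ∧ ((w k).1 = ∞ ∨ IsMerge (w k).2 (w (k + 1)).2)

theorem measurableSet_stepsAreMerges [MeasurableEq S] (z : State ι S) :
    MeasurableSet {w | StepsAreMerges z w} := by
  unfold StepsAreMerges
  simp only [Set.ofPred_and, Set.ofPred_forall, Set.ofPred_or]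
  have h1 : ∀ k, Measurable fun w : JumpRecord ι S => (w k).1 := fun k =>
    measurable_fst.comp (measurable_pi_apply k)
  have h2 : ∀ k, Measurable fun w : JumpRecord ι S => (w k).2 := fun k =>
    measurable_snd.comp (measurable_pi_apply k)
  refine ((h2 0) (measurableSet_singleton z)).inter (MeasurableSet.iInter fun k => ?_)
  refine ((h1 k) (measurableSet_singleton 0).compl).inter ?_
  exact ((h1 k) (measurableSet_singleton ∞)).union
    (((h2 k).prodMk (h2 (k + 1))) measurableSet_isMerge)

/-- Coagulations cannot continue forever, since each lowers the number of blocks; hence an infinite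
holding time is met after finitely many entries. -/
theorem StepsAreMerges.isRealisation {z : State ι S} {w : JumpRecord ι S}
    (h : StepsAreMerges z w) : IsRealisation z w := by
  induction hn : (blocks z).card using Nat.strong_induction_on generalizing z w with
  | _ n ih =>
    obtain ⟨h0, h⟩ := h
    obtain ⟨h1, h2⟩ := h 0
    by_cases ht : (w 0).1 = ∞
    · exact .stay z w (Prod.ext ht h0)
    · obtain ⟨C, D, u, hC, hD, hCD, he⟩ := (h2.resolve_left ht).exists_eq
      rw [h0] at hC hD he
      have hw : w = consSeq (ENNReal.ofReal (w 0).1.toReal, z) fun k => w (k + 1) := by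
        funext k
        cases k with
        | zero => exact Prod.ext (ENNReal.ofReal_toReal ht).symm h0
        | succ k => rfl
      rw [hw]
      refine .jump z C D u _ _ (ENNReal.toReal_pos h1 ht) hC hD hCD ?_
      exact ih _ (hn ▸ blocks_merge_card_lt hC hD hCD u) ⟨he, fun k => h (k + 1)⟩ rfl

theorem ae_stepsAreMerges [IsMarkovKernel Υ] [MeasurableEq S]
    (hK : Measurable (Function.uncurry K)) (z : State ι S) :
    ∀ᵐ w ∂(law K Υ z), StepsAreMerges z w := by
  refine ae_law hK measurableSet_stepsAreMerges (fun z => ⟨rfl, fun k => by simp⟩) ?_ z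
  rintro z C D u s v hs hC hD hCD ⟨h0, h⟩
  refine ⟨rfl, fun k => ?_⟩
  cases k with
  | zero =>
    refine ⟨by simpa [consSeq] using hs, Or.inr ?_⟩
    simp only [consSeq]
    rw [h0]
    exact isMerge_merge hC hD hCD u
  | succ k => exact h k

/-- The inductive predicate is convenient for proofs but not visibly measurable; `StepsAreMerges` is
the measurable condition that implies it. -/
theorem ae_isRealisation [IsMarkovKernel Υ] [MeasurableEq S] (hK : Measurable (Function.uncurry K))
    (z : State ι S) : ∀ᵐ w ∂(law K Υ z), IsRealisation z w :=
  (ae_stepsAreMerges hK z).mono fun _ hw => hw.isRealisation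

theorem IsRealisation.exists_top {z : State ι S} {w : JumpRecord ι S} (h : IsRealisation z w) :
    ∃ k, (w k).1 = ∞ := by
  induction h with
  | stay z w h => exact ⟨0, by rw [h]⟩
  | jump z C D u s v hs hC hD hCD hv ih => exact ih.imp' (· + 1) fun k hk => hk

theorem IsRealisation.zero {z : State ι S} {w : JumpRecord ι S} (h : IsRealisation z w) :
    (w 0).2 = z := by
  cases h with
  | stay z w h => rw [h]
  | jump z C D u s v hs hC hD hCD hv => rfl

theorem stateAt_of_top {z : State ι S} {w : JumpRecord ι S} (h : w 0 = (∞, z)) (t : ℝ) :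
    stateAt w t = z := by
  rw [stateAt_of_lt (by rw [h]; simp), h]

/-- The paths on `[0,∞)` with finitely many values that are constant on a right neighbourhood
of every time. -/
def IsRightStep {α : Type*} (η : ℝ → α) : Prop :=
  (η '' Set.Ici 0).Finite ∧ ∀ t, 0 ≤ t → ∃ ε > 0, ∀ t' ∈ Set.Ico t (t + ε), η t' = η t

theorem IsRightStep.comp {α β : Type*} {η : ℝ → α} (h : IsRightStep η) (g : α → β) :
    IsRightStep fun t => g (η t) := by
  refine ⟨?_, fun t ht => ?_⟩
  · have : (fun t => g (η t)) '' Set.Ici 0 = g '' (η '' Set.Ici 0) := by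
      rw [Set.image_image]
    rw [this]
    exact h.1.image g
  · obtain ⟨ε, hε, h'⟩ := h.2 t ht
    exact ⟨ε, hε, fun t' ht' => congrArg g (h' t' ht')⟩

theorem IsRealisation.isRightStep {z : State ι S} {w : JumpRecord ι S} (h : IsRealisation z w) :
    IsRightStep (stateAt w) := by
  induction h with
  | stay z w h =>
    have : stateAt w = fun _ => z := funext (stateAt_of_top h)
    rw [this]
    exact ⟨(Set.finite_singleton z).subset (by rintro _ ⟨t, -, rfl⟩; rfl),
      fun t _ => ⟨1, one_pos, fun _ _ => rfl⟩⟩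
  | jump z C D u s v hs hC hD hCD hv ih =>
    constructor
    · refine (ih.1.insert z).subset ?_
      rintro _ ⟨t, ht, rfl⟩
      by_cases hts : t < s
      · left; exact stateAt_consSeq_of_lt hs hts z v
      · right
        rw [stateAt_consSeq_of_ge hs.le (not_lt.1 hts) z hv.exists_top]
        exact ⟨t - s, by simpa using hts, rfl⟩
    · intro t ht
      by_cases hts : t < s
      · refine ⟨s - t, by linarith, fun t' ht' => ?_⟩
        rw [stateAt_consSeq_of_lt hs hts, stateAt_consSeq_of_lt hs (by linarith [ht'.2])]
      · push Not at hts
        obtain ⟨ε, hε, h⟩ := ih.2 (t - s) (by linarith)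
        refine ⟨ε, hε, fun t' ht' => ?_⟩
        rw [stateAt_consSeq_of_ge hs.le (hts.trans ht'.1) z hv.exists_top,
          stateAt_consSeq_of_ge hs.le hts z hv.exists_top]
        exact h _ ⟨by linarith [ht'.1], by linarith [ht'.2]⟩

/-- Induction principle for properties of states that are preserved by coagulations. -/
theorem IsRealisation.stateAt_induction {P : State ι S → Prop}
    (hP : ∀ z C D u, C ∈ blocks z → D ∈ blocks z → C ≠ D → P z → P (merge z C D u))
    {z : State ι S} {w : JumpRecord ι S} (h : IsRealisation z w) (hz : P z) (t : ℝ) :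
    P (stateAt w t) := by
  induction h generalizing t with
  | stay z w h => rwa [stateAt_of_top h]
  | jump z C D u s v hs hC hD hCD hv ih =>
    by_cases hts : t < s
    · rwa [stateAt_consSeq_of_lt hs hts]
    · rw [stateAt_consSeq_of_ge hs.le (not_lt.1 hts) z hv.exists_top]
      exact ih (hP z C D u hC hD hCD hz) _

theorem exists_superset_mem_blocks_merge {z : State ι S} {C D E : Finset ι} (u : S)
    (hE : E ∈ blocks z) : ∃ E' ∈ blocks (merge z C D u), E ⊆ E' := by
  by_cases h1 : E = C ∪ D
  · exact ⟨E, by simp [mem_blocks, merge, h1], subset_rfl⟩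
  by_cases h2 : E = C ∨ E = D
  · refine ⟨C ∪ D, by simp [mem_blocks, merge], ?_⟩
    rcases h2 with rfl | rfl
    · exact Finset.subset_union_left
    · exact Finset.subset_union_right
  · refine ⟨E, ?_, subset_rfl⟩
    rw [mem_blocks] at hE ⊢
    simpa [merge, h1, h2] using hE

theorem IsRealisation.exists_superset {z : State ι S} {w : JumpRecord ι S} (h : IsRealisation z w)
    {E : Finset ι} (hE : E ∈ blocks z) (t : ℝ) : ∃ E' ∈ blocks (stateAt w t), E ⊆ E' := by
  refine h.stateAt_induction (P := fun z => ∃ E' ∈ blocks z, E ⊆ E') ?_ ⟨E, hE, subset_rfl⟩ t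
  rintro z C D u - - - ⟨E', hE', hs⟩
  obtain ⟨E'', h1, h2⟩ := exists_superset_mem_blocks_merge (C := C) (D := D) u hE'
  exact ⟨E'', h1, hs.trans h2⟩

/-- The blocks form a partition of the label set. -/
structure IsPartitionState (z : State ι S) : Prop where
  nonempty : ∀ C ∈ blocks z, C.Nonempty
  disjoint : ∀ C ∈ blocks z, ∀ D ∈ blocks z, C ≠ D → Disjoint C D
  cover : ∀ i, ∃ C ∈ blocks z, i ∈ C

theorem mem_blocks_merge {z : State ι S} {C D E : Finset ι} {u : S} :
    E ∈ blocks (merge z C D u) ↔ E = C ∪ D ∨ (E ≠ C ∧ E ≠ D ∧ E ∈ blocks z) := by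
  simp only [mem_blocks, merge]
  split_ifs with h1 h2
  · simp [h1]
  · simp only [Sum.isLeft_inr, Bool.false_eq_true, h1, false_or, false_iff]; tauto
  · push Not at h2; simp [h1, h2]

theorem IsPartitionState.merge {z : State ι S} (hz : IsPartitionState z) {C D : Finset ι}
    (hC : C ∈ blocks z) (hD : D ∈ blocks z) (u : S) : IsPartitionState (merge z C D u) := by
  constructor
  · intro E hE
    rcases mem_blocks_merge.1 hE with rfl | ⟨-, -, h⟩
    · exact (hz.nonempty C hC).mono Finset.subset_union_left
    · exact hz.nonempty E h
  · intro E hE F hF hEF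
    rcases mem_blocks_merge.1 hE with rfl | ⟨h1, h2, h3⟩ <;>
    rcases mem_blocks_merge.1 hF with rfl | ⟨h1', h2', h3'⟩
    · exact absurd rfl hEF
    · exact Finset.disjoint_union_left.2 ⟨hz.disjoint C hC F h3' h1'.symm,
        hz.disjoint D hD F h3' h2'.symm⟩
    · exact Finset.disjoint_union_right.2 ⟨hz.disjoint E h3 C hC h1, hz.disjoint E h3 D hD h2⟩
    · exact hz.disjoint E h3 F h3' hEF
  · intro i
    obtain ⟨E, hE, hi⟩ := hz.cover i
    obtain ⟨E', hE', hs⟩ := exists_superset_mem_blocks_merge (C := C) (D := D) u hE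
    exact ⟨E', hE', hs hi⟩

theorem mem_blocks_initState {x : ι → S} {C : Finset ι} :
    C ∈ blocks (initState x) ↔ ∃ i, C = {i} := by
  rw [mem_blocks, initState]
  split_ifs with h <;> simp [h]

theorem initState_singleton (x : ι → S) (i : ι) : initState x {i} = Sum.inl (x i) := by
  have h : ∃ j, ({i} : Finset ι) = {j} := ⟨i, rfl⟩
  rw [initState, dif_pos h]
  have := h.choose_spec
  rw [Finset.singleton_inj] at this
  rw [← this]

theorem isPartitionState_initState (x : ι → S) : IsPartitionState (initState x) := by
  constructor
  · intro C hC
    obtain ⟨i, rfl⟩ := mem_blocks_initState.1 hC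
    simp
  · intro C hC D hD h
    obtain ⟨i, rfl⟩ := mem_blocks_initState.1 hC
    obtain ⟨j, rfl⟩ := mem_blocks_initState.1 hD
    simpa using h
  · exact fun i => ⟨{i}, mem_blocks_initState.2 ⟨i, rfl⟩, by simp⟩

theorem IsRealisation.isPartitionState {z : State ι S} {w : JumpRecord ι S}
    (h : IsRealisation z w) (hz : IsPartitionState z) (t : ℝ) : IsPartitionState (stateAt w t) :=
  h.stateAt_induction (fun _ _ _ u hC hD _ hz => hz.merge hC hD u) hz t

end Realisations

/-! ### Renewal equations -/

theorem lintegral_exp_tail {r : ℝ} (hr : 0 < r) (T : ℝ) :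
    ∫⁻ s in Set.Ioi T, ENNReal.ofReal (Real.exp (-(r * s))) * ENNReal.ofReal r =
      ENNReal.ofReal (Real.exp (-(r * T))) := by
  have h1 : IntegrableOn (fun s => Real.exp (-(r * s))) (Set.Ioi T) := by
    simpa [neg_mul] using exp_neg_integrableOn_Ioi T hr
  have h2 : ∫ s in Set.Ioi T, Real.exp (-(r * s)) = Real.exp (-(r * T)) / r := by
    have := integral_exp_mul_Ioi (a := -r) (by linarith) T
    simp only [neg_mul] at this
    rw [this, neg_div_neg_eq]
  rw [lintegral_mul_const _ (by fun_prop), ← ofReal_integral_eq_lintegral_ofReal h1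
    (Filter.Eventually.of_forall fun _ => (Real.exp_pos _).le), h2,
    ← ENNReal.ofReal_mul (by positivity), div_mul_cancel₀ _ hr.ne']

/-- If the first jump falls after `T`, a functional of the path up to `T` no longer sees it. The
tail of the time integral then collapses to the survival probability `e^{-rT}`. -/
theorem lintegral_exp_truncate {r : ℝ≥0} (hr : r ≠ 0) {T : ℝ} (hT : 0 ≤ T) (A : ℝ → ℝ≥0∞) (c : ℝ≥0∞)
    (hA : ∀ s, T < s → A s = r * c) :
    ∫⁻ s in Set.Ioi (0 : ℝ), ENNReal.ofReal (Real.exp (-(r * s))) * A s =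
      ENNReal.ofReal (Real.exp (-(r * T))) * c +
        ∫⁻ s in Set.Ioo 0 T, ENNReal.ofReal (Real.exp (-(r * s))) * A s := by
  have hr' : (0 : ℝ) < r := by positivity
  have e : Set.Ioi (0 : ℝ) = Set.Ioc 0 T ∪ Set.Ioi T := (Set.Ioc_union_Ioi_eq_Ioi hT).symm
  have hd : Disjoint (Set.Ioc 0 T) (Set.Ioi T) := by
    rw [Set.disjoint_left]; intro x hx hx'; exact absurd hx.2 (not_le.2 hx')
  rw [e, lintegral_union measurableSet_Ioi hd, add_comm, setLIntegral_congr Ioo_ae_eq_Ioc.symm]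
  congr 1
  rw [setLIntegral_congr_fun (g := fun s => ENNReal.ofReal (Real.exp (-(r * s))) *
    ENNReal.ofReal r * c) measurableSet_Ioi, lintegral_mul_const _ (by fun_prop),
    lintegral_exp_tail hr']
  intro s hs
  simp only
  rw [hA s hs, ENNReal.ofReal_coe_nnreal, mul_assoc]

/-- Splitting a double integral over the quadrant according to the order of the variables. -/
theorem lintegral_quadrant (g : ℝ → ℝ → ℝ≥0∞) (hg : Measurable (Function.uncurry g)) :
    ∫⁻ s in Set.Ioi (0 : ℝ), ∫⁻ t in Set.Ioi (0 : ℝ), g s t =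
      (∫⁻ s in Set.Ioi (0 : ℝ), ∫⁻ t in Set.Ioi (0 : ℝ), g s (s + t)) +
      ∫⁻ s in Set.Ioi (0 : ℝ), ∫⁻ t in Set.Ioi (0 : ℝ), g (s + t) s := by
  have shift : ∀ (h : ℝ → ℝ≥0∞) (s : ℝ), ∫⁻ t in Set.Ioi s, h t = ∫⁻ t in Set.Ioi 0, h (s + t) := by
    intro h s
    rw [← lintegral_indicator measurableSet_Ioi, ← lintegral_indicator measurableSet_Ioi,
      ← lintegral_add_left_eq_self _ s]
    refine lintegral_congr fun t => ?_
    simp [Set.indicator]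
  have hg' : Measurable fun p : ℝ × ℝ => g p.1 p.2 := hg
  have hlt : MeasurableSet {p : ℝ × ℝ | p.2 < p.1} := measurableSet_lt measurable_snd measurable_fst
  have h1 : ∀ s ∈ Set.Ioi (0 : ℝ), ∫⁻ t in Set.Ioi (0 : ℝ), g s t =
      (∫⁻ t in Set.Ioi (0 : ℝ), g s (s + t)) +
      ∫⁻ t in Set.Ioi (0 : ℝ), {p : ℝ × ℝ | p.2 < p.1}.indicator (fun p => g p.1 p.2) (s, t) := by
    intro s hs
    have e : Set.Ioi (0 : ℝ) = Set.Ioc 0 s ∪ Set.Ioi s :=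
      (Set.Ioc_union_Ioi_eq_Ioi (le_of_lt hs)).symm
    have hd : Disjoint (Set.Ioc 0 s) (Set.Ioi s) := by
      rw [Set.disjoint_left]; intro x hx hx'; exact absurd hx.2 (not_le.2 hx')
    rw [← shift (g s) s]
    conv_lhs => rw [e, lintegral_union measurableSet_Ioi hd, add_comm,
      setLIntegral_congr Ioo_ae_eq_Ioc.symm]
    congr 1
    rw [← lintegral_indicator measurableSet_Ioi, ← lintegral_indicator measurableSet_Ioo]
    refine lintegral_congr fun t => ?_
    by_cases ht : 0 < t <;> by_cases hts : t < s <;> simp [Set.indicator, ht, hts]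
  rw [setLIntegral_congr_fun measurableSet_Ioi h1, lintegral_add_left]
  · congr 1
    rw [lintegral_lintegral_swap]
    · refine setLIntegral_congr_fun measurableSet_Ioi fun s hs => ?_
      rw [← shift (fun t => g t s) s, ← lintegral_indicator measurableSet_Ioi,
        ← lintegral_indicator measurableSet_Ioi]
      refine lintegral_congr fun t => ?_
      have hs' : 0 < s := hs
      by_cases hts : s < t
      · simp [Set.indicator, hts, hs'.trans hts]
      · simp [Set.indicator, hts]
    · exact ((hg'.indicator hlt).aemeasurable)
  · exact Measurable.lintegral_prod_right' (f := fun p : ℝ × ℝ => g p.1 (p.1 + p.2))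
      (hg'.comp (f := fun p : ℝ × ℝ => (p.1, p.1 + p.2)) (by fun_prop))

section Renewal

variable {ι S : Type*} [Fintype ι] [DecidableEq ι] [MeasurableSpace S]
variable {K : Particle S → Particle S → ℝ≥0} {Υ : Kernel (Particle S × Particle S) S}

/-- The record of a process that stays in `z` forever. -/
def stayRecord (z : State ι S) : JumpRecord ι S := fun _ => (∞, z)

theorem stateAt_stayRecord (z : State ι S) (t : ℝ) : stateAt (stayRecord z) t = z :=
  stateAt_of_top rfl t

theorem measurable_consSeq_left (z : State ι S) :
    Measurable fun p : ℝ × JumpRecord ι S => consSeq (ENNReal.ofReal p.1, z) p.2 :=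
  measurable_consSeq.comp (f := fun p : ℝ × JumpRecord ι S => ((ENNReal.ofReal p.1, z), p.2))
    (by fun_prop)

theorem future_eq_zero [IsMarkovKernel Υ] (hK : Measurable (Function.uncurry K)) {z : State ι S}
    (h : totalRate K z = 0) : future K Υ z = 0 := by
  rw [← Measure.measure_univ_eq_zero, future_univ hK, h, ENNReal.coe_zero]

/-- Decomposition at the first jump, for functionals of the path up to time `T`. -/
theorem lintegral_law_horizon [IsMarkovKernel Υ] (hK : Measurable (Function.uncurry K))
    (z : State ι S) {T : ℝ} (hT : 0 ≤ T) (F : JumpRecord ι S → ℝ≥0∞) (hF : Measurable F)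
    (hdep : ∀ w w', (∀ t ∈ Set.Icc 0 T, stateAt w t = stateAt w' t) → F w = F w') :
    ∫⁻ w, F w ∂(law K Υ z) =
      ENNReal.ofReal (Real.exp (-(totalRate K z * T))) * F (stayRecord z) +
      ∫⁻ s in Set.Ioo 0 T, ENNReal.ofReal (Real.exp (-(totalRate K z * s))) *
        ∫⁻ v, F (consSeq (ENNReal.ofReal s, z) v) ∂(future K Υ z) := by
  by_cases hz : totalRate K z = 0
  · rw [law_of_totalRate_eq_zero hz, lintegral_dirac' _ hF, future_eq_zero hK hz, hz]
    simp only [NNReal.coe_zero, zero_mul, neg_zero, Real.exp_zero, ENNReal.ofReal_one, one_mul,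
      lintegral_zero_measure, mul_zero, lintegral_zero, add_zero]
    rfl
  · rw [lintegral_law hK z hz F hF]
    refine lintegral_exp_truncate hz hT _ _ fun s hs => ?_
    have : ∀ v, F (consSeq (ENNReal.ofReal s, z) v) = F (stayRecord z) := by
      intro v
      refine hdep _ _ fun t ht => ?_
      rw [stateAt_stayRecord, stateAt_consSeq_of_lt (hT.trans_lt hs) (ht.2.trans_lt hs)]
    simp_rw [this]
    rw [lintegral_const, future_univ hK, mul_comm]

variable {κ : Type*} [Fintype κ] [DecidableEq κ]

/-- Two competing exponential clocks. The renewal equation for both processes gives a double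
integral over the two first jump times, which is split according to which is smaller. By lack of
memory the process that has not yet jumped starts afresh, which is recorded by `delay`. -/
theorem lintegral_law_prod_of_ne_zero [IsMarkovKernel Υ] (hK : Measurable (Function.uncurry K))
    (a : State ι S) (b : State κ S) (ha : totalRate K a ≠ 0) (hb : totalRate K b ≠ 0)
    (Ψ : JumpRecord ι S → JumpRecord κ S → ℝ≥0∞) (hΨ : Measurable (Function.uncurry Ψ)) :
    ∫⁻ w, ∫⁻ w', Ψ w w' ∂(law K Υ b) ∂(law K Υ a) =
      ∫⁻ s in Set.Ioi (0 : ℝ),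
        ENNReal.ofReal (Real.exp (-(((totalRate K a + totalRate K b : ℝ≥0) : ℝ) * s))) *
        ((∫⁻ v, ∫⁻ w', Ψ (consSeq (ENNReal.ofReal s, a) v) (delay s w') ∂(law K Υ b)
          ∂(future K Υ a)) +
        ∫⁻ v', ∫⁻ w, Ψ (delay s w) (consSeq (ENNReal.ofReal s, b) v') ∂(law K Υ a)
          ∂(future K Υ b)) := by
  have := isFiniteMeasure_future hK a (Υ := Υ)
  have := isFiniteMeasure_future hK b (Υ := Υ)
  have := isProbabilityMeasure_law hK a (Υ := Υ)
  have := isProbabilityMeasure_law hK b (Υ := Υ)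
  have hΨ' : Measurable fun p : JumpRecord ι S × JumpRecord κ S => Ψ p.1 p.2 := hΨ
  have mca := measurable_consSeq_left a
  have mcb := measurable_consSeq_left b
  have e1 : ∀ w, ∫⁻ w', Ψ w w' ∂(law K Υ b) = ∫⁻ t in Set.Ioi (0 : ℝ),
      ENNReal.ofReal (Real.exp (-(totalRate K b * t))) *
        ∫⁻ v', Ψ w (consSeq (ENNReal.ofReal t, b) v') ∂(future K Υ b) := fun w =>
    lintegral_law hK b hb _ (hΨ'.comp measurable_prodMk_left)
  have e1' : ∀ w', ∫⁻ w, Ψ w w' ∂(law K Υ a) = ∫⁻ t in Set.Ioi (0 : ℝ),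
      ENNReal.ofReal (Real.exp (-(totalRate K a * t))) *
        ∫⁻ v, Ψ (consSeq (ENNReal.ofReal t, a) v) w' ∂(future K Υ a) := fun w' =>
    lintegral_law hK a ha _ (hΨ'.comp measurable_prodMk_right)
  -- Here `s` and `t` are the first jump times of the processes started from `a` and from `b`.
  let g : ℝ → ℝ → ℝ≥0∞ := fun s t =>
    ENNReal.ofReal (Real.exp (-(totalRate K a * s))) *
      (ENNReal.ofReal (Real.exp (-(totalRate K b * t))) *
      ∫⁻ v, ∫⁻ v', Ψ (consSeq (ENNReal.ofReal s, a) v) (consSeq (ENNReal.ofReal t, b) v')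
        ∂(future K Υ b) ∂(future K Υ a))
  -- joint measurability of the integrand
  have m4 : Measurable fun q : ((ℝ × ℝ) × JumpRecord ι S) × JumpRecord κ S =>
      Ψ (consSeq (ENNReal.ofReal q.1.1.1, a) q.1.2) (consSeq (ENNReal.ofReal q.1.1.2, b) q.2) := by
    refine hΨ'.comp (Measurable.prodMk ?_ ?_)
    · exact mca.comp (f := fun q : ((ℝ × ℝ) × JumpRecord ι S) × JumpRecord κ S =>
        (q.1.1.1, q.1.2)) (by fun_prop)
    · exact mcb.comp (f := fun q : ((ℝ × ℝ) × JumpRecord ι S) × JumpRecord κ S =>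
        (q.1.1.2, q.2)) (by fun_prop)
  have m3 : Measurable fun q : (ℝ × ℝ) × JumpRecord ι S =>
      ∫⁻ v', Ψ (consSeq (ENNReal.ofReal q.1.1, a) q.2) (consSeq (ENNReal.ofReal q.1.2, b) v')
        ∂(future K Υ b) := Measurable.lintegral_prod_right' m4
  have m2 : Measurable fun q : ℝ × ℝ =>
      ∫⁻ v, ∫⁻ v', Ψ (consSeq (ENNReal.ofReal q.1, a) v) (consSeq (ENNReal.ofReal q.2, b) v')
        ∂(future K Υ b) ∂(future K Υ a) := Measurable.lintegral_prod_right' m3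
  have hg : Measurable (Function.uncurry g) := by
    refine Measurable.mul (by fun_prop) (Measurable.mul (by fun_prop) m2)
  have m0 : Measurable fun w => ∫⁻ w', Ψ w w' ∂(law K Υ b) := Measurable.lintegral_prod_right' hΨ'
  have lhs : ∫⁻ w, ∫⁻ w', Ψ w w' ∂(law K Υ b) ∂(law K Υ a) =
      ∫⁻ s in Set.Ioi (0 : ℝ), ∫⁻ t in Set.Ioi (0 : ℝ), g s t := by
    rw [lintegral_law hK a ha _ m0]
    refine lintegral_congr fun s => ?_
    rw [lintegral_const_mul _ (by
      refine Measurable.mul (by fun_prop) ?_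
      exact m2.comp measurable_prodMk_left)]
    congr 1
    simp_rw [e1]
    rw [lintegral_lintegral_swap]
    · refine lintegral_congr fun t => ?_
      rw [lintegral_const_mul _ (by exact m3.comp (measurable_prodMk_left (x := (s, t))))]
    · refine Measurable.aemeasurable (Measurable.mul (by fun_prop) ?_)
      exact m3.comp (f := fun p : JumpRecord ι S × ℝ => ((s, p.2), p.1)) (by fun_prop)
  have ma : Measurable fun s => ENNReal.ofReal
      (Real.exp (-(((totalRate K a + totalRate K b : ℝ≥0) : ℝ) * s))) *
        (∫⁻ v, ∫⁻ w', Ψ (consSeq (ENNReal.ofReal s, a) v) (delay s w') ∂(law K Υ b)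
          ∂(future K Υ a)) := by
    refine Measurable.mul (by fun_prop) ?_
    refine Measurable.lintegral_prod_right' (f := fun p : ℝ × JumpRecord ι S =>
      ∫⁻ w', Ψ (consSeq (ENNReal.ofReal p.1, a) p.2) (delay p.1 w') ∂(law K Υ b)) ?_
    refine Measurable.lintegral_prod_right' (f := fun q : (ℝ × JumpRecord ι S) × JumpRecord κ S =>
      Ψ (consSeq (ENNReal.ofReal q.1.1, a) q.1.2) (delay q.1.1 q.2)) ?_
    exact hΨ'.comp ((mca.comp measurable_fst).prodMk (measurable_delay.comp
      (f := fun q : (ℝ × JumpRecord ι S) × JumpRecord κ S => (q.1.1, q.2)) (by fun_prop)))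
  rw [lhs, lintegral_quadrant g hg]
  simp_rw [mul_add]
  rw [lintegral_add_left ma]
  congr 1
  · refine setLIntegral_congr_fun measurableSet_Ioi fun s hs => ?_
    have hs' : (0 : ℝ) < s := hs
    -- The renewal equation read for the delayed process: it makes its first jump at `s + t`, and
    -- the missing survival factor of `b` up to `s` is supplied by the sum of the two rates in the
    -- exponent.
    have e2 : ∀ v, ∫⁻ w', Ψ (consSeq (ENNReal.ofReal s, a) v) (delay s w') ∂(law K Υ b) =
        ∫⁻ t in Set.Ioi (0 : ℝ), ENNReal.ofReal (Real.exp (-(totalRate K b * t))) *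
          ∫⁻ v', Ψ (consSeq (ENNReal.ofReal s, a) v) (consSeq (ENNReal.ofReal (s + t), b) v')
          ∂(future K Υ b) := by
      intro v
      rw [lintegral_law hK b hb]
      · refine setLIntegral_congr_fun measurableSet_Ioi fun t ht => ?_
        simp_rw [delay_consSeq hs'.le (le_of_lt ht)]
      · exact hΨ'.comp (measurable_const.prodMk (measurable_delay.comp measurable_prodMk_left))
    simp_rw [e2]
    rw [lintegral_lintegral_swap]
    · rw [← lintegral_const_mul]
      · refine setLIntegral_congr_fun measurableSet_Ioi fun t ht => ?_
        simp only [g]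
        rw [lintegral_const_mul _ (by exact m3.comp (measurable_prodMk_left (x := (s, s + t)))),
          ← mul_assoc, ← mul_assoc]
        congr 1
        rw [← ENNReal.ofReal_mul (Real.exp_pos _).le, ← ENNReal.ofReal_mul (Real.exp_pos _).le,
          ← Real.exp_add, ← Real.exp_add]
        congr 2
        push_cast
        ring
      · refine Measurable.lintegral_prod_right' (f := fun p : ℝ × JumpRecord ι S =>
          ENNReal.ofReal (Real.exp (-(totalRate K b * p.1))) *
          ∫⁻ v', Ψ (consSeq (ENNReal.ofReal s, a) p.2) (consSeq (ENNReal.ofReal (s + p.1), b) v')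
          ∂(future K Υ b)) ?_
        refine Measurable.mul (by fun_prop) ?_
        exact m3.comp (f := fun p : ℝ × JumpRecord ι S => ((s, s + p.1), p.2)) (by fun_prop)
    · refine Measurable.aemeasurable (Measurable.mul (by fun_prop) ?_)
      exact m3.comp (f := fun p : JumpRecord ι S × ℝ => ((s, s + p.2), p.1)) (by fun_prop)
  · refine setLIntegral_congr_fun measurableSet_Ioi fun s hs => ?_
    have hs' : (0 : ℝ) < s := hs
    have m4' : Measurable fun q : ((ℝ × ℝ) × JumpRecord κ S) × JumpRecord ι S =>
        Ψ (consSeq (ENNReal.ofReal q.1.1.1, a) q.2)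
          (consSeq (ENNReal.ofReal q.1.1.2, b) q.1.2) :=
      m4.comp (f := fun q : ((ℝ × ℝ) × JumpRecord κ S) × JumpRecord ι S =>
        ((q.1.1, q.2), q.1.2)) (by fun_prop)
    have m3' : Measurable fun q : (ℝ × ℝ) × JumpRecord κ S =>
        ∫⁻ v, Ψ (consSeq (ENNReal.ofReal q.1.1, a) v) (consSeq (ENNReal.ofReal q.1.2, b) q.2)
        ∂(future K Υ a) := Measurable.lintegral_prod_right' m4'
    have sw : ∀ s t : ℝ, ∫⁻ v, ∫⁻ v', Ψ (consSeq (ENNReal.ofReal s, a) v)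
        (consSeq (ENNReal.ofReal t, b) v') ∂(future K Υ b) ∂(future K Υ a) =
        ∫⁻ v', ∫⁻ v, Ψ (consSeq (ENNReal.ofReal s, a) v)
        (consSeq (ENNReal.ofReal t, b) v') ∂(future K Υ a) ∂(future K Υ b) := by
      intro s t
      refine lintegral_lintegral_swap ?_
      exact (m4.comp (f := fun q : JumpRecord ι S × JumpRecord κ S => (((s, t), q.1), q.2))
        (by fun_prop)).aemeasurable
    have e2 : ∀ v', ∫⁻ w, Ψ (delay s w) (consSeq (ENNReal.ofReal s, b) v') ∂(law K Υ a) =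
        ∫⁻ t in Set.Ioi (0 : ℝ), ENNReal.ofReal (Real.exp (-(totalRate K a * t))) *
          ∫⁻ v, Ψ (consSeq (ENNReal.ofReal (s + t), a) v) (consSeq (ENNReal.ofReal s, b) v')
          ∂(future K Υ a) := by
      intro v'
      rw [lintegral_law hK a ha]
      · refine setLIntegral_congr_fun measurableSet_Ioi fun t ht => ?_
        simp_rw [delay_consSeq hs'.le (le_of_lt ht)]
      · exact hΨ'.comp ((measurable_delay.comp measurable_prodMk_left).prodMk measurable_const)
    simp only [g]
    simp_rw [e2, sw]
    rw [lintegral_lintegral_swap]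
    · rw [← lintegral_const_mul]
      · refine setLIntegral_congr_fun measurableSet_Ioi fun t ht => ?_
        rw [lintegral_const_mul _ (by exact m3'.comp (measurable_prodMk_left (x := (s + t, s)))),
          ← mul_assoc, ← mul_assoc]
        congr 1
        rw [← ENNReal.ofReal_mul (Real.exp_pos _).le, ← ENNReal.ofReal_mul (Real.exp_pos _).le,
          ← Real.exp_add, ← Real.exp_add]
        congr 2
        push_cast
        ring
      · refine Measurable.lintegral_prod_right' (f := fun p : ℝ × JumpRecord κ S =>
          ENNReal.ofReal (Real.exp (-(totalRate K a * p.1))) *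
          ∫⁻ v, Ψ (consSeq (ENNReal.ofReal (s + p.1), a) v) (consSeq (ENNReal.ofReal s, b) p.2)
          ∂(future K Υ a)) ?_
        refine Measurable.mul (by fun_prop) ?_
        exact m3'.comp (f := fun p : ℝ × JumpRecord κ S => ((s + p.1, s), p.2)) (by fun_prop)
    · refine Measurable.aemeasurable (Measurable.mul (by fun_prop) ?_)
      exact m3'.comp (f := fun p : JumpRecord κ S × ℝ => ((s + p.2, s), p.1)) (by fun_prop)

/-- Decomposition of two independent processes at the first jump of one of them, for functionals
of the paths up to time `T`. -/
theorem lintegral_law_prod_horizon [IsMarkovKernel Υ] [MeasurableEq S]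
    (hK : Measurable (Function.uncurry K))
    (a : State ι S) (b : State κ S) {T : ℝ} (hT : 0 ≤ T)
    (Ψ : JumpRecord ι S → JumpRecord κ S → ℝ≥0∞) (hΨ : Measurable (Function.uncurry Ψ))
    (hdep : ∀ w v w' v', (∀ t ∈ Set.Icc 0 T, stateAt w t = stateAt v t) →
      (∀ t ∈ Set.Icc 0 T, stateAt w' t = stateAt v' t) → Ψ w w' = Ψ v v') :
    ∫⁻ w, ∫⁻ w', Ψ w w' ∂(law K Υ b) ∂(law K Υ a) =
      ENNReal.ofReal (Real.exp (-(((totalRate K a + totalRate K b : ℝ≥0) : ℝ) * T))) *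
        Ψ (stayRecord a) (stayRecord b) +
      ∫⁻ s in Set.Ioo 0 T,
        ENNReal.ofReal (Real.exp (-(((totalRate K a + totalRate K b : ℝ≥0) : ℝ) * s))) *
        ((∫⁻ v, ∫⁻ w', Ψ (consSeq (ENNReal.ofReal s, a) v) (delay s w') ∂(law K Υ b)
          ∂(future K Υ a)) +
        ∫⁻ v', ∫⁻ w, Ψ (delay s w) (consSeq (ENNReal.ofReal s, b) v') ∂(law K Υ a)
          ∂(future K Υ b)) := by
  have hΨ' : Measurable fun p : JumpRecord ι S × JumpRecord κ S => Ψ p.1 p.2 := hΨ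
  have := isProbabilityMeasure_law hK a (Υ := Υ)
  have := isProbabilityMeasure_law hK b (Υ := Υ)
  have m0 : Measurable fun w => ∫⁻ w', Ψ w w' ∂(law K Υ b) := Measurable.lintegral_prod_right' hΨ'
  by_cases ha : totalRate K a = 0
  · have h1 : ∀ f : JumpRecord ι S → ℝ≥0∞, Measurable f →
        ∫⁻ w, f w ∂(law K Υ a) = f (stayRecord a) := fun f hf => by
      rw [law_of_totalRate_eq_zero ha, lintegral_dirac' _ hf]; rfl
    rw [h1 _ m0, lintegral_law_horizon hK b hT (fun w' => Ψ (stayRecord a) w')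
      (hΨ'.comp measurable_prodMk_left)
      (fun w w' h => hdep _ _ _ _ (fun _ _ => rfl) h), future_eq_zero hK ha, ha]
    simp only [lintegral_zero_measure, zero_add]
    congr 2
    funext s
    congr 1
    refine lintegral_congr fun v' => ?_
    rw [h1 _ (by exact hΨ'.comp ((measurable_delay.comp measurable_prodMk_left).prodMk measurable_const))]
    congr 1
    exact (delay_const s a).symm
  by_cases hb : totalRate K b = 0
  · have h1 : ∀ f : JumpRecord κ S → ℝ≥0∞, Measurable f →
        ∫⁻ w, f w ∂(law K Υ b) = f (stayRecord b) := fun f hf => by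
      rw [law_of_totalRate_eq_zero hb, lintegral_dirac' _ hf]; rfl
    have h2 : ∀ w, ∫⁻ w', Ψ w w' ∂(law K Υ b) = Ψ w (stayRecord b) := fun w =>
      h1 _ (hΨ'.comp measurable_prodMk_left)
    simp_rw [h2]
    rw [lintegral_law_horizon hK a hT (fun w => Ψ w (stayRecord b))
      (hΨ'.comp measurable_prodMk_right) (fun w w' h => hdep _ _ _ _ h (fun _ _ => rfl)),
      future_eq_zero hK hb, hb]
    simp only [lintegral_zero_measure, add_zero]
    congr 2
    funext s
    congr 1
    refine lintegral_congr fun v => ?_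
    rw [h1 _ (by exact hΨ'.comp (measurable_const.prodMk (measurable_delay.comp measurable_prodMk_left)))]
    congr 1
    exact (delay_const s b).symm
  rw [lintegral_law_prod_of_ne_zero hK a b ha hb Ψ hΨ]
  -- If the earlier of the two jumps comes after `T`, both paths are constant on `[0,T]`, and the
  -- two futures together have mass equal to the sum of the rates.
  refine lintegral_exp_truncate (by simp [ha]) hT _ _ fun s hs => ?_
  have hs0 : 0 < s := hT.trans_lt hs
  have c1 : ∀ v, ∀ t ∈ Set.Icc 0 T, stateAt (consSeq (ENNReal.ofReal s, a) v) t =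
      stateAt (stayRecord a) t := fun v t ht => by
    rw [stateAt_stayRecord, stateAt_consSeq_of_lt hs0 (ht.2.trans_lt hs)]
  have c2 : ∀ v, ∀ t ∈ Set.Icc 0 T, stateAt (consSeq (ENNReal.ofReal s, b) v) t =
      stateAt (stayRecord b) t := fun v t ht => by
    rw [stateAt_stayRecord, stateAt_consSeq_of_lt hs0 (ht.2.trans_lt hs)]
  have d1 : ∀ᵐ w ∂(law K Υ a), ∀ t ∈ Set.Icc 0 T, stateAt (delay s w) t =
      stateAt (stayRecord a) t := by
    filter_upwards [ae_isRealisation hK a] with w hw t ht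
    rw [stateAt_stayRecord, stateAt_delay_of_lt hs0 (ht.2.trans_lt hs), hw.zero]
  have d2 : ∀ᵐ w ∂(law K Υ b), ∀ t ∈ Set.Icc 0 T, stateAt (delay s w) t =
      stateAt (stayRecord b) t := by
    filter_upwards [ae_isRealisation hK b] with w hw t ht
    rw [stateAt_stayRecord, stateAt_delay_of_lt hs0 (ht.2.trans_lt hs), hw.zero]
  have A : ∀ v, ∫⁻ w', Ψ (consSeq (ENNReal.ofReal s, a) v) (delay s w') ∂(law K Υ b) =
      Ψ (stayRecord a) (stayRecord b) := fun v => by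
    rw [lintegral_congr_ae (g := fun _ => Ψ (stayRecord a) (stayRecord b))]
    · simp
    · filter_upwards [d2] with w' hw'
      exact hdep _ _ _ _ (c1 v) hw'
  have B : ∀ v', ∫⁻ w, Ψ (delay s w) (consSeq (ENNReal.ofReal s, b) v') ∂(law K Υ a) =
      Ψ (stayRecord a) (stayRecord b) := fun v' => by
    rw [lintegral_congr_ae (g := fun _ => Ψ (stayRecord a) (stayRecord b))]
    · simp
    · filter_upwards [d1] with w hw
      exact hdep _ _ _ _ hw (c2 v')
  simp_rw [A, B, lintegral_const, future_univ hK]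
  push_cast
  ring

end Renewal

/-! ### The exponential weight -/

/-- The function `x ↦ exp (-x)` on `[0, ∞]`. -/
def expNeg (x : ℝ≥0∞) : ℝ≥0∞ := if x = ∞ then 0 else ENNReal.ofReal (Real.exp (-x.toReal))

theorem expNeg_add (x y : ℝ≥0∞) : expNeg (x + y) = expNeg x * expNeg y := by
  unfold expNeg
  by_cases hx : x = ∞
  · simp [hx]
  by_cases hy : y = ∞
  · simp [hy]
  rw [if_neg hx, if_neg hy, if_neg (by simp [hx, hy]), ENNReal.toReal_add hx hy, neg_add,
    Real.exp_add, ENNReal.ofReal_mul (Real.exp_pos _).le]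

theorem expNeg_zero : expNeg 0 = 1 := by simp [expNeg]

theorem expNeg_of_ne_top {x : ℝ≥0∞} (hx : x ≠ ∞) :
    expNeg x = ENNReal.ofReal (Real.exp (-x.toReal)) := if_neg hx

theorem expNeg_coe_mul_ofReal (c : ℝ≥0) {s : ℝ} (hs : 0 ≤ s) :
    expNeg (c * ENNReal.ofReal s) = ENNReal.ofReal (Real.exp (-(c * s))) := by
  rw [expNeg_of_ne_top (ENNReal.mul_ne_top (by simp) (by simp))]
  simp [ENNReal.toReal_ofReal hs]

theorem measurable_expNeg : Measurable expNeg := by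
  unfold expNeg
  refine Measurable.ite (measurableSet_singleton _) measurable_const ?_
  exact (Real.measurable_exp.comp ENNReal.measurable_toReal.neg).ennreal_ofReal

/-! ### Juxtaposition of two states, cross rates, and particles with labels from both sides. -/

section Glue

variable {α β S : Type*} [Fintype α] [DecidableEq α] [Fintype β] [DecidableEq β]
  [MeasurableSpace S]
variable {K : Particle S → Particle S → ℝ≥0} {Υ : Kernel (Particle S × Particle S) S}

/-- Juxtaposition of two states with disjoint label sets. -/
def glue (a : State α S) (b : State β S) : State (α ⊕ β) S := fun E =>
  if E.toRight = ∅ then a E.toLeft else if E.toLeft = ∅ then b E.toRight else Sum.inr ()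

/-- A subset of the left labels as a set of labels. -/
def leftSet (β : Type*) (C : Finset α) : Finset (α ⊕ β) := C.disjSum ∅

/-- A subset of the right labels as a set of labels. -/
def rightSet (α : Type*) (D : Finset β) : Finset (α ⊕ β) := (∅ : Finset α).disjSum D

@[simp] theorem toLeft_leftSet (C : Finset α) : (leftSet β C).toLeft = C := Finset.toLeft_disjSum
@[simp] theorem toRight_leftSet (C : Finset α) : (leftSet β C).toRight = ∅ :=
  Finset.toRight_disjSum
@[simp] theorem toLeft_rightSet (D : Finset β) : (rightSet α D).toLeft = ∅ :=
  Finset.toLeft_disjSum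
@[simp] theorem toRight_rightSet (D : Finset β) : (rightSet α D).toRight = D :=
  Finset.toRight_disjSum

@[simp] theorem toLeft_empty : (∅ : Finset (α ⊕ β)).toLeft = ∅ := rfl
@[simp] theorem toRight_empty : (∅ : Finset (α ⊕ β)).toRight = ∅ := rfl

theorem ext_toLeft_toRight {E F : Finset (α ⊕ β)} (h : E.toLeft = F.toLeft)
    (h' : E.toRight = F.toRight) : E = F := by
  rw [← Finset.toLeft_disjSum_toRight (u := E), h, h', Finset.toLeft_disjSum_toRight]

theorem toLeft_union' (E F : Finset (α ⊕ β)) : (E ∪ F).toLeft = E.toLeft ∪ F.toLeft := by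
  ext; simp

theorem toRight_union' (E F : Finset (α ⊕ β)) : (E ∪ F).toRight = E.toRight ∪ F.toRight := by
  ext; simp

theorem leftSet_union (C D : Finset α) : leftSet β C ∪ leftSet β D = leftSet β (C ∪ D) :=
  ext_toLeft_toRight (by simp [toLeft_union']) (by simp [toRight_union'])

theorem rightSet_union (C D : Finset β) : rightSet α C ∪ rightSet α D = rightSet α (C ∪ D) :=
  ext_toLeft_toRight (by simp [toLeft_union']) (by simp [toRight_union'])

theorem leftSet_injective : Function.Injective (leftSet β : Finset α → _) := fun C D h => by
  have := congrArg Finset.toLeft h; simpa using this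

theorem rightSet_injective : Function.Injective (rightSet α : Finset β → _) := fun C D h => by
  have := congrArg Finset.toRight h; simpa using this

theorem mass_leftSet (C : Finset α) : mass (leftSet β C) = mass C := by
  simp [mass, leftSet]

theorem mass_rightSet (D : Finset β) : mass (rightSet α D) = mass D := by
  simp [mass, rightSet]

theorem glue_leftSet (a : State α S) (b : State β S) (C : Finset α) :
    glue a b (leftSet β C) = a C := by simp [glue]

/-- The empty label set lies on both sides, and `glue` reads it from the left state; the two states
must therefore agree that it is not a particle. -/
theorem glue_rightSet {a : State α S} {b : State β S} (ha : a ∅ = Sum.inr ())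
    (hb : b ∅ = Sum.inr ()) (D : Finset β) : glue a b (rightSet α D) = b D := by
  simp only [glue, toRight_rightSet, toLeft_rightSet, if_true]
  split_ifs with h
  · rw [h, ha, hb]
  · rfl

theorem measurable_glue : Measurable fun p : State α S × State β S => glue p.1 p.2 := by
  refine measurable_pi_lambda _ fun E => ?_
  unfold glue
  split_ifs
  · exact (measurable_pi_apply _).comp measurable_fst
  · exact (measurable_pi_apply _).comp measurable_snd
  · exact measurable_const

/-- Sums over the sets of labels that lie on one side. -/
theorem sum_finset_sum {M : Type*} [AddCommMonoid M] (g : Finset (α ⊕ β) → M) (h0 : g ∅ = 0)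
    (h : ∀ E, E.toLeft ≠ ∅ → E.toRight ≠ ∅ → g E = 0) :
    ∑ E, g E = ∑ C, g (leftSet β C) + ∑ D, g (rightSet α D) := by
  -- The empty set satisfies both conditions and would be counted twice, which is why `g ∅ = 0` is
  -- required.
  have e1 : ∀ E : Finset (α ⊕ β), g E = (if E.toRight = ∅ then g E else 0) +
      (if E.toLeft = ∅ then g E else 0) := by
    intro E
    by_cases h1 : E.toLeft = ∅ <;> by_cases h2 : E.toRight = ∅
    · have : E = ∅ := ext_toLeft_toRight (by simpa using h1) (by simpa using h2)
      simp [this, h0]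
    · simp [h1, h2]
    · simp [h1, h2]
    · simp [h1, h2, h E h1 h2]
  have e2 : ∀ f : Finset (α ⊕ β) → M, ∑ E, f E = ∑ C : Finset α, ∑ D : Finset β, f (C.disjSum D) := by
    intro f
    rw [← Fintype.sum_prod_type']
    exact Fintype.sum_equiv Finset.sumEquiv.toEquiv _ _ fun E => by
      simp [Finset.toLeft_disjSum_toRight]
  rw [Finset.sum_congr rfl fun E _ => e1 E, Finset.sum_add_distrib]
  congr 1
  · rw [e2]
    refine Finset.sum_congr rfl fun C _ => ?_
    simp [leftSet]
  · rw [e2, Finset.sum_comm]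
    refine Finset.sum_congr rfl fun D _ => ?_
    simp [rightSet]

theorem glue_eq_inr {a : State α S} {b : State β S} {E : Finset (α ⊕ β)} (h1 : E.toLeft ≠ ∅)
    (h2 : E.toRight ≠ ∅) : glue a b E = Sum.inr () := by simp [glue, h1, h2]

theorem glue_empty {a : State α S} {b : State β S} (ha : a ∅ = Sum.inr ()) :
    glue a b ∅ = Sum.inr () := by simp [glue, ha]

theorem merge_glue_left (a : State α S) (b : State β S) (C D : Finset α) (u : S) :
    merge (glue a b) (leftSet β C) (leftSet β D) u = glue (merge a C D u) b := by
  have key : ∀ (E : Finset (α ⊕ β)) (C : Finset α),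
      E = leftSet β C ↔ E.toRight = ∅ ∧ E.toLeft = C := fun E C =>
    ⟨fun h => by simp [h], fun h => ext_toLeft_toRight (by simp [h.2]) (by simp [h.1])⟩
  funext E
  simp only [merge, leftSet_union, key, glue]
  by_cases h : E.toRight = ∅ <;> simp [h]

/-- In contrast to the left version, `C` and `D` must be nonempty, since `glue` takes its value at
the empty set from `a`. -/
theorem merge_glue_right (a : State α S) (b : State β S) {C D : Finset β} (hC : C ≠ ∅)
    (hD : D ≠ ∅) (u : S) :
    merge (glue a b) (rightSet α C) (rightSet α D) u = glue a (merge b C D u) := by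
  have key : ∀ (E : Finset (α ⊕ β)) (C : Finset β),
      E = rightSet α C ↔ E.toLeft = ∅ ∧ E.toRight = C := fun E C =>
    ⟨fun h => by simp [h], fun h => ext_toLeft_toRight (by simp [h.1]) (by simp [h.2])⟩
  funext E
  simp only [merge, rightSet_union, key, glue]
  by_cases h1 : E.toRight = ∅
  · have hCD : ∅ ≠ C ∪ D := fun h => hC (Finset.union_eq_empty.1 h.symm).1
    simp [h1, hC.symm, hD.symm, hCD]
  · by_cases h2 : E.toLeft = ∅ <;> simp [h1, h2]

/-- The rate at which the particle `C` of `a` and the particle `D` of `b` coagulate. -/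
def crossPairRate (K : Particle S → Particle S → ℝ≥0) (a : State α S) (b : State β S)
    (C : Finset α) (D : Finset β) : ℝ≥0 :=
  match a C, b D with
  | Sum.inl x, Sum.inl y => K (x, mass C) (y, mass D)
  | _, _ => 0

/-- The total rate of coagulations between a particle of `a` and a particle of `b`. -/
def crossRate (K : Particle S → Particle S → ℝ≥0) (a : State α S) (b : State β S) : ℝ≥0 :=
  ∑ C, ∑ D, crossPairRate K a b C D

theorem measurable_crossRate (hK : Measurable (Function.uncurry K)) :
    Measurable fun p : State α S × State β S => crossRate K p.1 p.2 := by
  unfold crossRate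
  refine Finset.measurable_fun_sum _ fun C _ => Finset.measurable_fun_sum _ fun D _ => ?_
  have h : Measurable fun p : (S ⊕ Unit) × (S ⊕ Unit) =>
      (match p.1, p.2 with
      | Sum.inl x, Sum.inl y => K (x, mass C) (y, mass D)
      | _, _ => 0 : ℝ≥0) := by
    apply measurable_sum_prod_sum
    · exact hK.comp (f := fun p : S × S => ((p.1, mass C), (p.2, mass D))) (by fun_prop)
    all_goals exact measurable_const
  exact h.comp (f := fun p : State α S × State β S => (p.1 C, p.2 D)) (by fun_prop)

theorem pairRate_of_inr {ι : Type*} [Fintype ι] [DecidableEq ι] {z : State ι S} {C : Finset ι}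
    (h : z C = Sum.inr ()) (D : Finset ι) : pairRate K z C D = 0 := by
  simp [pairRate, h]

theorem pairRate_of_inr_right {ι : Type*} [Fintype ι] [DecidableEq ι] {z : State ι S}
    {D : Finset ι} (h : z D = Sum.inr ()) (C : Finset ι) : pairRate K z C D = 0 := by
  unfold pairRate
  split <;> simp_all

theorem pairRate_glue_left (a : State α S) (b : State β S) (C D : Finset α) :
    pairRate K (glue a b) (leftSet β C) (leftSet β D) = pairRate K a C D := by
  simp only [pairRate, glue_leftSet, mass_leftSet, leftSet_injective.eq_iff]

theorem pairRate_glue_right {a : State α S} {b : State β S} (ha : a ∅ = Sum.inr ())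
    (hb : b ∅ = Sum.inr ()) (C D : Finset β) :
    pairRate K (glue a b) (rightSet α C) (rightSet α D) = pairRate K b C D := by
  simp only [pairRate, glue_rightSet ha hb, mass_rightSet, rightSet_injective.eq_iff]

theorem placement_glue_left (a : State α S) (b : State β S) (C D : Finset α) :
    placement Υ (glue a b) (leftSet β C) (leftSet β D) = placement Υ a C D := by
  simp only [placement, glue_leftSet, mass_leftSet]

theorem placement_glue_right {a : State α S} {b : State β S} (ha : a ∅ = Sum.inr ())
    (hb : b ∅ = Sum.inr ()) (C D : Finset β) :
    placement Υ (glue a b) (rightSet α C) (rightSet α D) = placement Υ b C D := by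
  simp only [placement, glue_rightSet ha hb, mass_rightSet]

theorem leftSet_ne_rightSet {C : Finset α} {D : Finset β} (h : C ≠ ∅) :
    leftSet β C ≠ rightSet α D := fun e => h (by simpa using congrArg Finset.toLeft e)

theorem pairRate_glue_left_right {a : State α S} {b : State β S} (ha : a ∅ = Sum.inr ())
    (hb : b ∅ = Sum.inr ()) (C : Finset α) (D : Finset β) :
    pairRate K (glue a b) (leftSet β C) (rightSet α D) = crossPairRate K a b C D := by
  by_cases hC : C = ∅
  · simp [pairRate, crossPairRate, hC, glue_leftSet, ha]
  · simp only [pairRate, crossPairRate, glue_leftSet, glue_rightSet ha hb, mass_leftSet,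
      mass_rightSet, leftSet_ne_rightSet hC, if_false]

theorem pairRate_symm {ι : Type*} [Fintype ι] [DecidableEq ι] (hKsymm : ∀ p q, K p q = K q p)
    (z : State ι S) (C D : Finset ι) : pairRate K z C D = pairRate K z D C := by
  unfold pairRate
  rcases hC : z C with x | x <;> rcases hD : z D with y | y <;> simp only
  by_cases h : C = D
  · simp [h]
  · rw [if_neg h, if_neg (Ne.symm h), hKsymm]

/-- A double sum over pairs of particles of a juxtaposition. -/
theorem sum_sum_glue {M : Type*} [AddCommMonoid M] {a : State α S} {b : State β S}
    (ha : a ∅ = Sum.inr ()) (g : Finset (α ⊕ β) → Finset (α ⊕ β) → M)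
    (h1 : ∀ C D, glue a b C = Sum.inr () → g C D = 0)
    (h2 : ∀ C D, glue a b D = Sum.inr () → g C D = 0) :
    ∑ C, ∑ D, g C D = (∑ C, ∑ D, g (leftSet β C) (leftSet β D) +
      ∑ C, ∑ D, g (leftSet β C) (rightSet α D)) +
      (∑ C, ∑ D, g (rightSet α C) (leftSet β D) +
      ∑ C, ∑ D, g (rightSet α C) (rightSet α D)) := by
  have hD : ∀ C, ∑ D, g C D = ∑ D, g C (leftSet β D) + ∑ D, g C (rightSet α D) := fun C =>
    sum_finset_sum _ (h2 C ∅ (glue_empty ha)) fun E e1 e2 => h2 C E (glue_eq_inr e1 e2)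
  rw [sum_finset_sum (fun C => ∑ D, g C D)
    (Finset.sum_eq_zero fun D _ => h1 ∅ D (glue_empty ha))
    fun E e1 e2 => Finset.sum_eq_zero fun D _ => h1 E D (glue_eq_inr e1 e2)]
  simp_rw [hD, Finset.sum_add_distrib]

/-- The origin of the exponential density in the decoupling. The sum over ordered pairs contains
each cross pair in both orders; by the symmetry of `K` these agree, and halving leaves the cross
rate once. -/
theorem totalRate_glue (hKsymm : ∀ p q, K p q = K q p) {a : State α S} {b : State β S}
    (ha : a ∅ = Sum.inr ()) (hb : b ∅ = Sum.inr ()) :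
    totalRate K (glue a b) = totalRate K a + totalRate K b + crossRate K a b := by
  have h := sum_sum_glue (b := b) ha (fun C D => pairRate K (glue a b) C D)
    (fun C D h => pairRate_of_inr h D) (fun C D h => pairRate_of_inr_right h C)
  simp_rw [pairRate_glue_left, pairRate_glue_right ha hb, pairRate_glue_left_right ha hb,
    fun C D => pairRate_symm hKsymm (glue a b) (rightSet α C) (leftSet β D),
    pairRate_glue_left_right ha hb] at h
  have h3 : ∑ C, ∑ D, crossPairRate K a b D C = crossRate K a b := by
    rw [Finset.sum_comm]; rfl
  unfold totalRate
  rw [h, h3]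
  have h4 : ∑ C, ∑ D, crossPairRate K a b C D = crossRate K a b := rfl
  rw [h4]
  have h2 : (2 : ℝ≥0) ≠ 0 := by norm_num
  field_simp
  ring

/-- The integrated coagulation rate between two processes, up to time `T`. -/
def crossIntegral (K : Particle S → Particle S → ℝ≥0) (T : ℝ) (w : JumpRecord α S)
    (w' : JumpRecord β S) : ℝ≥0∞ :=
  ∫⁻ t in Set.Ioo 0 T, (crossRate K (stateAt w t) (stateAt w' t) : ℝ≥0∞)

theorem measurable_crossRate_stateAt (hK : Measurable (Function.uncurry K)) :
    Measurable fun p : (JumpRecord α S × JumpRecord β S) × ℝ =>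
      (crossRate K (stateAt p.1.1 p.2) (stateAt p.1.2 p.2) : ℝ≥0∞) := by
  have h1 : Measurable fun p : (JumpRecord α S × JumpRecord β S) × ℝ => stateAt p.1.1 p.2 :=
    measurable_stateAt_uncurry.comp (measurable_snd.prodMk (measurable_fst.comp measurable_fst))
  have h2 : Measurable fun p : (JumpRecord α S × JumpRecord β S) × ℝ => stateAt p.1.2 p.2 :=
    measurable_stateAt_uncurry.comp (measurable_snd.prodMk (measurable_snd.comp measurable_fst))
  exact ((measurable_crossRate hK).comp (h1.prodMk h2)).coe_nnreal_ennreal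

theorem measurable_crossIntegral (hK : Measurable (Function.uncurry K)) (T : ℝ) :
    Measurable fun p : JumpRecord α S × JumpRecord β S => crossIntegral K T p.1 p.2 :=
  Measurable.lintegral_prod_right' (measurable_crossRate_stateAt hK)

theorem crossIntegral_congr {T : ℝ} {w v : JumpRecord α S} {w' v' : JumpRecord β S}
    (h : ∀ t ∈ Set.Icc 0 T, stateAt w t = stateAt v t)
    (h' : ∀ t ∈ Set.Icc 0 T, stateAt w' t = stateAt v' t) :
    crossIntegral K T w w' = crossIntegral K T v v' := by
  refine setLIntegral_congr_fun measurableSet_Ioo fun t ht => ?_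
  have ht' := Set.Ioo_subset_Icc_self ht
  rw [h t ht', h' t ht']

/-- Splitting the integrated coagulation rate at a time up to which both processes stay put. -/
theorem crossIntegral_split {s T : ℝ} (hs : 0 < s) (hsT : s < T) {a : State α S} {b : State β S}
    {w v : JumpRecord α S} {w' v' : JumpRecord β S}
    (h1 : ∀ t < s, stateAt w t = a) (h2 : ∀ t, s ≤ t → stateAt w t = stateAt v (t - s))
    (h1' : ∀ t < s, stateAt w' t = b) (h2' : ∀ t, s ≤ t → stateAt w' t = stateAt v' (t - s)) :
    crossIntegral K T w w' =
      crossRate K a b * ENNReal.ofReal s + crossIntegral K (T - s) v v' := by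
  have e : Set.Ioo 0 T = Set.Ioo 0 s ∪ Set.Ico s T := (Set.Ioo_union_Ico_eq_Ioo hs hsT.le).symm
  have hd : Disjoint (Set.Ioo 0 s) (Set.Ico s T) := by
    rw [Set.disjoint_left]; intro x hx hx'; exact absurd hx.2 (not_lt.2 hx'.1)
  unfold crossIntegral
  rw [e, lintegral_union measurableSet_Ico hd]
  congr 1
  · rw [setLIntegral_congr_fun (g := fun _ => (crossRate K a b : ℝ≥0∞)) measurableSet_Ioo]
    · simp
    · intro t ht
      simp only
      rw [h1 t ht.2, h1' t ht.2]
  · rw [setLIntegral_congr Ioo_ae_eq_Ico.symm, ← lintegral_indicator measurableSet_Ioo,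
      ← lintegral_indicator measurableSet_Ioo, ← lintegral_add_right_eq_self _ s]
    refine lintegral_congr fun t => ?_
    by_cases ht : t ∈ Set.Ioo 0 (T - s)
    · have ht' : t + s ∈ Set.Ioo s T := ⟨by linarith [ht.1], by linarith [ht.2]⟩
      rw [Set.indicator_of_mem ht, Set.indicator_of_mem ht', h2 _ ht'.1.le, h2' _ ht'.1.le]
      simp
    · have ht' : t + s ∉ Set.Ioo s T := fun h => ht ⟨by linarith [h.1], by linarith [h.2]⟩
      rw [Set.indicator_of_notMem ht, Set.indicator_of_notMem ht']

/-- A particle with labels from both sides exists. -/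
def Straddles (z : State (α ⊕ β) S) : Prop := ∃ E ∈ blocks z, E.toLeft ≠ ∅ ∧ E.toRight ≠ ∅

/-- Particles only grow, so excluding a particle with labels from both sides at the final time
excludes it at all earlier times. -/
theorem straddles_mono {z : State (α ⊕ β) S} {w : JumpRecord (α ⊕ β) S} (h : IsRealisation z w)
    (hz : Straddles z) (t : ℝ) : Straddles (stateAt w t) := by
  obtain ⟨E, hE, h1, h2⟩ := hz
  obtain ⟨E', hE', hs⟩ := h.exists_superset hE t
  refine ⟨E', hE', ?_, ?_⟩
  · obtain ⟨x, hx⟩ := Finset.nonempty_iff_ne_empty.2 h1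
    exact Finset.ne_empty_of_mem (a := x) (by simpa using hs (by simpa using hx))
  · obtain ⟨x, hx⟩ := Finset.nonempty_iff_ne_empty.2 h2
    exact Finset.ne_empty_of_mem (a := x) (by simpa using hs (by simpa using hx))

theorem straddles_merge (z : State (α ⊕ β) S) {C : Finset α} {D : Finset β} (hC : C ≠ ∅)
    (hD : D ≠ ∅) (u : S) : Straddles (merge z (leftSet β C) (rightSet α D) u) ∧
      Straddles (merge z (rightSet α D) (leftSet β C) u) := by
  constructor
  · refine ⟨leftSet β C ∪ rightSet α D, mem_blocks_merge.2 (Or.inl rfl), ?_, ?_⟩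
    · simpa [toLeft_union'] using hC
    · simpa [toRight_union'] using hD
  · refine ⟨rightSet α D ∪ leftSet β C, mem_blocks_merge.2 (Or.inl rfl), ?_, ?_⟩
    · simpa [toLeft_union'] using hC
    · simpa [toRight_union'] using hD

theorem merge_empty {ι : Type*} [Fintype ι] [DecidableEq ι] {z : State ι S}
    (hz : z ∅ = Sum.inr ()) {C D : Finset ι} (hC : C ∈ blocks z) (u : S) :
    merge z C D u ∅ = Sum.inr () := by
  have hC' : C ≠ ∅ := by
    rintro rfl
    rw [mem_blocks, hz] at hC
    simp at hC
  have : ∅ ≠ C ∪ D := fun h => hC' (Finset.union_eq_empty.1 h.symm).1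
  simp [merge, this, hz]

/-- The path that stays in `z` up to time `s` and then follows `ω`. -/
def prependPath {E : Type*} (s : ℝ) (z : E) (ω : ℝ → E) : ℝ → E :=
  fun t => if t < s then z else ω (t - s)

theorem measurable_prependPath {E : Type*} [MeasurableSpace E] (s : ℝ) (z : E) :
    Measurable (prependPath s z) := by
  refine measurable_pi_lambda _ fun t => ?_
  unfold prependPath
  split_ifs
  · exact measurable_const
  · exact measurable_pi_apply _

theorem stateAt_consSeq_eq_prependPath {ι : Type*} [Fintype ι] [DecidableEq ι] {s : ℝ} (hs : 0 < s)
    (z : State ι S) {v : JumpRecord ι S} (hv : ∃ k, (v k).1 = ∞) :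
    stateAt (consSeq (ENNReal.ofReal s, z) v) = prependPath s z (stateAt v) := by
  funext t
  unfold prependPath
  split_ifs with h
  · exact stateAt_consSeq_of_lt hs h z v
  · exact stateAt_consSeq_of_ge hs.le (not_lt.1 h) z hv

theorem measurable_glue_path : Measurable fun p : JumpRecord α S × JumpRecord β S =>
    fun t => glue (stateAt p.1 t) (stateAt p.2 t) := by
  refine measurable_pi_lambda _ fun t => ?_
  exact measurable_glue.comp (((measurable_stateAt t).comp measurable_fst).prodMk
    ((measurable_stateAt t).comp measurable_snd))

end Glue

/-! ### Two groups of atoms without mutual coagulation evolve independently, up to an exponential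
density. -/

section Decoupling

variable {α β S : Type*} [Fintype α] [DecidableEq α] [Fintype β] [DecidableEq β]
  [MeasurableSpace S] [MeasurableEq S]
variable {K : Particle S → Particle S → ℝ≥0} {Υ : Kernel (Particle S × Particle S) S}
  [IsMarkovKernel Υ]

theorem ae_future_exists_top {ι : Type*} [Fintype ι] [DecidableEq ι]
    (hK : Measurable (Function.uncurry K)) (z : State ι S) :
    ∀ᵐ v ∂(future K Υ z), ∃ k, (v k).1 = ∞ := by
  have hm : MeasurableSet {w : JumpRecord ι S | ∃ k, (w k).1 = ∞} := by
    simp only [Set.ofPred_exists]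
    exact MeasurableSet.iUnion fun k =>
      (measurableSet_singleton ∞).preimage (measurable_fst.comp (measurable_pi_apply k))
  exact ae_future hK hm fun C D u _ _ _ =>
    (ae_isRealisation hK _).mono fun v hv => hv.exists_top

/-- A first jump within one side leads to a juxtaposition again; a cross coagulation creates a
particle with labels from both sides, on which `F` integrates to zero. -/
theorem lintegral_future_glue (hK : Measurable (Function.uncurry K)) {a : State α S}
    {b : State β S} (ha : a ∅ = Sum.inr ()) (hb : b ∅ = Sum.inr ())
    (F : JumpRecord (α ⊕ β) S → ℝ≥0∞) (hF : Measurable F)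
    (hbad : ∀ z, Straddles z → ∫⁻ v, F v ∂(law K Υ z) = 0) :
    ∫⁻ v, F v ∂(future K Υ (glue a b)) =
      (∑ C, ∑ D, ((pairRate K a C D / 2 : ℝ≥0) : ℝ≥0∞) *
        ∫⁻ u, ∫⁻ v, F v ∂(law K Υ (glue (merge a C D u) b)) ∂(placement Υ a C D)) +
      ∑ C, ∑ D, ((pairRate K b C D / 2 : ℝ≥0) : ℝ≥0∞) *
        ∫⁻ u, ∫⁻ v, F v ∂(law K Υ (glue a (merge b C D u))) ∂(placement Υ b C D) := by
  rw [lintegral_future hK _ _ hF, sum_sum_glue ha]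
  · simp_rw [pairRate_glue_left, pairRate_glue_right ha hb, placement_glue_left,
      placement_glue_right ha hb, merge_glue_left]
    have z1 : ∀ C D, ((pairRate K (glue a b) (leftSet β C) (rightSet α D) / 2 : ℝ≥0) : ℝ≥0∞) *
        ∫⁻ u, ∫⁻ v, F v ∂(law K Υ (merge (glue a b) (leftSet β C) (rightSet α D) u))
        ∂(placement Υ (glue a b) (leftSet β C) (rightSet α D)) = 0 := by
      intro C D
      by_cases hC : C = ∅
      · rw [pairRate_of_inr (by rw [hC, glue_leftSet, ha])]; simp
      by_cases hD : D = ∅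
      · rw [pairRate_of_inr_right (by rw [hD, glue_rightSet ha hb, hb])]; simp
      simp [fun u => hbad _ (straddles_merge (glue a b) hC hD u).1]
    have z2 : ∀ C D, ((pairRate K (glue a b) (rightSet α C) (leftSet β D) / 2 : ℝ≥0) : ℝ≥0∞) *
        ∫⁻ u, ∫⁻ v, F v ∂(law K Υ (merge (glue a b) (rightSet α C) (leftSet β D) u))
        ∂(placement Υ (glue a b) (rightSet α C) (leftSet β D)) = 0 := by
      intro C D
      by_cases hC : C = ∅
      · rw [pairRate_of_inr (by rw [hC, glue_rightSet ha hb, hb])]; simp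
      by_cases hD : D = ∅
      · rw [pairRate_of_inr_right (by rw [hD, glue_leftSet, ha])]; simp
      simp [fun u => hbad _ (straddles_merge (glue a b) hD hC u).2]
    simp only [z1, z2, Finset.sum_const_zero, add_zero, zero_add]
    congr 1
    refine Finset.sum_congr rfl fun C _ => Finset.sum_congr rfl fun D _ => ?_
    by_cases hne : pairRate K b C D = 0
    · simp [hne]
    · obtain ⟨hC, hD, -⟩ := pairRate_ne_zero hne
      have ne : ∀ E ∈ blocks b, E ≠ ∅ := by
        rintro E hE rfl
        rw [mem_blocks, hb] at hE
        simp at hE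
      simp_rw [merge_glue_right a b (ne C hC) (ne D hD)]
  · intro C D h
    rw [pairRate_of_inr h]; simp
  · intro C D h
    rw [pairRate_of_inr_right h]; simp

set_option maxHeartbeats 1000000 in
/-- **Decoupling.** On the event that no particle with labels from both sides is formed up to time
`T`, the process started from a juxtaposition of two states is distributed as the juxtaposition of
two independent processes, with the density `exp (-∫_0^T crossRate dt)`. -/
theorem lintegral_law_glue (hK : Measurable (Function.uncurry K)) (hKsymm : ∀ p q, K p q = K q p)
    {T : ℝ} (hT : 0 ≤ T) {a : State α S} {b : State β S} (ha : a ∅ = Sum.inr ())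
    (hb : b ∅ = Sum.inr ()) (F : (ℝ → State (α ⊕ β) S) → ℝ≥0∞) (hF : Measurable F)
    (hdep : ∀ ω ω', (∀ t ∈ Set.Icc 0 T, ω t = ω' t) → F ω = F ω')
    (hbad : ∀ ω, Straddles (ω T) → F ω = 0) :
    ∫⁻ w, F (stateAt w) ∂(law K Υ (glue a b)) =
      ∫⁻ w, ∫⁻ w', expNeg (crossIntegral K T w w') *
        F (fun t => glue (stateAt w t) (stateAt w' t)) ∂(law K Υ b) ∂(law K Υ a) := by
  -- After a jump at time `s` the remaining horizon is `T - s` and the functional sees the path with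
  -- a constant piece prepended, so both vary in the induction.
  induction hn : (blocks a).card + (blocks b).card using Nat.strong_induction_on
    generalizing a b T F with
  | _ n ih =>
  have := isProbabilityMeasure_law hK a (Υ := Υ)
  have := isProbabilityMeasure_law hK b (Υ := Υ)
  have mΨ : ∀ (T : ℝ) (F : (ℝ → State (α ⊕ β) S) → ℝ≥0∞), Measurable F →
      Measurable fun p : JumpRecord α S × JumpRecord β S => expNeg (crossIntegral K T p.1 p.2) *
        F (fun t => glue (stateAt p.1 t) (stateAt p.2 t)) := fun T F hF =>
    (measurable_expNeg.comp (measurable_crossIntegral hK T)).mul (hF.comp measurable_glue_path)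
  rw [lintegral_law_horizon hK (glue a b) hT (fun w => F (stateAt w)) (hF.comp measurable_path)
    (fun w w' h => hdep _ _ h), lintegral_law_prod_horizon hK a b hT
    (fun w w' => expNeg (crossIntegral K T w w') * F (fun t => glue (stateAt w t) (stateAt w' t)))
    (mΨ T F hF)]
  swap
  · intro w v w' v' h h'
    rw [crossIntegral_congr h h', hdep _ _ fun t ht => by rw [h t ht, h' t ht]]
  rw [totalRate_glue hKsymm ha hb]
  congr 1
  -- No jump before `T`: the survival probability of the juxtaposition is that of the two processes
  -- times `e^{-crossRate T}`, and the last factor is the exponential weight of two constant paths.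
  · have h1 : (fun t => glue (stateAt (stayRecord a) t) (stateAt (stayRecord b) t)) =
        stateAt (stayRecord (glue a b)) := by
      funext t; simp only [stateAt_stayRecord]
    have h2 : crossIntegral K T (stayRecord a) (stayRecord b) =
        crossRate K a b * ENNReal.ofReal T := by
      simp [crossIntegral, stateAt_stayRecord]
    rw [h1, h2, expNeg_coe_mul_ofReal _ hT, ← mul_assoc,
      ← ENNReal.ofReal_mul (Real.exp_pos _).le, ← Real.exp_add]
    congr 3
    push_cast
    ring
  · refine setLIntegral_congr_fun measurableSet_Ioo fun s hs => ?_
    obtain ⟨hs0, hsT⟩ := hs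
    let G : (ℝ → State (α ⊕ β) S) → ℝ≥0∞ := fun ω => F (prependPath s (glue a b) ω)
    have hG : Measurable G := hF.comp (measurable_prependPath s _)
    have hGdep : ∀ ω ω', (∀ t ∈ Set.Icc 0 (T - s), ω t = ω' t) → G ω = G ω' := by
      intro ω ω' h
      refine hdep _ _ fun t ht => ?_
      unfold prependPath
      split_ifs with hts
      · rfl
      · exact h _ ⟨by linarith, by linarith [ht.2]⟩
    have hGbad : ∀ ω, Straddles (ω (T - s)) → G ω = 0 := by
      intro ω h
      refine hbad _ ?_
      rwa [prependPath, if_neg (by linarith)]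
    -- the left-hand side
    have L : ∫⁻ v, F (stateAt (consSeq (ENNReal.ofReal s, glue a b) v)) ∂(future K Υ (glue a b)) =
        ∫⁻ v, G (stateAt v) ∂(future K Υ (glue a b)) := by
      refine lintegral_congr_ae ?_
      filter_upwards [ae_future_exists_top hK (glue a b)] with v hv
      rw [stateAt_consSeq_eq_prependPath hs0 _ hv]
    have Lbad : ∀ z, Straddles z → ∫⁻ v, G (stateAt v) ∂(law K Υ z) = 0 := by
      intro z hz
      rw [lintegral_congr_ae (g := fun _ => 0), lintegral_zero]
      filter_upwards [ae_isRealisation hK z] with v hv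
      exact hGbad _ (straddles_mono hv hz _)
    rw [L, lintegral_future_glue hK ha hb (fun v => G (stateAt v)) (hG.comp measurable_path) Lbad]
    -- the right-hand side
    have glue_prepend : ∀ (w : JumpRecord α S) (w' : JumpRecord β S) (v : JumpRecord α S)
        (v' : JumpRecord β S), (∀ t < s, stateAt w t = a) →
        (∀ t, s ≤ t → stateAt w t = stateAt v (t - s)) → (∀ t < s, stateAt w' t = b) →
        (∀ t, s ≤ t → stateAt w' t = stateAt v' (t - s)) →
        expNeg (crossIntegral K T w w') * F (fun t => glue (stateAt w t) (stateAt w' t)) =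
        ENNReal.ofReal (Real.exp (-(crossRate K a b * s))) *
          (expNeg (crossIntegral K (T - s) v v') *
          G (fun t => glue (stateAt v t) (stateAt v' t))) := by
      intro w w' v v' h1 h2 h1' h2'
      rw [crossIntegral_split hs0 hsT h1 h2 h1' h2', expNeg_add, expNeg_coe_mul_ofReal _ hs0.le,
        mul_assoc]
      congr 3
      funext t
      simp only [prependPath]
      split_ifs with h
      · rw [h1 t h, h1' t h]
      · rw [h2 t (not_lt.1 h), h2' t (not_lt.1 h)]
    have RA : ∫⁻ v, ∫⁻ w', expNeg (crossIntegral K T (consSeq (ENNReal.ofReal s, a) v) (delay s w')) *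
        F (fun t => glue (stateAt (consSeq (ENNReal.ofReal s, a) v) t) (stateAt (delay s w') t))
        ∂(law K Υ b) ∂(future K Υ a) = ENNReal.ofReal (Real.exp (-(crossRate K a b * s))) *
        ∑ C, ∑ D, ((pairRate K a C D / 2 : ℝ≥0) : ℝ≥0∞) *
        ∫⁻ u, ∫⁻ v, G (stateAt v) ∂(law K Υ (glue (merge a C D u) b)) ∂(placement Υ a C D) := by
      have : ∀ᵐ v ∂(future K Υ a), ∫⁻ w', expNeg (crossIntegral K T
          (consSeq (ENNReal.ofReal s, a) v) (delay s w')) *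
          F (fun t => glue (stateAt (consSeq (ENNReal.ofReal s, a) v) t) (stateAt (delay s w') t))
          ∂(law K Υ b) = ENNReal.ofReal (Real.exp (-(crossRate K a b * s))) *
          ∫⁻ w', expNeg (crossIntegral K (T - s) v w') *
          G (fun t => glue (stateAt v t) (stateAt w' t)) ∂(law K Υ b) := by
        filter_upwards [ae_future_exists_top hK a] with v hv
        have h := (mΨ (T - s) G hG).comp (measurable_prodMk_left (x := v))
        simp only [Function.comp_def] at h
        rw [← lintegral_const_mul _ h]
        refine lintegral_congr_ae ?_
        filter_upwards [ae_isRealisation hK b] with w' hw'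
        exact glue_prepend _ _ _ _ (fun t ht => stateAt_consSeq_of_lt hs0 ht a v)
          (fun t ht => stateAt_consSeq_of_ge hs0.le ht a hv)
          (fun t ht => by rw [stateAt_delay_of_lt hs0 ht, hw'.zero])
          (fun t ht => stateAt_delay_of_ge hs0.le ht w')
      have m1 : Measurable fun v => ∫⁻ w', expNeg (crossIntegral K (T - s) v w') *
          G (fun t => glue (stateAt v t) (stateAt w' t)) ∂(law K Υ b) :=
        Measurable.lintegral_prod_right' (mΨ (T - s) G hG)
      rw [lintegral_congr_ae this, lintegral_const_mul _ m1, lintegral_future hK _ _ m1]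
      congr 1
      refine Finset.sum_congr rfl fun C _ => Finset.sum_congr rfl fun D _ => ?_
      by_cases hne : pairRate K a C D = 0
      · simp [hne]
      · obtain ⟨hC, hD, hCD⟩ := pairRate_ne_zero hne
        congr 1
        refine lintegral_congr fun u => ?_
        exact (ih _ (by have := blocks_merge_card_lt hC hD hCD u; omega) (T := T - s) (by linarith)
          (merge_empty ha hC u) hb G hG hGdep hGbad rfl).symm
    have RB : ∫⁻ v', ∫⁻ w, expNeg (crossIntegral K T (delay s w) (consSeq (ENNReal.ofReal s, b) v')) *
        F (fun t => glue (stateAt (delay s w) t) (stateAt (consSeq (ENNReal.ofReal s, b) v') t))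
        ∂(law K Υ a) ∂(future K Υ b) = ENNReal.ofReal (Real.exp (-(crossRate K a b * s))) *
        ∑ C, ∑ D, ((pairRate K b C D / 2 : ℝ≥0) : ℝ≥0∞) *
        ∫⁻ u, ∫⁻ v, G (stateAt v) ∂(law K Υ (glue a (merge b C D u))) ∂(placement Υ b C D) := by
      have : ∀ᵐ v' ∂(future K Υ b), ∫⁻ w, expNeg (crossIntegral K T (delay s w)
          (consSeq (ENNReal.ofReal s, b) v')) *
          F (fun t => glue (stateAt (delay s w) t) (stateAt (consSeq (ENNReal.ofReal s, b) v') t))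
          ∂(law K Υ a) = ENNReal.ofReal (Real.exp (-(crossRate K a b * s))) *
          ∫⁻ w, expNeg (crossIntegral K (T - s) w v') *
          G (fun t => glue (stateAt w t) (stateAt v' t)) ∂(law K Υ a) := by
        filter_upwards [ae_future_exists_top hK b] with v' hv'
        have h := (mΨ (T - s) G hG).comp (measurable_prodMk_right (y := v'))
        simp only [Function.comp_def] at h
        rw [← lintegral_const_mul _ h]
        refine lintegral_congr_ae ?_
        filter_upwards [ae_isRealisation hK a] with w hw
        exact glue_prepend _ _ _ _ (fun t ht => by rw [stateAt_delay_of_lt hs0 ht, hw.zero])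
          (fun t ht => stateAt_delay_of_ge hs0.le ht w)
          (fun t ht => stateAt_consSeq_of_lt hs0 ht b v')
          (fun t ht => stateAt_consSeq_of_ge hs0.le ht b hv')
      have m1 : Measurable fun v' => ∫⁻ w, expNeg (crossIntegral K (T - s) w v') *
          G (fun t => glue (stateAt w t) (stateAt v' t)) ∂(law K Υ a) :=
        Measurable.lintegral_prod_left' (mΨ (T - s) G hG)
      rw [lintegral_congr_ae this, lintegral_const_mul _ m1, lintegral_future hK _ _ m1]
      congr 1
      refine Finset.sum_congr rfl fun C _ => Finset.sum_congr rfl fun D _ => ?_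
      by_cases hne : pairRate K b C D = 0
      · simp [hne]
      · obtain ⟨hC, hD, hCD⟩ := pairRate_ne_zero hne
        congr 1
        refine lintegral_congr fun u => ?_
        -- The induction hypothesis integrates over the left process outside, whereas here the right
        -- process jumped and is outside; hence the exchange of integrals.
        rw [ih _ (by have := blocks_merge_card_lt hC hD hCD u; omega) (T := T - s) (by linarith)
          ha (merge_empty hb hC u) G hG hGdep hGbad rfl]
        have := isProbabilityMeasure_law hK (merge b C D u) (Υ := Υ)
        exact lintegral_lintegral_swap ((mΨ (T - s) G hG).comp measurable_swap).aemeasurable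
    rw [RA, RB, ← mul_add, ← mul_assoc, ← ENNReal.ofReal_mul (Real.exp_pos _).le, ← Real.exp_add]
    congr 3
    push_cast
    ring

end Decoupling

/-! ### Invariance under relabelling of the atoms; initial states. -/

section Relabel

variable {α ι S : Type*} [Fintype α] [DecidableEq α] [Fintype ι] [DecidableEq ι]
  [MeasurableSpace S]
variable {K : Particle S → Particle S → ℝ≥0} {Υ : Kernel (Particle S × Particle S) S}

/-- Change of labels in a state. -/
def relabel (σ : α ≃ ι) (z : State ι S) : State α S := fun E => z (σ.finsetCongr E)

/-- Change of labels in a record. -/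
def relabelRecord (σ : α ≃ ι) (w : JumpRecord ι S) : JumpRecord α S :=
  fun k => ((w k).1, relabel σ (w k).2)

theorem measurable_relabel (σ : α ≃ ι) : Measurable (relabel σ : State ι S → State α S) :=
  measurable_pi_lambda _ fun _ => measurable_pi_apply _

theorem measurable_relabelRecord (σ : α ≃ ι) :
    Measurable (relabelRecord σ : JumpRecord ι S → JumpRecord α S) :=
  measurable_pi_lambda _ fun k => (measurable_fst.comp (measurable_pi_apply k)).prodMk
    ((measurable_relabel σ).comp (measurable_snd.comp (measurable_pi_apply k)))

theorem mass_finsetCongr (σ : α ≃ ι) (C : Finset α) : mass (σ.finsetCongr C) = mass C := by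
  simp [mass]

theorem finsetCongr_union (σ : α ≃ ι) (C D : Finset α) :
    σ.finsetCongr (C ∪ D) = σ.finsetCongr C ∪ σ.finsetCongr D := by
  simp [Finset.map_union]

theorem merge_relabel (σ : α ≃ ι) (z : State ι S) (C D : Finset α) (u : S) :
    merge (relabel σ z) C D u = relabel σ (merge z (σ.finsetCongr C) (σ.finsetCongr D) u) := by
  funext E
  simp only [merge, relabel, ← finsetCongr_union, σ.finsetCongr.injective.eq_iff]

theorem pairRate_relabel (σ : α ≃ ι) (z : State ι S) (C D : Finset α) :
    pairRate K (relabel σ z) C D = pairRate K z (σ.finsetCongr C) (σ.finsetCongr D) := by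
  simp only [pairRate, relabel, mass_finsetCongr, σ.finsetCongr.injective.eq_iff]

theorem placement_relabel (σ : α ≃ ι) (z : State ι S) (C D : Finset α) :
    placement Υ (relabel σ z) C D = placement Υ z (σ.finsetCongr C) (σ.finsetCongr D) := by
  simp only [placement, relabel, mass_finsetCongr]

theorem totalRate_relabel (σ : α ≃ ι) (z : State ι S) :
    totalRate K (relabel σ z) = totalRate K z := by
  unfold totalRate
  congr 1
  simp_rw [pairRate_relabel]
  exact Fintype.sum_equiv σ.finsetCongr _ _ fun C => Fintype.sum_equiv σ.finsetCongr _ _ fun D => rfl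

theorem mem_blocks_relabel (σ : α ≃ ι) (z : State ι S) (C : Finset α) :
    C ∈ blocks (relabel σ z) ↔ σ.finsetCongr C ∈ blocks z := by
  simp only [mem_blocks, relabel]

theorem card_blocks_relabel (σ : α ≃ ι) (z : State ι S) :
    (blocks (relabel σ z)).card = (blocks z).card := by
  refine Finset.card_bij (fun C _ => σ.finsetCongr C) (fun C hC => (mem_blocks_relabel σ z C).1 hC)
    (fun C _ D _ h => σ.finsetCongr.injective h) fun C hC =>
    ⟨σ.finsetCongr.symm C, ?_, Equiv.apply_symm_apply _ _⟩
  rw [mem_blocks_relabel, Equiv.apply_symm_apply]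
  exact hC

/-- Rates and placements depend on label sets only through sites and cardinalities, so relabelling
commutes with every term of the renewal equation. -/
theorem lintegral_law_relabel [IsMarkovKernel Υ] (hK : Measurable (Function.uncurry K))
    (σ : α ≃ ι) (z : State ι S) (F : JumpRecord α S → ℝ≥0∞) (hF : Measurable F) :
    ∫⁻ w, F w ∂(law K Υ (relabel σ z)) = ∫⁻ w, F (relabelRecord σ w) ∂(law K Υ z) := by
  induction hn : (blocks z).card using Nat.strong_induction_on generalizing z F with
  | _ n ih =>
    have hF' : Measurable fun w => F (relabelRecord σ w) := hF.comp (measurable_relabelRecord σ)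
    by_cases hz : totalRate K z = 0
    · rw [law_of_totalRate_eq_zero hz, law_of_totalRate_eq_zero ((totalRate_relabel σ z).trans hz),
        lintegral_dirac' _ hF, lintegral_dirac' _ hF']
      rfl
    · rw [lintegral_law hK _ (by rwa [totalRate_relabel]) _ hF, lintegral_law hK _ hz _ hF']
      refine lintegral_congr fun s => ?_
      rw [totalRate_relabel]
      congr 1
      have hc := fun z : State ι S => measurable_consSeq_left z |>.comp
        (measurable_prodMk_left (x := s))
      have hc' := fun z : State α S => measurable_consSeq_left z |>.comp
        (measurable_prodMk_left (x := s))
      have hc1 : Measurable fun v => F (consSeq (ENNReal.ofReal s, relabel σ z) v) :=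
        hF.comp (hc' _)
      have hc2 : Measurable fun v => F (relabelRecord σ (consSeq (ENNReal.ofReal s, z) v)) :=
        hF'.comp (hc _)
      rw [lintegral_future hK _ _ hc1, lintegral_future hK _ _ hc2]
      refine Fintype.sum_equiv σ.finsetCongr _ _ fun C => Fintype.sum_equiv σ.finsetCongr _ _
        fun D => ?_
      rw [pairRate_relabel, placement_relabel]
      by_cases hne : pairRate K z (σ.finsetCongr C) (σ.finsetCongr D) = 0
      · rw [hne, zero_div, ENNReal.coe_zero, zero_mul, zero_mul]
      · obtain ⟨hC, hD, hCD⟩ := pairRate_ne_zero hne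
        congr 1
        refine lintegral_congr fun u => ?_
        rw [merge_relabel, ih _ (hn ▸ blocks_merge_card_lt hC hD hCD u) _ _ hc1 rfl]
        refine lintegral_congr fun v => ?_
        congr 1
        funext k
        cases k <;> rfl

theorem stateAt_relabelRecord (σ : α ≃ ι) (w : JumpRecord ι S) (t : ℝ) :
    stateAt (relabelRecord σ w) t = relabel σ (stateAt w t) := rfl

theorem relabel_initState (σ : α ≃ ι) (x : ι → S) :
    relabel σ (initState x) = initState (x ∘ σ) := by
  funext E
  by_cases h : ∃ i, E = {i}
  · obtain ⟨i, rfl⟩ := h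
    rw [initState_singleton]
    simp only [relabel, Equiv.finsetCongr_apply, Finset.map_singleton, Equiv.coe_toEmbedding]
    rw [initState_singleton]; rfl
  · have h' : ¬ ∃ i, σ.finsetCongr E = {i} := by
      rintro ⟨i, hi⟩
      refine h ⟨σ.symm i, σ.finsetCongr.injective ?_⟩
      rw [hi]; simp
    rw [relabel, initState, initState, dif_neg h, dif_neg h']

theorem measurable_initState : Measurable (initState : (ι → S) → State ι S) := by
  refine measurable_pi_lambda _ fun C => ?_
  unfold initState
  split_ifs
  · exact measurable_inl.comp (measurable_pi_apply _)
  · exact measurable_const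

theorem initState_empty (x : ι → S) : initState x ∅ = Sum.inr () := by
  rw [initState, dif_neg]
  rintro ⟨i, hi⟩
  exact Finset.singleton_ne_empty i hi.symm

theorem card_blocks_initState (x : ι → S) : (blocks (initState x)).card = Fintype.card ι := by
  have : blocks (initState x) = Finset.univ.image fun i : ι => ({i} : Finset ι) := by
    ext C
    rw [mem_blocks_initState]
    simp [eq_comm]
  rw [this, Finset.card_image_of_injective _ Finset.singleton_injective, Finset.card_univ]

theorem labelledLaw_eq (x : ι → S) : labelledLaw K Υ x = law K Υ (initState x) :=
  jumpLaw_eq_law _ (card_blocks_initState x).le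

theorem glue_initState (x : α ⊕ ι → S) :
    glue (initState (x ∘ Sum.inl)) (initState (x ∘ Sum.inr)) = initState x := by
  funext E
  by_cases h : ∃ i, E = {i}
  · obtain ⟨i | i, rfl⟩ := h
    · rw [initState_singleton]
      have : ({Sum.inl i} : Finset (α ⊕ ι)) = leftSet ι {i} := by ext j; cases j <;> simp [leftSet]
      rw [this, glue_leftSet, initState_singleton]; rfl
    · rw [initState_singleton]
      have : ({Sum.inr i} : Finset (α ⊕ ι)) = rightSet α {i} := by
        ext j; cases j <;> simp [rightSet]
      rw [this, glue_rightSet (initState_empty _) (initState_empty _), initState_singleton]; rfl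
  · have h' : initState x E = Sum.inr () := by rw [initState, dif_neg h]
    rw [h', glue]
    split_ifs with h1 h2
    · rw [initState, dif_neg]
      rintro ⟨i, hi⟩
      refine h ⟨Sum.inl i, ext_toLeft_toRight ?_ ?_⟩
      · rw [hi]; ext; simp [eq_comm]
      · rw [h1]; ext; simp
    · rw [initState, dif_neg]
      rintro ⟨i, hi⟩
      refine h ⟨Sum.inr i, ext_toLeft_toRight ?_ ?_⟩
      · rw [h2]; ext; simp
      · rw [hi]; ext; simp [eq_comm]
    · rfl

/-! ### Configurations -/

/-- The point mass of the particle `D`, if it is a particle of `z`. -/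
def particleMeasure (z : State ι S) (D : Finset ι) : Measure (Particle S) :=
  match z D with
  | Sum.inl x => Measure.dirac (x, mass D)
  | Sum.inr _ => 0

theorem subConfig_eq (z : State ι S) (C : Finset ι) :
    subConfig z C = ∑ D, if D ⊆ C then particleMeasure z D else 0 := by
  unfold subConfig
  rw [← Finset.sum_filter]
  refine Finset.sum_congr ?_ fun _ _ => rfl
  ext D; simp

theorem particleMeasure_of_notMem {z : State ι S} {D : Finset ι} (h : D ∉ blocks z) :
    particleMeasure z D = 0 := by
  rw [mem_blocks] at h
  unfold particleMeasure
  split <;> simp_all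

theorem particleMeasure_relabel (σ : α ≃ ι) (z : State ι S) (D : Finset α) :
    particleMeasure (relabel σ z) D = particleMeasure z (σ.finsetCongr D) := by
  simp only [particleMeasure, relabel, mass_finsetCongr]

theorem subConfig_relabel (σ : α ≃ ι) (z : State ι S) (C : Finset α) :
    subConfig (relabel σ z) C = subConfig z (σ.finsetCongr C) := by
  rw [subConfig_eq, subConfig_eq]
  refine Fintype.sum_equiv σ.finsetCongr _ _ fun D => ?_
  rw [particleMeasure_relabel]
  congr 1
  simp

theorem particleMeasure_glue_left (a : State α S) (b : State ι S) (C : Finset α) :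
    particleMeasure (glue a b) (leftSet ι C) = particleMeasure a C := by
  simp only [particleMeasure, glue_leftSet, mass_leftSet]

theorem particleMeasure_glue_right {a : State α S} {b : State ι S} (ha : a ∅ = Sum.inr ())
    (hb : b ∅ = Sum.inr ()) (C : Finset ι) :
    particleMeasure (glue a b) (rightSet α C) = particleMeasure b C := by
  simp only [particleMeasure, glue_rightSet ha hb, mass_rightSet]

theorem particleMeasure_of_inr {z : State ι S} {D : Finset ι} (h : z D = Sum.inr ()) :
    particleMeasure z D = 0 := by simp [particleMeasure, h]

theorem subset_iff_toLeft_toRight {E F : Finset (α ⊕ ι)} :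
    E ⊆ F ↔ E.toLeft ⊆ F.toLeft ∧ E.toRight ⊆ F.toRight := by
  simp [Finset.subset_iff]

theorem subConfig_glue_left {a : State α S} {b : State ι S} (ha : a ∅ = Sum.inr ())
    (hb : b ∅ = Sum.inr ()) (C : Finset α) :
    subConfig (glue a b) (leftSet ι C) = subConfig a C := by
  rw [subConfig_eq, subConfig_eq, sum_finset_sum]
  · rw [Finset.sum_eq_zero (s := Finset.univ) (f := fun D => if rightSet α D ⊆ leftSet ι C then
      particleMeasure (glue a b) (rightSet α D) else 0), add_zero]
    · refine Finset.sum_congr rfl fun D _ => ?_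
      rw [particleMeasure_glue_left]
      simp [subset_iff_toLeft_toRight]
    · intro D _
      rw [particleMeasure_glue_right ha hb]
      split_ifs with h
      · simp only [subset_iff_toLeft_toRight, toRight_rightSet, toRight_leftSet,
          Finset.subset_empty] at h
        rw [h.2, particleMeasure_of_inr hb]
      · rfl
  · rw [particleMeasure_of_inr (glue_empty ha)]; simp
  · intro E h1 h2
    rw [particleMeasure_of_inr (glue_eq_inr h1 h2)]; simp

theorem subConfig_glue_right {a : State α S} {b : State ι S} (ha : a ∅ = Sum.inr ())
    (hb : b ∅ = Sum.inr ()) (C : Finset ι) :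
    subConfig (glue a b) (rightSet α C) = subConfig b C := by
  rw [subConfig_eq, subConfig_eq, sum_finset_sum]
  · rw [Finset.sum_eq_zero (s := Finset.univ) (f := fun D => if leftSet ι D ⊆ rightSet α C then
      particleMeasure (glue a b) (leftSet ι D) else 0), zero_add]
    · refine Finset.sum_congr rfl fun D _ => ?_
      rw [particleMeasure_glue_right ha hb]
      simp [subset_iff_toLeft_toRight]
    · intro D _
      rw [particleMeasure_glue_left]
      split_ifs with h
      · simp only [subset_iff_toLeft_toRight, toLeft_rightSet, toLeft_leftSet,
          Finset.subset_empty] at h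
        rw [h.1, particleMeasure_of_inr ha]
      · rfl
  · rw [particleMeasure_of_inr (glue_empty ha)]; simp
  · intro E h1 h2
    rw [particleMeasure_of_inr (glue_eq_inr h1 h2)]; simp

theorem measurable_particleMeasure (D : Finset ι) :
    Measurable fun z : State ι S => particleMeasure z D := by
  have h : Measurable fun y : S ⊕ Unit =>
      (match y with
      | Sum.inl x => Measure.dirac (x, mass D)
      | Sum.inr _ => 0 : Measure (Particle S)) := by
    apply measurable_fun_sum
    · exact Measure.measurable_dirac.comp (measurable_id.prodMk measurable_const)
    · exact measurable_const
  exact h.comp (measurable_pi_apply D)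

theorem measurable_measure_add {X Y : Type*} [MeasurableSpace X] [MeasurableSpace Y]
    {f g : Y → Measure X} (hf : Measurable f) (hg : Measurable g) :
    Measurable fun y => f y + g y :=
  Measure.measurable_of_measurable_coe _ fun s hs => by
    simp only [Measure.add_apply]
    exact ((Measure.measurable_coe hs).comp hf).add ((Measure.measurable_coe hs).comp hg)

theorem measurable_measure_sum {X Y A : Type*} [MeasurableSpace X] [MeasurableSpace Y]
    (s : Finset A) {f : A → Y → Measure X} (hf : ∀ i, Measurable (f i)) :
    Measurable fun y => ∑ i ∈ s, f i y :=
  Measure.measurable_of_measurable_coe _ fun B hB => by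
    simp only [Measure.finsetSum_apply]
    exact Finset.measurable_fun_sum _ fun i _ => (Measure.measurable_coe hB).comp (hf i)

theorem measurable_subConfig (C : Finset ι) :
    Measurable fun z : State ι S => subConfig z C := by
  simp_rw [subConfig_eq]
  refine measurable_measure_sum _ fun D => ?_
  split_ifs
  · exact measurable_particleMeasure D
  · exact measurable_const

/-- The paths of measures on the time interval `[0,T]`. -/
abbrev MeasurePath (S : Type*) [MeasurableSpace S] (T : ℝ≥0) := TimeInt T → Measure (Particle S)

/-- The path of the particles with labels in `C`. -/
def pathConfig (T : ℝ≥0) (ω : ℝ → State ι S) (C : Finset ι) : MeasurePath S T :=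
  fun t => subConfig (ω t) C

theorem measurable_pathConfig (T : ℝ≥0) (C : Finset ι) :
    Measurable fun ω : ℝ → State ι S => pathConfig T ω C :=
  measurable_pi_lambda _ fun t => (measurable_subConfig C).comp (measurable_pi_apply (t : ℝ))

/-- The counting measure of the histories of the particles present at time `T`. -/
def historyMeasure (T : ℝ≥0) (ω : ℝ → State ι S) : Measure (MeasurePath S T) :=
  ∑ C, if C ∈ blocks (ω T) then Measure.dirac (pathConfig T ω C) else 0

theorem measurableSet_mem_blocks_at (t : ℝ) (C : Finset ι) :
    MeasurableSet {ω : ℝ → State ι S | C ∈ blocks (ω t)} :=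
  (measurableSet_mem_blocks C).preimage (measurable_pi_apply t)

theorem measurable_historyMeasure (T : ℝ≥0) :
    Measurable fun ω : ℝ → State ι S => historyMeasure T ω := by
  refine measurable_measure_sum _ fun C => ?_
  exact Measurable.ite (measurableSet_mem_blocks_at (T : ℝ) C)
    (Measure.measurable_dirac.comp (measurable_pathConfig T C)) measurable_const

/-- The point measure of histories forgets the labels. Together with i.i.d. sites this lets any set
of atoms be replaced by a standard one of the same size. -/
theorem historyMeasure_relabel (T : ℝ≥0) (σ : α ≃ ι) (ω : ℝ → State ι S) :
    historyMeasure T (fun t => relabel σ (ω t)) = historyMeasure T ω := by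
  unfold historyMeasure
  refine Fintype.sum_equiv σ.finsetCongr _ _ fun C => ?_
  simp only [mem_blocks_relabel]
  congr 2
  funext t
  exact subConfig_relabel σ _ C

theorem historyMeasure_congr {T : ℝ≥0} {ω ω' : ℝ → State ι S}
    (h : ∀ t ∈ Set.Icc (0 : ℝ) T, ω t = ω' t) : historyMeasure T ω = historyMeasure T ω' := by
  have h1 : ∀ C, pathConfig T ω C = pathConfig T ω' C := fun C => by
    funext t; simp only [pathConfig]; rw [h t t.2]
  unfold historyMeasure
  simp_rw [h1, h T ⟨T.2, le_rfl⟩]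

theorem mem_blocks_glue_left (a : State α S) (b : State ι S) (C : Finset α) :
    leftSet ι C ∈ blocks (glue a b) ↔ C ∈ blocks a := by
  simp only [mem_blocks, glue_leftSet]

theorem mem_blocks_glue_right {a : State α S} {b : State ι S} (ha : a ∅ = Sum.inr ())
    (hb : b ∅ = Sum.inr ()) (C : Finset ι) :
    rightSet α C ∈ blocks (glue a b) ↔ C ∈ blocks b := by
  simp only [mem_blocks, glue_rightSet ha hb]

theorem notMem_blocks_of_inr {z : State ι S} {C : Finset ι} (h : z C = Sum.inr ()) :
    C ∉ blocks z := by simp [mem_blocks, h]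

theorem card_blocks_eq_sum (z : State ι S) :
    (blocks z).card = ∑ C, if C ∈ blocks z then 1 else 0 := by
  rw [Finset.sum_ite_mem, Finset.univ_inter, Finset.sum_const, smul_eq_mul, mul_one]

theorem card_blocks_glue {a : State α S} {b : State ι S} (ha : a ∅ = Sum.inr ())
    (hb : b ∅ = Sum.inr ()) :
    (blocks (glue a b)).card = (blocks a).card + (blocks b).card := by
  rw [card_blocks_eq_sum, card_blocks_eq_sum a, card_blocks_eq_sum b, sum_finset_sum]
  · simp_rw [mem_blocks_glue_left, mem_blocks_glue_right ha hb]
  · simp [notMem_blocks_of_inr (glue_empty (b := b) ha)]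
  · intro E h1 h2
    simp [notMem_blocks_of_inr (glue_eq_inr (a := a) (b := b) h1 h2)]

/-- Particles of a juxtaposition lie entirely on one side, and a history follows only subsets of its
own label set. -/
theorem historyMeasure_glue (T : ℝ≥0) {ω : ℝ → State α S} {ω' : ℝ → State ι S}
    (h : ∀ t, ω t ∅ = Sum.inr ()) (h' : ∀ t, ω' t ∅ = Sum.inr ()) :
    historyMeasure T (fun t => glue (ω t) (ω' t)) = historyMeasure T ω + historyMeasure T ω' := by
  have e1 : ∀ C, pathConfig T (fun t => glue (ω t) (ω' t)) (leftSet ι C) = pathConfig T ω C :=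
    fun C => funext fun t => subConfig_glue_left (h t) (h' t) C
  have e2 : ∀ C, pathConfig T (fun t => glue (ω t) (ω' t)) (rightSet α C) = pathConfig T ω' C :=
    fun C => funext fun t => subConfig_glue_right (h t) (h' t) C
  unfold historyMeasure
  rw [sum_finset_sum]
  · simp_rw [mem_blocks_glue_left, mem_blocks_glue_right (h T) (h' T), e1, e2]
  · simp [notMem_blocks_of_inr (glue_empty (b := ω' T) (h T))]
  · intro E h1 h2
    simp [notMem_blocks_of_inr (glue_eq_inr (a := ω T) (b := ω' T) h1 h2)]

end Relabel

/-! ### Joint measurability for integrals against variable measures -/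

section FiniteKernel

variable {X Y : Type*} [MeasurableSpace X] [MeasurableSpace Y]

/-- The kernel that maps a finite measure to itself, and the other measures to zero. -/
def finiteKernel (X : Type*) [MeasurableSpace X] : Kernel (Measure X) X where
  toFun ν := open Classical in if ν Set.univ < ∞ then ν else 0
  measurable' := by
    refine Measurable.ite ?_ measurable_id measurable_const
    exact measurableSet_lt (Measure.measurable_coe MeasurableSet.univ) measurable_const

theorem finiteKernel_apply (ν : Measure X) [IsFiniteMeasure ν] : finiteKernel X ν = ν :=
  if_pos (measure_lt_top ν _)

/-- Cut according to the total mass: on the measures with mass in `[n, n + 1)` the kernel is finite,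
and these slices exhaust the finite measures. S-finiteness is what makes integrals against a
variable measure jointly measurable. -/
instance : IsSFiniteKernel (finiteKernel X) := by
  classical
  let P : ℕ → Set (Measure X) := fun n => {ν | (n : ℝ≥0∞) ≤ ν Set.univ ∧ ν Set.univ < n + 1}
  have hP : ∀ n, MeasurableSet (P n) := fun n =>
    (measurableSet_le measurable_const (Measure.measurable_coe MeasurableSet.univ)).inter
      (measurableSet_lt (Measure.measurable_coe MeasurableSet.univ) measurable_const)
  let κ : ℕ → Kernel (Measure X) X := fun n => Kernel.piecewise (hP n) (finiteKernel X) 0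
  have hκ : ∀ n ν, κ n ν = if ν ∈ P n then ν else 0 := by
    intro n ν
    simp only [κ, Kernel.piecewise_apply]
    split_ifs with h
    · exact if_pos (h.2.trans_le (by simp))
    · rfl
  have hfin : ∀ n, IsFiniteKernel (κ n) := fun n => ⟨n + 1, by simp [ENNReal.add_lt_top], fun ν => by
    rw [hκ]
    split_ifs with h
    · exact h.2.le
    · simp⟩
  refine ⟨κ, hfin, ?_⟩
  ext ν s hs
  rw [Kernel.sum_apply' _ _ hs]
  by_cases hν : ν Set.univ < ∞
  · have h0 : finiteKernel X ν = ν := if_pos hν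
    have hmem : ν ∈ P ⌊(ν Set.univ).toReal⌋₊ := by
      constructor
      · rw [← ENNReal.ofReal_natCast]
        exact (ENNReal.ofReal_le_ofReal (Nat.floor_le ENNReal.toReal_nonneg)).trans
          (ENNReal.ofReal_toReal hν.ne).le
      · have := Nat.lt_floor_add_one (ν Set.univ).toReal
        calc ν Set.univ = ENNReal.ofReal (ν Set.univ).toReal := (ENNReal.ofReal_toReal hν.ne).symm
          _ < ENNReal.ofReal ((⌊(ν Set.univ).toReal⌋₊ : ℝ) + 1) :=
              (ENNReal.ofReal_lt_ofReal_iff (by positivity)).2 this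
          _ = _ := by
            rw [ENNReal.ofReal_add (by positivity) (by norm_num), ENNReal.ofReal_natCast,
              ENNReal.ofReal_one]
    rw [h0, tsum_eq_single ⌊(ν Set.univ).toReal⌋₊]
    · rw [hκ, if_pos hmem]
    · intro m hm
      rw [hκ, if_neg]
      · simp
      · rintro ⟨h1, h2⟩
        refine hm ?_
        symm
        rw [Nat.floor_eq_iff ENNReal.toReal_nonneg]
        constructor
        · rw [← ENNReal.ofReal_le_ofReal_iff ENNReal.toReal_nonneg, ENNReal.ofReal_toReal hν.ne,
            ENNReal.ofReal_natCast]
          exact h1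
        · rw [← ENNReal.ofReal_lt_ofReal_iff (by positivity), ENNReal.ofReal_toReal hν.ne,
            ENNReal.ofReal_add (by positivity) (by norm_num), ENNReal.ofReal_natCast,
            ENNReal.ofReal_one]
          exact h2
  · have h0 : finiteKernel X ν = 0 := if_neg hν
    rw [h0]
    symm
    simp only [Measure.coe_zero, Pi.zero_apply, ENNReal.tsum_eq_zero]
    intro n
    rw [hκ, if_neg]
    · simp
    · rintro ⟨-, h2⟩
      exact hν (h2.trans_le (by simp))

theorem measurable_lintegral_finiteKernel {Z : Type*} [MeasurableSpace Z] {f : Z → X → ℝ≥0∞}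
    (hf : Measurable (Function.uncurry f)) {g : Z → Measure X} (hg : Measurable g) :
    Measurable fun z => ∫⁻ x, f z x ∂(finiteKernel X (g z)) :=
  Measurable.lintegral_kernel_prod_right (κ := (finiteKernel X).comap g hg) (f := f) hf

end FiniteKernel

/-! ### The interaction as a measurable functional of paths -/

section Interaction

variable {S : Type*} [MeasurableSpace S] {K : Particle S → Particle S → ℝ≥0} {T : ℝ≥0}

/-- The quantity `⟨φ, K ψ⟩`. -/
def pairing (K : Particle S → Particle S → ℝ≥0) (φ ψ : Measure (Particle S)) : ℝ≥0∞ :=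
  ∫⁻ p, ∫⁻ q, (K p q : ℝ≥0∞) ∂ψ ∂φ

/-- The quantity `⟨φ, K ψ⟩` for finite `φ`, `ψ`, extended by zero. -/
def finitePairing (K : Particle S → Particle S → ℝ≥0) (φ ψ : Measure (Particle S)) : ℝ≥0∞ :=
  ∫⁻ p, ∫⁻ q, (K p q : ℝ≥0∞) ∂(finiteKernel _ ψ) ∂(finiteKernel _ φ)

theorem finitePairing_eq (φ ψ : Measure (Particle S)) [IsFiniteMeasure φ] [IsFiniteMeasure ψ] :
    finitePairing K φ ψ = pairing K φ ψ := by
  simp only [finitePairing, finiteKernel_apply, pairing]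

theorem measurable_finitePairing (hK : Measurable (Function.uncurry K)) :
    Measurable fun p : Measure (Particle S) × Measure (Particle S) => finitePairing K p.1 p.2 := by
  have hK' : Measurable fun q : ((Measure (Particle S) × Measure (Particle S)) × Particle S) ×
      Particle S => (K q.1.2 q.2 : ℝ≥0∞) := by
    refine Measurable.coe_nnreal_ennreal ?_
    exact hK.comp ((measurable_snd.comp measurable_fst).prodMk measurable_snd)
  refine measurable_lintegral_finiteKernel (f := fun p x => ∫⁻ q, (K x q : ℝ≥0∞)
    ∂(finiteKernel _ p.2)) ?_ measurable_fst
  exact measurable_lintegral_finiteKernel (f := fun (p : (Measure (Particle S) ×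
    Measure (Particle S)) × Particle S) q => (K p.2 q : ℝ≥0∞)) hK'
    (measurable_snd.comp measurable_fst)

/-- Lebesgue measure on `[0,T]`. -/
def timeMeasure (T : ℝ≥0) : Measure (TimeInt T) := (volume : Measure ℝ).comap Subtype.val

theorem lintegral_timeMeasure (f : ℝ → ℝ≥0∞) :
    ∫⁻ t : TimeInt T, f t ∂(timeMeasure T) = ∫⁻ t in Set.Ioo (0 : ℝ) T, f t := by
  unfold timeMeasure
  rw [lintegral_subtype_comap measurableSet_Icc, setLIntegral_congr Ioo_ae_eq_Icc]

instance : IsFiniteMeasure (timeMeasure T) := by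
  constructor
  have := lintegral_timeMeasure (T := T) (fun _ => 1)
  rw [lintegral_one] at this
  rw [this]
  simp

/-- Approximation of times from the right by multiples of `1 / (n + 1)`. -/
def sampleTime (T : ℝ≥0) (n : ℕ) (k : ℤ) : TimeInt T :=
  ⟨max 0 (min (T : ℝ) (((k : ℝ) + 1) / ((n : ℝ) + 1))), le_max_left _ _,
    max_le T.2 (min_le_left _ _)⟩

theorem sampleTime_mem (n : ℕ) {t : TimeInt T} (ht : (t : ℝ) < T) :
    (t : ℝ) ≤ sampleTime T n ⌊(t : ℝ) * (n + 1)⌋ ∧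
      (sampleTime T n ⌊(t : ℝ) * (n + 1)⌋ : ℝ) ≤ t + 1 / ((n : ℝ) + 1) := by
  have hn : (0 : ℝ) < (n : ℝ) + 1 := by positivity
  have h1 : (t : ℝ) ≤ ((⌊(t : ℝ) * (n + 1)⌋ : ℝ) + 1) / ((n : ℝ) + 1) := by
    rw [le_div_iff₀ hn]; exact (Int.lt_floor_add_one _).le
  have h2 : ((⌊(t : ℝ) * (n + 1)⌋ : ℝ) + 1) / ((n : ℝ) + 1) ≤ t + 1 / ((n : ℝ) + 1) := by
    rw [div_le_iff₀ hn, add_mul, div_mul_cancel₀ _ hn.ne']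
    linarith [Int.floor_le ((t : ℝ) * (n + 1))]
  unfold sampleTime
  constructor
  · exact le_max_of_le_right (le_min ht.le h1)
  · exact max_le (by have := t.2.1; positivity) ((min_le_right _ _).trans h2)

/-- The paths on `[0,T]` with finitely many values that are constant on a right neighbourhood
of every time before `T`. -/
def IsRightStepOn {E : Type*} (ζ : TimeInt T → E) : Prop :=
  (Set.range ζ).Finite ∧ ∀ t : TimeInt T, (t : ℝ) < T →
    ∃ ε > 0, ∀ t' : TimeInt T, t ≤ t' → (t' : ℝ) < t + ε → ζ t' = ζ t

theorem IsRightStep.isRightStepOn {E : Type*} {η : ℝ → E} (h : IsRightStep η) :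
    IsRightStepOn fun t : TimeInt T => η t := by
  refine ⟨h.1.subset ?_, fun t ht => ?_⟩
  · rintro _ ⟨t, rfl⟩
    exact ⟨t, t.2.1, rfl⟩
  · obtain ⟨ε, hε, h'⟩ := h.2 t t.2.1
    exact ⟨ε, hε, fun t' h1 h2 => h' _ ⟨h1, h2⟩⟩

theorem IsRightStepOn.comp {E E' : Type*} {ζ : TimeInt T → E} (h : IsRightStepOn ζ) (g : E → E') :
    IsRightStepOn fun t => g (ζ t) := by
  refine ⟨?_, fun t ht => ?_⟩
  · have : Set.range (fun t => g (ζ t)) = g '' Set.range ζ := Set.range_comp g ζ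
    rw [this]
    exact h.1.image g
  · obtain ⟨ε, hε, h'⟩ := h.2 t ht
    exact ⟨ε, hε, fun t' h1 h2 => congrArg g (h' t' h1 h2)⟩

theorem IsRightStepOn.prodMk {E E' : Type*} {ζ : TimeInt T → E} {θ : TimeInt T → E'}
    (h : IsRightStepOn ζ) (h' : IsRightStepOn θ) : IsRightStepOn fun t => (ζ t, θ t) := by
  refine ⟨(h.1.prod h'.1).subset ?_, fun t ht => ?_⟩
  · rintro _ ⟨t, rfl⟩
    exact ⟨⟨t, rfl⟩, ⟨t, rfl⟩⟩
  · obtain ⟨ε, hε, h1⟩ := h.2 t ht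
    obtain ⟨δ, hδ, h2⟩ := h'.2 t ht
    refine ⟨min ε δ, lt_min hε hδ, fun t' ht1 ht2 => ?_⟩
    exact Prod.ext (h1 t' ht1 (ht2.trans_le (by gcongr; exact min_le_left _ _)))
      (h2 t' ht1 (ht2.trans_le (by gcongr; exact min_le_right _ _)))

/-- The sampled path factors through the integer `⌊t (n+1)⌋`, so it is measurable in time whatever
`ζ` is. -/
theorem measurable_sample {E : Type*} [MeasurableSpace E] (ζ : TimeInt T → E) (n : ℕ) :
    Measurable fun t : TimeInt T => ζ (sampleTime T n ⌊(t : ℝ) * (n + 1)⌋) := by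
  have h1 : Measurable fun t : TimeInt T => ⌊(t : ℝ) * (n + 1)⌋ :=
    Int.measurable_floor.comp (measurable_subtype_coe.mul_const _)
  exact (measurable_of_countable fun k : ℤ => ζ (sampleTime T n k)).comp h1

theorem ae_lt_timeMeasure : ∀ᵐ t : TimeInt T ∂(timeMeasure T), (t : ℝ) < T := by
  have hm : MeasurableSet {t : TimeInt T | ¬ (t : ℝ) < T} :=
    (measurableSet_lt measurable_subtype_coe measurable_const).compl
  rw [ae_iff, timeMeasure, Measure.comap_apply _ Subtype.val_injective
    (fun s hs => measurableSet_Icc.subtype_image hs) _ hm]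
  refine measure_mono_null (t := {(T : ℝ)}) ?_ (by simp)
  rintro _ ⟨t, ht, rfl⟩
  exact le_antisymm t.2.2 (not_lt.1 ht)

theorem IsRightStepOn.eventually_sample {E : Type*} {ζ : TimeInt T → E} (h : IsRightStepOn ζ)
    {t : TimeInt T} (ht : (t : ℝ) < T) :
    ∀ᶠ n : ℕ in Filter.atTop, ζ (sampleTime T n ⌊(t : ℝ) * (n + 1)⌋) = ζ t := by
  obtain ⟨ε, hε, h'⟩ := h.2 t ht
  have := (tendsto_one_div_add_atTop_nhds_zero_nat (𝕜 := ℝ)).eventually_lt_const hε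
  filter_upwards [this] with n hn
  have h1 := sampleTime_mem n ht
  exact h' _ h1.1 (by linarith [h1.2])

theorem IsRightStepOn.aemeasurable {ζ : TimeInt T → ℝ≥0∞} (h : IsRightStepOn ζ) :
    AEMeasurable ζ (timeMeasure T) := by
  refine aemeasurable_of_tendsto_metrizable_ae Filter.atTop
    (f := fun (n : ℕ) (t : TimeInt T) => ζ (sampleTime T n ⌊(t : ℝ) * (n + 1)⌋))
    (fun n => (measurable_sample ζ n).aemeasurable) ?_
  filter_upwards [ae_lt_timeMeasure] with t ht
  exact tendsto_const_nhds.congr' ((h.eventually_sample ht).mono fun n hn => hn.symm)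

theorem IsRightStepOn.exists_bound {ζ : TimeInt T → ℝ≥0∞} (h : IsRightStepOn ζ)
    (hfin : ∀ t, ζ t ≠ ∞) : ∃ c : ℝ≥0∞, c ≠ ∞ ∧ ∀ t, ζ t ≤ c := by
  refine ⟨∑ y ∈ h.1.toFinset, y, ?_, fun t => ?_⟩
  · refine ENNReal.sum_ne_top.2 fun y hy => ?_
    obtain ⟨t, rfl⟩ := h.1.mem_toFinset.1 hy
    exact hfin t
  · exact Finset.single_le_sum (f := fun y : ℝ≥0∞ => y) (fun _ _ => zero_le)
      (h.1.mem_toFinset.2 ⟨t, rfl⟩)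

/-- The sample times approach `t` from the right, where the path is constant, so pointwise the
sampled value is eventually exact; finitely many finite values give a bound. -/
theorem IsRightStepOn.tendsto_lintegral {ζ : TimeInt T → ℝ≥0∞} (h : IsRightStepOn ζ)
    (hfin : ∀ t, ζ t ≠ ∞) :
    Filter.Tendsto (fun n : ℕ => ∫⁻ t, ζ (sampleTime T n ⌊(t : ℝ) * (n + 1)⌋) ∂(timeMeasure T))
      Filter.atTop (nhds (∫⁻ t, ζ t ∂(timeMeasure T))) := by
  obtain ⟨c, hc, hb⟩ := h.exists_bound hfin
  refine tendsto_lintegral_of_dominated_convergence (fun _ => c) (fun n => measurable_sample ζ n)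
    (fun n => Filter.Eventually.of_forall fun t => hb _) ?_ ?_
  · rw [lintegral_const]
    exact ENNReal.mul_ne_top hc (measure_ne_top _ _)
  · filter_upwards [ae_lt_timeMeasure] with t ht
    exact tendsto_const_nhds.congr' ((h.eventually_sample ht).mono fun n hn => hn.symm)

/-- A measurable version of the interaction `∫_0^T ⟨η_t, K η'_t⟩ dt` on the space of all paths. -/
def pathInteraction (K : Particle S → Particle S → ℝ≥0) (η η' : MeasurePath S T) : ℝ≥0∞ :=
  Filter.limsup (fun n : ℕ => ∫⁻ t, finitePairing K (η (sampleTime T n ⌊(t : ℝ) * (n + 1)⌋))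
    (η' (sampleTime T n ⌊(t : ℝ) * (n + 1)⌋)) ∂(timeMeasure T)) Filter.atTop

theorem measurable_pathInteraction (hK : Measurable (Function.uncurry K)) :
    Measurable fun p : MeasurePath S T × MeasurePath S T => pathInteraction K p.1 p.2 := by
  refine Measurable.limsup fun n => ?_
  -- For fixed `n` and `k` only one time coordinate of each path enters, so the product σ-algebra
  -- suffices although time is uncountable.
  have h1 : Measurable fun q : ℤ × (MeasurePath S T × MeasurePath S T) =>
      finitePairing K (q.2.1 (sampleTime T n q.1)) (q.2.2 (sampleTime T n q.1)) := by
    refine measurable_from_prod_countable_right fun k => ?_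
    have h3 : Measurable fun q : MeasurePath S T × MeasurePath S T =>
        (q.1 (sampleTime T n k), q.2 (sampleTime T n k)) :=
      ((measurable_pi_apply (sampleTime T n k)).comp measurable_fst).prodMk
        ((measurable_pi_apply (sampleTime T n k)).comp measurable_snd)
    exact (measurable_finitePairing hK).comp h3
  have h2 : Measurable fun q : (MeasurePath S T × MeasurePath S T) × TimeInt T =>
      (⌊(q.2 : ℝ) * (n + 1)⌋, q.1) := by
    refine Measurable.prodMk ?_ measurable_fst
    exact Int.measurable_floor.comp ((measurable_subtype_coe.comp measurable_snd).mul_const _)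
  exact Measurable.lintegral_prod_right' (h1.comp h2)

theorem measurable_pathInteraction_right (hK : Measurable (Function.uncurry K))
    (η : MeasurePath S T) : Measurable fun η' : MeasurePath S T => pathInteraction K η η' :=
  Measurable.comp (g := fun p : MeasurePath S T × MeasurePath S T => pathInteraction K p.1 p.2)
    (f := fun η' => (η, η')) (measurable_pathInteraction hK) measurable_prodMk_left

theorem pathInteraction_eq {η η' : MeasurePath S T} (h : IsRightStepOn η) (h' : IsRightStepOn η')
    (hfin : ∀ t, IsFiniteMeasure (η t)) (hfin' : ∀ t, IsFiniteMeasure (η' t))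
    (hne : ∀ t, pairing K (η t) (η' t) ≠ ∞) :
    pathInteraction K η η' = ∫⁻ t, pairing K (η t) (η' t) ∂(timeMeasure T) := by
  unfold pathInteraction
  simp_rw [finitePairing_eq]
  have hs : IsRightStepOn fun t => pairing K (η t) (η' t) :=
    (h.prodMk h').comp fun p => pairing K p.1 p.2
  exact (hs.tendsto_lintegral hne).limsup_eq

end Interaction

/-! ### The process with i.i.d. initial sites -/

section InitLaw

variable {α ι S : Type*} [Fintype α] [DecidableEq α] [Fintype ι] [DecidableEq ι]
  [MeasurableSpace S]
variable {K : Particle S → Particle S → ℝ≥0} {Υ : Kernel (Particle S × Particle S) S}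
  {μ : Measure S}

/-- The law of the process when the atoms are labelled by `ι`, with i.i.d. initial sites. -/
def initLaw (ι : Type*) [Fintype ι] [DecidableEq ι] (K : Particle S → Particle S → ℝ≥0)
    (Υ : Kernel (Particle S × Particle S) S) (μ : Measure S) : Measure (JumpRecord ι S) :=
  (Measure.pi fun _ : ι => μ).bind fun x => law K Υ (initState x)

theorem measurable_law_initState [IsMarkovKernel Υ] (hK : Measurable (Function.uncurry K)) :
    Measurable fun x : ι → S => law K Υ (initState x) :=
  (measurable_law hK).comp measurable_initState

theorem lintegral_initLaw [IsMarkovKernel Υ] (hK : Measurable (Function.uncurry K))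
    {F : JumpRecord ι S → ℝ≥0∞} (hF : Measurable F) :
    ∫⁻ w, F w ∂(initLaw ι K Υ μ) =
      ∫⁻ x, ∫⁻ w, F w ∂(law K Υ (initState x)) ∂(Measure.pi fun _ : ι => μ) :=
  Measure.lintegral_bind (measurable_law_initState hK).aemeasurable hF.aemeasurable

variable [IsProbabilityMeasure μ] [IsMarkovKernel Υ]

theorem isProbabilityMeasure_initLaw (hK : Measurable (Function.uncurry K)) :
    IsProbabilityMeasure (initLaw ι K Υ μ) := by
  constructor
  rw [← lintegral_one, lintegral_initLaw hK measurable_const]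
  have : ∀ x : ι → S, ∫⁻ _, 1 ∂(law K Υ (initState x)) = 1 := fun x => by
    have := isProbabilityMeasure_law (Υ := Υ) hK (initState x)
    simp
  simp [this]

/-- A measurable description of the initial states. -/
def IsInitState (z : State ι S) : Prop :=
  (∀ i, (z {i}).isLeft) ∧ ∀ C, (¬ ∃ i, C = {i}) → ¬ (z C).isLeft

theorem isInitState_initState (x : ι → S) : IsInitState (initState x) := by
  refine ⟨fun i => by rw [initState_singleton]; rfl, fun C hC h => ?_⟩
  exact hC (mem_blocks_initState.1 (mem_blocks.2 h))

theorem IsInitState.exists_eq {z : State ι S} (h : IsInitState z) :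
    ∃ x : ι → S, z = initState x := by
  choose x hx using fun i => Sum.isLeft_iff.1 (h.1 i)
  refine ⟨x, funext fun C => ?_⟩
  by_cases hC : ∃ i, C = {i}
  · obtain ⟨i, rfl⟩ := hC
    rw [hx, initState_singleton]
  · have := h.2 C hC
    rw [Bool.not_eq_true, Sum.isLeft_eq_false, Sum.isRight_iff] at this
    obtain ⟨u, hu⟩ := this
    rw [hu, initState, dif_neg hC]

theorem measurableSet_isInitState : MeasurableSet {z : State ι S | IsInitState z} := by
  unfold IsInitState
  simp only [Set.ofPred_and, Set.ofPred_forall]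
  refine (MeasurableSet.iInter fun i => ?_).inter
    (MeasurableSet.iInter fun C => MeasurableSet.iInter fun _ => MeasurableSet.compl ?_)
  · exact measurableSet_isLeft.preimage (measurable_pi_apply _)
  · exact measurableSet_isLeft.preimage (measurable_pi_apply _)

/-- The realisations that start from singletons. -/
def goodRecords (ι S : Type*) [Fintype ι] [DecidableEq ι] : Set (JumpRecord ι S) :=
  {w | IsInitState (w 0).2 ∧
    ∀ k, (w k).1 ≠ 0 ∧ ((w k).1 = ∞ ∨ IsMerge (w k).2 (w (k + 1)).2)}

theorem measurableSet_goodRecords [MeasurableEq S] : MeasurableSet (goodRecords ι S) := by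
  unfold goodRecords
  simp only [Set.ofPred_and, Set.ofPred_forall, Set.ofPred_or]
  have h1 : ∀ k, Measurable fun w : JumpRecord ι S => (w k).1 := fun k =>
    measurable_fst.comp (measurable_pi_apply k)
  have h2 : ∀ k, Measurable fun w : JumpRecord ι S => (w k).2 := fun k =>
    measurable_snd.comp (measurable_pi_apply k)
  refine ((h2 0) measurableSet_isInitState).inter 
    (MeasurableSet.iInter fun k => ?_)
  refine ((h1 k) (measurableSet_singleton 0).compl).inter ?_
  exact ((h1 k) (measurableSet_singleton ∞)).union
    (((h2 k).prodMk (h2 (k + 1))) measurableSet_isMerge)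

theorem exists_isRealisation_of_mem_goodRecords {w : JumpRecord ι S} (h : w ∈ goodRecords ι S) :
    ∃ x : ι → S, IsRealisation (initState x) w := by
  obtain ⟨x, hx⟩ := h.1.exists_eq
  exact ⟨x, hx ▸ StepsAreMerges.isRealisation ⟨rfl, h.2⟩⟩

theorem ae_law_mem_goodRecords [MeasurableEq S] (hK : Measurable (Function.uncurry K))
    (x : ι → S) : ∀ᵐ w ∂(law K Υ (initState x)), w ∈ goodRecords ι S := by
  filter_upwards [ae_stepsAreMerges hK (initState x)] with w hw
  refine ⟨?_, ?_⟩
  · rw [hw.1]; exact isInitState_initState x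
  · exact hw.2

theorem ae_initLaw_mem_goodRecords [MeasurableEq S] (hK : Measurable (Function.uncurry K)) :
    ∀ᵐ w ∂(initLaw ι K Υ μ), w ∈ goodRecords ι S := by
  rw [ae_iff]
  have hm : MeasurableSet {w : JumpRecord ι S | w ∉ goodRecords ι S} :=
    measurableSet_goodRecords.compl
  rw [initLaw, Measure.bind_apply hm (measurable_law_initState hK).aemeasurable]
  simp_rw [fun x : ι → S => ae_iff.1 (ae_law_mem_goodRecords (Υ := Υ) hK x)]
  simp

theorem ae_initLaw_isRealisation [MeasurableEq S] (hK : Measurable (Function.uncurry K)) :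
    ∀ᵐ w ∂(initLaw ι K Υ μ), ∃ x : ι → S, IsRealisation (initState x) w :=
  (ae_initLaw_mem_goodRecords hK).mono fun _ => exists_isRealisation_of_mem_goodRecords

theorem lintegral_pi_relabel (σ : α ≃ ι) {G : (α → S) → ℝ≥0∞} (hG : Measurable G) :
    ∫⁻ x, G x ∂(Measure.pi fun _ : α => μ) =
      ∫⁻ y, G (y ∘ σ) ∂(Measure.pi fun _ : ι => μ) := by
  have h := (measurePreserving_piCongrLeft (fun _ : ι => μ) σ).symm
  rw [← h.lintegral_comp hG]
  rfl

/-- Exchangeability: the product of identical site laws is invariant under reindexing, and the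
dynamics commute with it. -/
theorem lintegral_initLaw_relabel (hK : Measurable (Function.uncurry K)) (σ : α ≃ ι)
    {F : JumpRecord α S → ℝ≥0∞} (hF : Measurable F) :
    ∫⁻ w, F w ∂(initLaw α K Υ μ) = ∫⁻ w, F (relabelRecord σ w) ∂(initLaw ι K Υ μ) := by
  have hF' : Measurable fun w => F (relabelRecord σ w) := hF.comp (measurable_relabelRecord σ)
  rw [lintegral_initLaw hK hF, lintegral_initLaw hK hF', lintegral_pi_relabel σ]
  · simp_rw [← relabel_initState, lintegral_law_relabel hK σ _ F hF]
  · exact (Measure.measurable_lintegral hF).comp (measurable_law_initState hK)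

/-- Decoupling averaged over the sites. The product law on `α ⊕ ι` splits into a product, so the two
groups also have independent initial sites. -/
theorem lintegral_initLaw_glue [MeasurableEq S] (hK : Measurable (Function.uncurry K))
    (hKsymm : ∀ p q, K p q = K q p) {T : ℝ} (hT : 0 ≤ T)
    (F : (ℝ → State (α ⊕ ι) S) → ℝ≥0∞) (hF : Measurable F)
    (hdep : ∀ ω ω', (∀ t ∈ Set.Icc 0 T, ω t = ω' t) → F ω = F ω')
    (hbad : ∀ ω, Straddles (ω T) → F ω = 0) :
    ∫⁻ w, F (stateAt w) ∂(initLaw (α ⊕ ι) K Υ μ) =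
      ∫⁻ w, ∫⁻ w', expNeg (crossIntegral K T w w') *
        F (fun t => glue (stateAt w t) (stateAt w' t)) ∂(initLaw ι K Υ μ) ∂(initLaw α K Υ μ) := by
  have hF1 : Measurable fun w : JumpRecord (α ⊕ ι) S => F (stateAt w) := hF.comp measurable_path
  obtain ⟨Φ, hΦ⟩ : ∃ Φ : JumpRecord α S × JumpRecord ι S → ℝ≥0∞, ∀ w w', Φ (w, w') =
      expNeg (crossIntegral K T w w') * F (fun t => glue (stateAt w t) (stateAt w' t)) :=
    ⟨fun p => expNeg (crossIntegral K T p.1 p.2) *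
        F (fun t => glue (stateAt p.1 t) (stateAt p.2 t)), fun _ _ => rfl⟩
  have hF2 : Measurable Φ := by
    have : Φ = fun p => expNeg (crossIntegral K T p.1 p.2) *
        F (fun t => glue (stateAt p.1 t) (stateAt p.2 t)) := funext fun p => hΦ p.1 p.2
    rw [this]
    exact (measurable_expNeg.comp (measurable_crossIntegral hK T)).mul (hF.comp measurable_glue_path)
  have hglue : ∀ x : α → S, ∀ y : ι → S,
      ∫⁻ w, F (stateAt w) ∂(law K Υ (glue (initState x) (initState y))) =
        ∫⁻ w, ∫⁻ w', Φ (w, w') ∂(law K Υ (initState y)) ∂(law K Υ (initState x)) := fun x y => by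
    rw [lintegral_law_glue hK hKsymm hT (initState_empty x) (initState_empty y) F hF hdep hbad]
    simp_rw [hΦ]
  simp_rw [← hΦ]
  have hG : Measurable fun x : α ⊕ ι → S => ∫⁻ w, F (stateAt w) ∂(law K Υ (initState x)) :=
    (Measure.measurable_lintegral hF1).comp (measurable_law_initState hK)
  clear hΦ hF hdep hbad
  have hF3 : ∀ w, Measurable fun w' : JumpRecord ι S => Φ (w, w') :=
    fun w => hF2.comp measurable_prodMk_left
  have := isProbabilityMeasure_initLaw (ι := ι) (Υ := Υ) (μ := μ) hK
  have hl := fun y : ι → S => isProbabilityMeasure_law (Υ := Υ) hK (initState y)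
  have hF4 : Measurable fun w : JumpRecord α S => ∫⁻ w', Φ (w, w') ∂(initLaw ι K Υ μ) :=
    hF2.lintegral_prod_right'
  rw [lintegral_initLaw hK hF1, lintegral_initLaw hK hF4]
  have h := measurePreserving_sumPiEquivProdPi_symm (X := fun _ : α ⊕ ι => S) (fun _ => μ)
  have hG' := (hG.comp h.measurable).aemeasurable
    (μ := (Measure.pi fun _ : α => μ).prod (Measure.pi fun _ : ι => μ))
  simp only [Function.comp_def] at hG'
  rw [← h.lintegral_comp hG, lintegral_prod _ hG']
  refine lintegral_congr fun x => ?_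
  have e : ∀ y : ι → S, initState ((MeasurableEquiv.sumPiEquivProdPi fun _ : α ⊕ ι => S).symm
      (x, y)) = glue (initState x) (initState y) := fun y => by
    rw [← glue_initState]; rfl
  simp_rw [e, hglue]
  have hp := isProbabilityMeasure_law (Υ := Υ) hK (initState x)
  -- The sites `y` of the second group have to move inside the integral over the first process,
  -- where they join the second process to form `initLaw ι`.
  rw [lintegral_lintegral_swap]
  · exact lintegral_congr fun w => (lintegral_initLaw hK (hF3 w)).symm
  · let κ : Kernel ((ι → S) × JumpRecord α S) (JumpRecord ι S) :=
      ⟨fun p => law K Υ (initState p.1), (measurable_law_initState hK).comp measurable_fst⟩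
    have : IsMarkovKernel κ := ⟨fun p => hl p.1⟩
    have hm : Measurable fun p : ((ι → S) × JumpRecord α S) × JumpRecord ι S =>
        Φ (p.1.2, p.2) :=
      hF2.comp ((measurable_snd.comp measurable_fst).prodMk measurable_snd)
    exact (Measurable.lintegral_kernel_prod_right' (κ := κ) hm).aemeasurable

end InitLaw

/-! ### Nested partitions -/

section Nested

variable {ι S : Type*} [Fintype ι] [DecidableEq ι] [MeasurableSpace S]

theorem IsRealisation.exists_superset_of_le {z : State ι S} {w : JumpRecord ι S}
    (h : IsRealisation z w) {t t' : ℝ} (htt : t ≤ t') {E : Finset ι}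
    (hE : E ∈ blocks (stateAt w t)) : ∃ E' ∈ blocks (stateAt w t'), E ⊆ E' := by
  induction h generalizing t t' with
  | stay z w h =>
    rw [stateAt_of_top h] at hE
    exact ⟨E, by rwa [stateAt_of_top h], subset_rfl⟩
  | jump z C D u s v hs hC hD hCD hv ih =>
    by_cases h1 : t' < s
    · rw [stateAt_consSeq_of_lt hs (htt.trans_lt h1)] at hE
      exact ⟨E, by rwa [stateAt_consSeq_of_lt hs h1], subset_rfl⟩
    · rw [stateAt_consSeq_of_ge hs.le (not_lt.1 h1) z hv.exists_top]
      by_cases h2 : t < s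
      · rw [stateAt_consSeq_of_lt hs h2] at hE
        obtain ⟨E', hE', h3⟩ := exists_superset_mem_blocks_merge (C := C) (D := D) u hE
        obtain ⟨E'', hE'', h4⟩ := hv.exists_superset hE' (t' - s)
        exact ⟨E'', hE'', h3.trans h4⟩
      · rw [stateAt_consSeq_of_ge hs.le (not_lt.1 h2) z hv.exists_top] at hE
        exact ih (by linarith) hE

/-- When `z'` is a coarser partition, each particle of `z`, being nonempty, is contained in exactly
one block of `z'` and is counted once. -/
theorem sum_subConfig_blocks {z z' : State ι S} (hz : IsPartitionState z)
    (hz' : IsPartitionState z') (h : ∀ E ∈ blocks z, ∃ E' ∈ blocks z', E ⊆ E') :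
    ∑ C ∈ blocks z', subConfig z C = subConfig z Finset.univ := by
  simp_rw [subConfig_eq]
  rw [Finset.sum_comm]
  refine Finset.sum_congr rfl fun D _ => ?_
  rw [if_pos (Finset.subset_univ _)]
  by_cases hD : D ∈ blocks z
  · obtain ⟨E, hE, hDE⟩ := h D hD
    rw [Finset.sum_eq_single E, if_pos hDE]
    · intro F hF hFE
      rw [if_neg]
      intro hDF
      obtain ⟨i, hi⟩ := hz.nonempty D hD
      exact Finset.disjoint_left.1 (hz'.disjoint F hF E hE hFE) (hDF hi) (hDE hi)
    · exact fun h => absurd hE h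
  · simp [particleMeasure_of_notMem hD]

theorem IsPartitionState.eq_singleton_univ {z : State ι S} (hz : IsPartitionState z)
    (h : Finset.univ ∈ blocks z) : blocks z = {Finset.univ} := by
  ext C
  rw [Finset.mem_singleton]
  constructor
  · intro hC
    by_contra hne
    obtain ⟨i, hi⟩ := hz.nonempty C hC
    exact Finset.disjoint_left.1 (hz.disjoint C hC _ h hne) hi (Finset.mem_univ i)
  · rintro rfl; exact h

theorem historyMeasure_eq_sum_blocks (T : ℝ≥0) (ω : ℝ → State ι S) :
    historyMeasure T ω = ∑ C ∈ blocks (ω T), Measure.dirac (pathConfig T ω C) := by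
  rw [historyMeasure, Finset.sum_ite_mem, Finset.univ_inter]

instance (z : State ι S) (C : Finset ι) : IsFiniteMeasure (particleMeasure z C) := by
  unfold particleMeasure
  split <;> infer_instance

instance (z : State ι S) (C : Finset ι) : IsFiniteMeasure (subConfig z C) := by
  rw [subConfig_eq]
  have : ∀ D, IsFiniteMeasure (if D ⊆ C then particleMeasure z D else 0) := fun D => by
    split_ifs <;> infer_instance
  constructor
  rw [Measure.finsetSum_apply]
  exact ENNReal.sum_lt_top.2 fun D _ => measure_lt_top _ _

theorem subConfig_univ_eq (z : State ι S) : subConfig z Finset.univ = ∑ D, particleMeasure z D := by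
  simp [subConfig_eq]

end Nested

/-! ### The integrated cross rate as a sum of interactions of histories. -/

section Cross

variable {α ι S : Type*} [Fintype α] [DecidableEq α] [Fintype ι] [DecidableEq ι]
  [MeasurableSpace S] {K : Particle S → Particle S → ℝ≥0}

theorem pairing_finsetSum_left {A : Type*} (s : Finset A)
    (φ : A → Measure (Particle S)) (ψ : Measure (Particle S)) :
    pairing K (∑ i ∈ s, φ i) ψ = ∑ i ∈ s, pairing K (φ i) ψ :=
  lintegral_finsetSum_measure _ _ _

theorem pairing_finsetSum_right {A : Type*} (hK : Measurable (Function.uncurry K)) (s : Finset A)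
    (φ : Measure (Particle S)) (ψ : A → Measure (Particle S)) [∀ i, IsFiniteMeasure (ψ i)] :
    pairing K φ (∑ i ∈ s, ψ i) = ∑ i ∈ s, pairing K φ (ψ i) := by
  unfold pairing
  simp_rw [lintegral_finsetSum_measure]
  refine lintegral_finsetSum _ fun i _ => ?_
  exact Measurable.lintegral_prod_right' (f := fun p : Particle S × Particle S =>
    (K p.1 p.2 : ℝ≥0∞)) hK.coe_nnreal_ennreal

theorem pairing_particleMeasure (hK : Measurable (Function.uncurry K)) (a : State α S)
    (b : State ι S) (C : Finset α) (D : Finset ι) :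
    pairing K (particleMeasure a C) (particleMeasure b D) = crossPairRate K a b C D := by
  unfold pairing particleMeasure crossPairRate
  have h1 : ∀ p, Measurable fun q => (K p q : ℝ≥0∞) := fun p =>
    (hK.comp measurable_prodMk_left).coe_nnreal_ennreal
  have h2 : ∀ q, Measurable fun p => (K p q : ℝ≥0∞) := fun p =>
    (hK.comp measurable_prodMk_right).coe_nnreal_ennreal
  cases a C <;> cases b D <;> simp [lintegral_dirac' _ (h1 _), lintegral_dirac' _ (h2 _)]

theorem pairing_subConfig (hK : Measurable (Function.uncurry K)) (a : State α S)
    (b : State ι S) :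
    pairing K (subConfig a Finset.univ) (subConfig b Finset.univ) = crossRate K a b := by
  rw [subConfig_univ_eq, subConfig_univ_eq, pairing_finsetSum_left]
  simp_rw [pairing_finsetSum_right hK, pairing_particleMeasure hK]
  simp [crossRate]

theorem pairing_mono {φ φ' ψ ψ' : Measure (Particle S)} (h : φ ≤ φ') (h' : ψ ≤ ψ') :
    pairing K φ ψ ≤ pairing K φ' ψ' :=
  lintegral_mono' h fun _ => lintegral_mono' h' fun _ => le_rfl

theorem subConfig_le (z : State ι S) (C : Finset ι) : subConfig z C ≤ subConfig z Finset.univ := by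
  refine Measure.le_iff.2 fun s _ => ?_
  rw [subConfig_univ_eq, subConfig_eq, Measure.finsetSum_apply, Measure.finsetSum_apply]
  refine Finset.sum_le_sum fun D _ => ?_
  split_ifs <;> simp

theorem pairing_subConfig_ne_top (hK : Measurable (Function.uncurry K)) (a : State α S)
    (b : State ι S) (C : Finset α) (D : Finset ι) :
    pairing K (subConfig a C) (subConfig b D) ≠ ∞ := by
  refine ne_top_of_le_ne_top ?_ (pairing_mono (subConfig_le a C) (subConfig_le b D))
  rw [pairing_subConfig hK]
  exact ENNReal.coe_ne_top

theorem IsRealisation.isRightStepOn_pathConfig {z : State ι S} {w : JumpRecord ι S}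
    (h : IsRealisation z w) (T : ℝ≥0) (C : Finset ι) :
    IsRightStepOn (pathConfig T (stateAt w) C) :=
  (h.isRightStep.comp fun z => subConfig z C).isRightStepOn

/-- At each time the cross rate is the bilinear pairing of the two configurations. By nestedness of
the partitions, the second configuration is the sum of the histories of its final particles. -/
theorem crossIntegral_eq_lintegral_historyMeasure (hK : Measurable (Function.uncurry K)) {T : ℝ≥0}
    {a : State α S} {b : State ι S} {w : JumpRecord α S} {w' : JumpRecord ι S}
    (h : IsRealisation a w) (h' : IsRealisation b w') (hb : IsPartitionState b) :
    crossIntegral K T w w' = ∫⁻ η, pathInteraction K (pathConfig T (stateAt w) Finset.univ) η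
      ∂(historyMeasure T (stateAt w')) := by
  have hm := measurable_pathInteraction_right (T := T) hK
    (pathConfig T (stateAt w) Finset.univ)
  rw [historyMeasure_eq_sum_blocks, lintegral_finsetSum_measure]
  simp_rw [lintegral_dirac' _ hm]
  have e : ∀ C, pathInteraction K (pathConfig T (stateAt w) Finset.univ)
      (pathConfig T (stateAt w') C) = ∫⁻ t : TimeInt T, pairing K
        (subConfig (stateAt w t) Finset.univ) (subConfig (stateAt w' t) C) ∂(timeMeasure T) := by
    intro C
    refine pathInteraction_eq (h.isRightStepOn_pathConfig T _) (h'.isRightStepOn_pathConfig T _)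
      (fun t => ?_) (fun t => ?_) fun t => pairing_subConfig_ne_top hK _ _ _ _
    all_goals unfold pathConfig; infer_instance
  simp_rw [e]
  rw [← lintegral_finsetSum' _ fun C _ => ?_, crossIntegral, ← lintegral_timeMeasure]
  · refine lintegral_congr fun t => ?_
    rw [← pairing_finsetSum_right hK, sum_subConfig_blocks (h'.isPartitionState hb _)
      (h'.isPartitionState hb _) fun E hE => h'.exists_superset_of_le t.2.2 hE,
      pairing_subConfig hK]
  · have := ((h.isRightStepOn_pathConfig T Finset.univ).prodMk
      (h'.isRightStepOn_pathConfig T C)).comp fun p => pairing K p.1 p.2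
    exact this.aemeasurable

end Cross

/-! ### Splitting off one particle of the final configuration -/

section Split

variable {α ι S : Type*} [Fintype α] [DecidableEq α] [Fintype ι] [DecidableEq ι]
  [MeasurableSpace S]
variable {K : Particle S → Particle S → ℝ≥0} {Υ : Kernel (Particle S × Particle S) S}
  {μ : Measure S} {T : ℝ≥0}

theorem measurable_card_blocks : Measurable fun z : State ι S => (blocks z).card := by
  simp_rw [card_blocks_eq_sum]
  exact Finset.measurable_fun_sum _ fun C _ =>
    Measurable.ite (measurableSet_mem_blocks C) measurable_const measurable_const

theorem measurableSet_card_blocks (k : ℕ) :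
    MeasurableSet {z : State ι S | (blocks z).card = k} :=
  measurable_card_blocks (measurableSet_singleton k)

theorem measurableSet_straddles : MeasurableSet {z : State (α ⊕ ι) S | Straddles z} := by
  unfold Straddles
  simp only [Set.ofPred_exists, Set.ofPred_and]
  exact MeasurableSet.iUnion fun E => (measurableSet_mem_blocks E).inter
    ((MeasurableSet.const _).inter (MeasurableSet.const _))

theorem measurableSet_mem_blocks_stateAt (t : ℝ) (C : Finset ι) :
    MeasurableSet {w : JumpRecord ι S | C ∈ blocks (stateAt w t)} :=
  (measurableSet_mem_blocks C).preimage (measurable_stateAt t)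

theorem measurableSet_card_blocks_stateAt (t : ℝ) (k : ℕ) :
    MeasurableSet {w : JumpRecord ι S | (blocks (stateAt w t)).card = k} :=
  (measurableSet_card_blocks k).preimage (measurable_stateAt t)

theorem measurable_historyMeasure_stateAt (T : ℝ≥0) :
    Measurable fun w : JumpRecord ι S => historyMeasure T (stateAt w) :=
  (measurable_historyMeasure T).comp measurable_path

theorem measurable_pathConfig_stateAt (T : ℝ≥0) (C : Finset ι) :
    Measurable fun w : JumpRecord ι S => pathConfig T (stateAt w) C :=
  (measurable_pathConfig T C).comp measurable_path

instance (ω : ℝ → State ι S) : IsFiniteMeasure (historyMeasure T ω) := by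
  rw [historyMeasure_eq_sum_blocks]
  infer_instance

/-- The functional of the remaining particles, when a particle with history `ξ` is split off. -/
def tilt (K : Particle S → Particle S → ℝ≥0) (F : Measure (MeasurePath S T) → ℝ≥0∞)
    (ξ : MeasurePath S T) (Y : Measure (MeasurePath S T)) : ℝ≥0∞ :=
  expNeg (∫⁻ η, pathInteraction K ξ η ∂(finiteKernel _ Y)) * F (Measure.dirac ξ + Y)

theorem measurable_tilt (hK : Measurable (Function.uncurry K))
    {F : Measure (MeasurePath S T) → ℝ≥0∞} (hF : Measurable F) :
    Measurable fun p : MeasurePath S T × Measure (MeasurePath S T) => tilt K F p.1 p.2 := by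
  unfold tilt
  refine Measurable.mul (measurable_expNeg.comp ?_) (hF.comp ?_)
  · refine measurable_lintegral_finiteKernel (f := fun (p : MeasurePath S T ×
      Measure (MeasurePath S T)) η => pathInteraction K p.1 η) ?_ measurable_snd
    exact Measurable.comp (g := fun p : MeasurePath S T × MeasurePath S T =>
      pathInteraction K p.1 p.2) (f := fun q : (MeasurePath S T × Measure (MeasurePath S T)) ×
        MeasurePath S T => (q.1.1, q.2)) (measurable_pathInteraction hK)
      ((measurable_fst.comp measurable_fst).prodMk measurable_snd)
  · exact measurable_measure_add (Measure.measurable_dirac.comp measurable_fst) measurable_snd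

theorem measurable_tilt_right (hK : Measurable (Function.uncurry K))
    {F : Measure (MeasurePath S T) → ℝ≥0∞} (hF : Measurable F) (ξ : MeasurePath S T) :
    Measurable (tilt K F ξ) :=
  Measurable.comp (g := fun p : MeasurePath S T × Measure (MeasurePath S T) => tilt K F p.1 p.2)
    (f := fun Y => (ξ, Y)) (measurable_tilt hK hF) measurable_prodMk_left

variable [IsProbabilityMeasure μ] [IsMarkovKernel Υ] [MeasurableEq S]

/-- If the left labels form one particle at time `T`, no particle straddles the two sides, so the
decoupling applies. The weight becomes the exponential of the interactions of that particle's
history with the others. -/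
theorem lintegral_initLaw_split_sum (hK : Measurable (Function.uncurry K))
    (hKsymm : ∀ p q, K p q = K q p) (k : ℕ)
    {F : Measure (MeasurePath S T) → ℝ≥0∞} (hF : Measurable F) :
    ∫⁻ v, (if leftSet ι Finset.univ ∈ blocks (stateAt v T) then
        if (blocks (stateAt v T)).card = k + 1 then F (historyMeasure T (stateAt v)) else 0
        else 0) ∂(initLaw (α ⊕ ι) K Υ μ) =
      ∫⁻ w, (if Finset.univ ∈ blocks (stateAt w T) then
        ∫⁻ w', (if (blocks (stateAt w' T)).card = k then
          tilt K F (pathConfig T (stateAt w) Finset.univ) (historyMeasure T (stateAt w')) else 0)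
          ∂(initLaw ι K Υ μ) else 0) ∂(initLaw α K Υ μ) := by
  classical
  -- The decoupling demands a functional that vanishes on every straddling path; this modification
  -- changes the integrand only on a null set, where the blocks do not form a partition.
  let Φ : (ℝ → State (α ⊕ ι) S) → ℝ≥0∞ := fun ω =>
    if Straddles (ω T) then 0 else if leftSet ι Finset.univ ∈ blocks (ω T) then
        if (blocks (ω T)).card = k + 1 then F (historyMeasure T ω) else 0 else 0
  have hΦ : Measurable Φ := by
    refine Measurable.ite (measurableSet_straddles.preimage (measurable_pi_apply (T : ℝ)))
      measurable_const (Measurable.ite (measurableSet_mem_blocks_at (T : ℝ) _)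
      (Measurable.ite ((measurableSet_card_blocks (k + 1)).preimage (measurable_pi_apply (T : ℝ)))
      (hF.comp (measurable_historyMeasure T)) measurable_const) measurable_const)
  have hdep : ∀ ω ω', (∀ t ∈ Set.Icc (0 : ℝ) T, ω t = ω' t) → Φ ω = Φ ω' := by
    intro ω ω' h
    simp only [Φ, h T ⟨T.2, le_rfl⟩, historyMeasure_congr h]
  have e1 : ∀ᵐ v ∂(initLaw (α ⊕ ι) K Υ μ),
      (if leftSet ι Finset.univ ∈ blocks (stateAt v T) then
        if (blocks (stateAt v T)).card = k + 1 then F (historyMeasure T (stateAt v)) else 0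
        else 0) = Φ (stateAt v) := by
    filter_upwards [ae_initLaw_isRealisation hK] with v ⟨x, hv⟩
    have hp := hv.isPartitionState (isPartitionState_initState x) T
    simp only [Φ]
    split_ifs with h1 h2 h3 h3 <;> try rfl
    exfalso
    obtain ⟨E, hE, hl, hr⟩ := h3
    have hne : E ≠ leftSet ι Finset.univ := fun h => hr (by rw [h, toRight_leftSet])
    obtain ⟨i, hi⟩ := Finset.nonempty_iff_ne_empty.2 hl
    refine Finset.disjoint_left.1 (hp.disjoint E hE _ h1 hne) (Finset.mem_toLeft.1 hi) ?_
    rw [← Finset.mem_toLeft, toLeft_leftSet]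
    exact Finset.mem_univ i
  rw [lintegral_congr_ae e1, lintegral_initLaw_glue hK hKsymm (NNReal.coe_nonneg T) Φ hΦ hdep
    fun ω h => if_pos h]
  refine lintegral_congr_ae ?_
  filter_upwards [ae_initLaw_isRealisation hK] with w ⟨x, hw⟩
  have hpw := fun t => hw.isPartitionState (isPartitionState_initState x) t
  have hne : ∀ t, stateAt w t ∅ = Sum.inr () := fun t => by
    by_contra h
    have : ∅ ∈ blocks (stateAt w t) := by
      rw [mem_blocks]
      cases hz : stateAt w t ∅ <;> simp_all
    exact Finset.not_nonempty_empty ((hpw t).nonempty _ this)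
  have key : ∀ᵐ w' ∂(initLaw ι K Υ μ), expNeg (crossIntegral K T w w') *
      Φ (fun t => glue (stateAt w t) (stateAt w' t)) =
      if Finset.univ ∈ blocks (stateAt w T) then if (blocks (stateAt w' T)).card = k then
          tilt K F (pathConfig T (stateAt w) Finset.univ) (historyMeasure T (stateAt w')) else 0
      else 0 := by
    filter_upwards [ae_initLaw_isRealisation hK] with w' ⟨y, hw'⟩
    have hpw' := fun t => hw'.isPartitionState (isPartitionState_initState y) t
    have hne' : ∀ t, stateAt w' t ∅ = Sum.inr () := fun t => by
      by_contra h
      have : ∅ ∈ blocks (stateAt w' t) := by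
        rw [mem_blocks]
        cases hz : stateAt w' t ∅ <;> simp_all
      exact Finset.not_nonempty_empty ((hpw' t).nonempty _ this)
    have hstr : ¬ Straddles (glue (stateAt w T) (stateAt w' T)) := by
      rintro ⟨E, hE, hl, hr⟩
      exact notMem_blocks_of_inr (glue_eq_inr hl hr) hE
    simp only [Φ, if_neg hstr, mem_blocks_glue_left, card_blocks_glue (hne T) (hne' T),
      historyMeasure_glue T hne hne']
    by_cases hu : Finset.univ ∈ blocks (stateAt w T)
    · have hs := (hpw T).eq_singleton_univ hu
      rw [if_pos hu, if_pos hu, historyMeasure_eq_sum_blocks T (stateAt w), hs,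
        Finset.sum_singleton, Finset.card_singleton, Nat.add_comm 1 _]
      by_cases hc : (blocks (stateAt w' T)).card = k
      · rw [if_pos hc, if_pos (by rw [hc]), tilt, finiteKernel_apply,
          crossIntegral_eq_lintegral_historyMeasure hK hw hw' (isPartitionState_initState y)]
      · rw [if_neg hc, if_neg (by omega), mul_zero]
    · rw [if_neg hu, if_neg hu, mul_zero]
  rw [lintegral_congr_ae key]
  split_ifs <;> simp

/-- The contribution of a particle made of `p` atoms and of `q` further atoms. -/
def splitIntegral (K : Particle S → Particle S → ℝ≥0) (Υ : Kernel (Particle S × Particle S) S)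
    (μ : Measure S) (k : ℕ) (F : Measure (MeasurePath S T) → ℝ≥0∞) (p q : ℕ) : ℝ≥0∞ :=
  ∫⁻ w, (if Finset.univ ∈ blocks (stateAt w T) then
    ∫⁻ w', (if (blocks (stateAt w' T)).card = k then
      tilt K F (pathConfig T (stateAt w) Finset.univ) (historyMeasure T (stateAt w')) else 0)
      ∂(initLaw (Fin q) K Υ μ) else 0) ∂(initLaw (Fin p) K Υ μ)

/-- By exchangeability the contribution of a set `A` as a final particle depends only on its size.
-/
theorem lintegral_initLaw_split (hK : Measurable (Function.uncurry K))
    (hKsymm : ∀ p q, K p q = K q p) (k n : ℕ)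
    {F : Measure (MeasurePath S T) → ℝ≥0∞} (hF : Measurable F) (A : Finset (Fin n)) :
    ∫⁻ v, (if A ∈ blocks (stateAt v T) then
        if (blocks (stateAt v T)).card = k + 1 then F (historyMeasure T (stateAt v)) else 0
        else 0) ∂(initLaw (Fin n) K Υ μ) = splitIntegral K Υ μ k F A.card (n - A.card) := by
  have hc : Aᶜ.card = n - A.card := by rw [Finset.card_compl, Fintype.card_fin]
  -- Enumerates `A` on the left and its complement on the right, so that the left labels are sent
  -- onto `A`.
  let σ : Fin A.card ⊕ Fin (n - A.card) ≃ Fin n := finSumEquivOfFinset rfl hc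
  have hσ : σ.finsetCongr (leftSet _ Finset.univ) = A := by
    ext i
    simp only [Equiv.finsetCongr_apply, Finset.mem_map_equiv, leftSet, Finset.mem_disjSum,
      Finset.mem_univ, true_and, Finset.notMem_empty, false_and, exists_false, or_false]
    constructor
    · rintro ⟨j, hj⟩
      rw [Equiv.eq_symm_apply] at hj
      rw [← hj, finSumEquivOfFinset_inl]
      exact Finset.orderEmbOfFin_mem _ _ _
    · intro hi
      obtain ⟨j, hj⟩ : i ∈ Set.range (A.orderEmbOfFin rfl) := by
        rw [Finset.range_orderEmbOfFin]; exact hi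
      refine ⟨j, ?_⟩
      rw [Equiv.eq_symm_apply, finSumEquivOfFinset_inl]
      exact hj
  have hm : Measurable fun v : JumpRecord (Fin A.card ⊕ Fin (n - A.card)) S =>
      (if leftSet _ Finset.univ ∈ blocks (stateAt v T) then
        if (blocks (stateAt v T)).card = k + 1 then F (historyMeasure T (stateAt v)) else 0
        else 0) :=
    Measurable.ite (measurableSet_mem_blocks_stateAt (T : ℝ) _)
      (Measurable.ite (measurableSet_card_blocks_stateAt (T : ℝ) (k + 1))
      (hF.comp (measurable_historyMeasure_stateAt T)) measurable_const) measurable_const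
  rw [splitIntegral, ← lintegral_initLaw_split_sum hK hKsymm k hF,
    lintegral_initLaw_relabel hK σ hm]
  refine lintegral_congr fun v => ?_
  have e : ∀ t, stateAt (relabelRecord σ v) t = relabel σ (stateAt v t) :=
    stateAt_relabelRecord σ v
  have e2 : stateAt (relabelRecord σ v) = fun t => relabel σ (stateAt v t) := rfl
  simp only [e, mem_blocks_relabel, card_blocks_relabel, hσ, e2, historyMeasure_relabel]

end Split

/-! ### The law of the histories of all particles -/

section HistoryLaw

variable {S : Type*} [MeasurableSpace S]
variable {K : Particle S → Particle S → ℝ≥0} {Υ : Kernel (Particle S × Particle S) S}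
  {μ : Measure S} {T : ℝ≥0}

/-- The weights `N^n / n!`. -/
def poissonWeight (N n : ℕ) : ℝ≥0∞ := (N : ℝ≥0∞) ^ n / (n.factorial : ℝ≥0∞)

theorem poissonWeight_mul_choose (N p q : ℕ) :
    poissonWeight N (p + q) * ((p + q).choose p : ℝ≥0∞) =
      poissonWeight N p * poissonWeight N q := by
  unfold poissonWeight
  have h := Nat.add_choose_mul_factorial_mul_factorial p q
  rw [← Nat.choose_symm_add] at h
  have e : ∀ n : ℕ, (n.factorial : ℝ≥0∞) ≠ 0 := fun n => by exact_mod_cast n.factorial_ne_zero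
  have e' : ∀ n : ℕ, (n.factorial : ℝ≥0∞) ≠ ∞ := fun n => by simp
  have h' : ((p + q).choose p : ℝ≥0∞) * p.factorial * q.factorial = (p + q).factorial := by
    exact_mod_cast h
  rw [div_eq_mul_inv, div_eq_mul_inv, div_eq_mul_inv, pow_add, ← h',
    ENNReal.mul_inv (Or.inr (e' _)) (Or.inr (e _)),
    ENNReal.mul_inv (Or.inr (e' _)) (Or.inr (e _))]
  have hc : ((p + q).choose p : ℝ≥0∞) ≠ 0 := by
    have := (Nat.choose_pos (Nat.le_add_right p q)).ne'
    exact_mod_cast this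
  calc (N : ℝ≥0∞) ^ p * N ^ q * (((p + q).choose p : ℝ≥0∞)⁻¹ * (p.factorial : ℝ≥0∞)⁻¹ *
        (q.factorial : ℝ≥0∞)⁻¹) * (p + q).choose p
      = N ^ p * N ^ q * (p.factorial : ℝ≥0∞)⁻¹ * (q.factorial : ℝ≥0∞)⁻¹ *
        (((p + q).choose p : ℝ≥0∞) * ((p + q).choose p : ℝ≥0∞)⁻¹) := by ring
    _ = _ := by rw [ENNReal.mul_inv_cancel hc (by simp)]; ring

/-- The law of the collection of the histories of the particles at time `T`, when there are `k`
of them, where the configurations with `n` atoms have weight `N^n / n!`. -/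
def historyLaw (K : Particle S → Particle S → ℝ≥0) (Υ : Kernel (Particle S × Particle S) S)
    (μ : Measure S) (N : ℕ) (T : ℝ≥0) (k : ℕ) : Measure (Measure (MeasurePath S T)) :=
  Measure.sum fun n => poissonWeight N n • ((initLaw (Fin n) K Υ μ).restrict
    {w | (blocks (stateAt w T)).card = k}).map fun w => historyMeasure T (stateAt w)

/-- The law of the history of a single particle, where the particles with `n` atoms have
weight `N^n / n!`. -/
def singleLaw (K : Particle S → Particle S → ℝ≥0) (Υ : Kernel (Particle S × Particle S) S)
    (μ : Measure S) (N : ℕ) (T : ℝ≥0) : Measure (MeasurePath S T) :=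
  Measure.sum fun n => poissonWeight N n • ((initLaw (Fin n) K Υ μ).restrict
    {w | Finset.univ ∈ blocks (stateAt w T)}).map fun w => pathConfig T (stateAt w) Finset.univ

theorem lintegral_historyLaw (N k : ℕ) {F : Measure (MeasurePath S T) → ℝ≥0∞} (hF : Measurable F) :
    ∫⁻ Y, F Y ∂(historyLaw K Υ μ N T k) = ∑' n, poissonWeight N n * ∫⁻ w,
      (if (blocks (stateAt w T)).card = k then F (historyMeasure T (stateAt w)) else 0)
      ∂(initLaw (Fin n) K Υ μ) := by
  rw [historyLaw, lintegral_sum_measure]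
  refine tsum_congr fun n => ?_
  rw [lintegral_smul_measure, lintegral_map hF (measurable_historyMeasure_stateAt T),
    ← lintegral_indicator (measurableSet_card_blocks_stateAt (T : ℝ) k), smul_eq_mul]
  simp only [Set.indicator_apply, Set.mem_ofPred_eq]

theorem lintegral_singleLaw (N : ℕ) {G : MeasurePath S T → ℝ≥0∞} (hG : Measurable G) :
    ∫⁻ ξ, G ξ ∂(singleLaw K Υ μ N T) = ∑' n, poissonWeight N n * ∫⁻ w,
      (if Finset.univ ∈ blocks (stateAt w T) then G (pathConfig T (stateAt w) Finset.univ) else 0)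
      ∂(initLaw (Fin n) K Υ μ) := by
  rw [singleLaw, lintegral_sum_measure]
  refine tsum_congr fun n => ?_
  rw [lintegral_smul_measure, lintegral_map hG (measurable_pathConfig_stateAt T _),
    ← lintegral_indicator (measurableSet_mem_blocks_stateAt (T : ℝ) _), smul_eq_mul]
  simp only [Set.indicator_apply, Set.mem_ofPred_eq]

variable [IsProbabilityMeasure μ] [IsMarkovKernel Υ]

theorem tsum_poissonWeight (N : ℕ) :
    ∑' n, poissonWeight N n = ENNReal.ofReal (Real.exp N) := by
  have h := NormedSpace.expSeries_div_hasSum_exp (𝔸 := ℝ) (N : ℝ)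
  rw [← Real.exp_eq_exp_ℝ] at h
  have e : ∀ n, poissonWeight N n = ENNReal.ofReal ((N : ℝ) ^ n / n.factorial) := fun n => by
    rw [ENNReal.ofReal_div_of_pos (by positivity), ENNReal.ofReal_pow (by positivity),
      ENNReal.ofReal_natCast, ENNReal.ofReal_natCast]
    rfl
  simp_rw [e]
  rw [← ENNReal.ofReal_tsum_of_nonneg (fun n => by positivity) h.summable, h.tsum_eq]

theorem isFiniteMeasure_singleLaw (hK : Measurable (Function.uncurry K)) (N : ℕ) :
    IsFiniteMeasure (singleLaw K Υ μ N T) := by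
  constructor
  rw [← lintegral_one, lintegral_singleLaw N measurable_const]
  refine lt_of_le_of_lt (b := ∑' n, poissonWeight N n) ?_ ?_
  · refine ENNReal.tsum_le_tsum fun n => ?_
    have := isProbabilityMeasure_initLaw (ι := Fin n) (Υ := Υ) (μ := μ) hK
    refine mul_le_of_le_one_right' ?_
    refine (lintegral_mono (g := fun _ => 1) fun w => ?_).trans (by simp)
    split_ifs <;> simp
  · rw [tsum_poissonWeight]; exact ENNReal.ofReal_lt_top

theorem sFinite_historyLaw (hK : Measurable (Function.uncurry K)) (N k : ℕ) :
    SFinite (historyLaw K Υ μ N T k) := by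
  have : ∀ n, SFinite (poissonWeight N n • ((initLaw (Fin n) K Υ μ).restrict
    {w | (blocks (stateAt w T)).card = k}).map fun w => historyMeasure T (stateAt w)) := fun n => by
    have := isProbabilityMeasure_initLaw (ι := Fin n) (Υ := Υ) (μ := μ) hK
    infer_instance
  unfold historyLaw
  infer_instance

/-- The subsets of size `p` produce a binomial coefficient, which turns the weight of `p + q` atoms
into the product of the weights of `p` and `q`. The sum over `n` is then a sum over all pairs `(p,
q)`. -/
theorem tsum_sum_choose (N : ℕ) (J : ℕ → ℕ → ℝ≥0∞) :
    ∑' n, poissonWeight N n * ∑ A : Finset (Fin n), J A.card (n - A.card) =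
      ∑' p, poissonWeight N p * ∑' q, poissonWeight N q * J p q := by
  have h : ∀ n, poissonWeight N n * ∑ A : Finset (Fin n), J A.card (n - A.card) =
      ∑ x ∈ Finset.HasAntidiagonal.antidiagonal n, poissonWeight N x.1 * (poissonWeight N x.2 * J x.1 x.2) := by
    intro n
    have := Finset.sum_powerset_apply_card (fun m => J m (n - m)) (x := (Finset.univ : Finset (Fin n)))
    rw [Finset.powerset_univ, Finset.card_univ, Fintype.card_fin] at this
    rw [this, Finset.Nat.sum_antidiagonal_eq_sum_range_succ (fun p q =>
      poissonWeight N p * (poissonWeight N q * J p q)), Finset.mul_sum]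
    refine Finset.sum_congr rfl fun m hm => ?_
    have hmn : m + (n - m) = n := by have := Finset.mem_range.1 hm; omega
    have := poissonWeight_mul_choose N m (n - m)
    rw [hmn] at this
    rw [nsmul_eq_mul, ← mul_assoc, this, mul_assoc]
  simp_rw [h, ← ENNReal.tsum_mul_left]
  rw [← ENNReal.tsum_prod, ← (Finset.HasAntidiagonal.sigmaAntidiagonalEquivProd).tsum_eq, ENNReal.tsum_sigma']
  refine tsum_congr fun n => ?_
  rw [tsum_fintype, Finset.univ_eq_attach, ← Finset.sum_attach]
  rfl

/-- Mark one of the `k + 1` final particles, which explains the factor on the left, and split it off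
from the rest. The marked particle contributes `singleLaw`, the rest `historyLaw` with `k`
particles, and their interaction is the tilt. -/
theorem lintegral_historyLaw_succ [MeasurableEq S] (hK : Measurable (Function.uncurry K))
    (hKsymm : ∀ p q, K p q = K q p) (N k : ℕ) {F : Measure (MeasurePath S T) → ℝ≥0∞}
    (hF : Measurable F) :
    ((k + 1 : ℕ) : ℝ≥0∞) * ∫⁻ Y, F Y ∂(historyLaw K Υ μ N T (k + 1)) =
      ∫⁻ ξ, ∫⁻ Y, tilt K F ξ Y ∂(historyLaw K Υ μ N T k) ∂(singleLaw K Υ μ N T) := by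
  have := sFinite_historyLaw (Υ := Υ) (μ := μ) (T := T) hK N k
  have hG : Measurable fun ξ => ∫⁻ Y, tilt K F ξ Y ∂(historyLaw K Υ μ N T k) :=
    (measurable_tilt hK hF).lintegral_prod_right'
  rw [lintegral_singleLaw N hG, lintegral_historyLaw N (k + 1) hF, ← ENNReal.tsum_mul_left]
  have e1 : ∀ n, ((k + 1 : ℕ) : ℝ≥0∞) * (poissonWeight N n * ∫⁻ w,
      (if (blocks (stateAt w T)).card = k + 1 then F (historyMeasure T (stateAt w)) else 0)
      ∂(initLaw (Fin n) K Υ μ)) = poissonWeight N n * ∑ A : Finset (Fin n),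
        splitIntegral K Υ μ k F A.card (n - A.card) := by
    intro n
    have hm : Measurable fun v : JumpRecord (Fin n) S =>
        (if (blocks (stateAt v T)).card = k + 1 then F (historyMeasure T (stateAt v)) else 0) :=
      Measurable.ite (measurableSet_card_blocks_stateAt (T : ℝ) (k + 1))
        (hF.comp (measurable_historyMeasure_stateAt T)) measurable_const
    rw [mul_left_comm, ← lintegral_const_mul _ hm]
    congr 1
    simp_rw [← lintegral_initLaw_split hK hKsymm k n hF]
    rw [← lintegral_finsetSum _ fun A _ =>
      Measurable.ite (measurableSet_mem_blocks_stateAt (T : ℝ) A) hm measurable_const]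
    refine lintegral_congr fun v => ?_
    -- Summing over all label sets `A` the indicator that `A` is a final particle counts the final
    -- particles.
    rw [Finset.sum_ite_mem, Finset.univ_inter, Finset.sum_const, nsmul_eq_mul]
    split_ifs with h
    · rw [h]
    · simp
  simp_rw [e1]
  rw [tsum_sum_choose]
  refine tsum_congr fun p => ?_
  congr 1
  simp_rw [splitIntegral]
  have hm : ∀ q, Measurable fun w : JumpRecord (Fin p) S =>
      (if Finset.univ ∈ blocks (stateAt w T) then
        ∫⁻ w', (if (blocks (stateAt w' T)).card = k then
        tilt K F (pathConfig T (stateAt w) Finset.univ) (historyMeasure T (stateAt w')) else 0)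
        ∂(initLaw (Fin q) K Υ μ) else 0) := by
    intro q
    have := isProbabilityMeasure_initLaw (ι := Fin q) (Υ := Υ) (μ := μ) hK
    refine Measurable.ite (measurableSet_mem_blocks_stateAt (T : ℝ) _) ?_ measurable_const
    refine Measurable.lintegral_prod_right' (f := fun z : JumpRecord (Fin p) S ×
      JumpRecord (Fin q) S => if (blocks (stateAt z.2 T)).card = k then
        tilt K F (pathConfig T (stateAt z.1) Finset.univ) (historyMeasure T (stateAt z.2)) else 0) ?_
    refine Measurable.ite ((measurableSet_card_blocks_stateAt (T : ℝ) k).preimage measurable_snd)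
      ?_ measurable_const
    exact Measurable.comp (g := fun p : MeasurePath S T × Measure (MeasurePath S T) =>
      tilt K F p.1 p.2) (f := fun z : JumpRecord (Fin p) S × JumpRecord (Fin q) S =>
        (pathConfig T (stateAt z.1) Finset.univ, historyMeasure T (stateAt z.2)))
      (measurable_tilt hK hF)
      (((measurable_pathConfig_stateAt T _).comp measurable_fst).prodMk
        ((measurable_historyMeasure_stateAt T).comp measurable_snd))
  simp_rw [← lintegral_const_mul _ (hm _)]
  rw [← lintegral_tsum fun q => ((hm q).const_mul _).aemeasurable]
  refine lintegral_congr fun w => ?_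
  split_ifs with h
  · rw [lintegral_historyLaw N k (measurable_tilt_right hK hF _)]
  · simp

/-- The sum of the interactions between the paths `η_i`, `i < k`. -/
def pairSum (K : Particle S → Particle S → ℝ≥0) {k : ℕ} (η : Fin k → MeasurePath S T) : ℝ≥0∞ :=
  ∑ i, ∑ j, if i < j then pathInteraction K (η i) (η j) else 0

theorem measurable_pairSum (hK : Measurable (Function.uncurry K)) (k : ℕ) :
    Measurable fun η : Fin k → MeasurePath S T => pairSum K η := by
  refine Finset.measurable_fun_sum _ fun i _ => Finset.measurable_fun_sum _ fun j _ => ?_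
  split_ifs
  · exact Measurable.comp (g := fun p : MeasurePath S T × MeasurePath S T =>
      pathInteraction K p.1 p.2) (f := fun η : Fin k → MeasurePath S T => (η i, η j))
      (measurable_pathInteraction hK) ((measurable_pi_apply i).prodMk (measurable_pi_apply j))
  · exact measurable_const

theorem pairSum_cons {k : ℕ} (ξ : MeasurePath S T) (η : Fin k → MeasurePath S T) :
    pairSum K (Fin.cons ξ η : Fin (k + 1) → MeasurePath S T) =
      (∑ i, pathInteraction K ξ (η i)) + pairSum K η := by
  unfold pairSum
  rw [Fin.sum_univ_succ]
  congr 1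
  · rw [Fin.sum_univ_succ]; simp
  · refine Finset.sum_congr rfl fun i _ => ?_
    rw [Fin.sum_univ_succ]
    simp

theorem measurable_sum_dirac {X : Type*} [MeasurableSpace X] (k : ℕ) :
    Measurable fun η : Fin k → X => ∑ i, Measure.dirac (η i) :=
  measurable_measure_sum _ fun i => Measure.measurable_dirac.comp (measurable_pi_apply i)

theorem historyMeasure_of_card_eq_zero {ι : Type*} [Fintype ι] [DecidableEq ι]
    {ω : ℝ → State ι S} (h : (blocks (ω T)).card = 0) : historyMeasure T ω = 0 := by
  rw [historyMeasure_eq_sum_blocks, Finset.card_eq_zero.1 h, Finset.sum_empty]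

/-- Absence of particles at time `T` means absence of atoms, since the blocks cover all labels; the
term `n = 0` has weight one. -/
theorem lintegral_historyLaw_zero [MeasurableEq S] (hK : Measurable (Function.uncurry K)) (N : ℕ)
    {F : Measure (MeasurePath S T) → ℝ≥0∞} (hF : Measurable F) :
    ∫⁻ Y, F Y ∂(historyLaw K Υ μ N T 0) = F 0 := by
  rw [lintegral_historyLaw N 0 hF, tsum_eq_single 0]
  · have := isProbabilityMeasure_initLaw (ι := Fin 0) (Υ := Υ) (μ := μ) hK
    have e : ∀ᵐ w ∂(initLaw (Fin 0) K Υ μ), (if (blocks (stateAt w T)).card = 0 then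
        F (historyMeasure T (stateAt w)) else 0) = F 0 := by
      filter_upwards [ae_initLaw_isRealisation hK] with w ⟨x, hw⟩
      have hp := hw.isPartitionState (isPartitionState_initState x) T
      have h : (blocks (stateAt w T)).card = 0 := by
        rw [Finset.card_eq_zero, Finset.eq_empty_iff_forall_notMem]
        intro C hC
        obtain ⟨i, -⟩ := hp.nonempty C hC
        exact i.elim0
      rw [if_pos h, historyMeasure_of_card_eq_zero h]
    rw [lintegral_congr_ae e, lintegral_const, measure_univ, mul_one, poissonWeight]
    simp
  · intro n hn
    have e : ∀ᵐ w ∂(initLaw (Fin n) K Υ μ), (if (blocks (stateAt w T)).card = 0 then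
        F (historyMeasure T (stateAt w)) else 0) = 0 := by
      filter_upwards [ae_initLaw_isRealisation hK] with w ⟨x, hw⟩
      have hp := hw.isPartitionState (isPartitionState_initState x) T
      refine if_neg fun h => ?_
      obtain ⟨C, hC, -⟩ := hp.cover ⟨0, Nat.pos_of_ne_zero hn⟩
      rw [Finset.card_eq_zero.1 h] at hC
      simp at hC
    rw [lintegral_congr_ae e, lintegral_zero, mul_zero]

theorem lintegral_pi_succ {X : Type*} [MeasurableSpace X] (m : Measure X) [IsFiniteMeasure m]
    (k : ℕ) {G : (Fin (k + 1) → X) → ℝ≥0∞} (hG : Measurable G) :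
    ∫⁻ η, G η ∂(Measure.pi fun _ : Fin (k + 1) => m) =
      ∫⁻ ξ, ∫⁻ η, G (Fin.cons ξ η) ∂(Measure.pi fun _ : Fin k => m) ∂m := by
  have h := (measurePreserving_piFinSuccAbove (fun _ : Fin (k + 1) => m) 0).symm
  have hG' := (hG.comp h.measurable).aemeasurable
    (μ := m.prod (Measure.pi fun _ : Fin k => m))
  simp only [Function.comp_def] at hG'
  rw [← h.lintegral_comp hG, lintegral_prod _ hG']
  refine lintegral_congr fun ξ => lintegral_congr fun η => ?_
  congr 1
  simp [MeasurableEquiv.piFinSuccAbove, Fin.insertNthEquiv]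

/-- Iterated splitting: the successive factors `k, k - 1, …` accumulate to `k!`, and the tilts
accumulate to the exponential of the sum over all pairs. -/
theorem lintegral_historyLaw_eq [MeasurableEq S] (hK : Measurable (Function.uncurry K))
    (hKsymm : ∀ p q, K p q = K q p) (N k : ℕ) {F : Measure (MeasurePath S T) → ℝ≥0∞}
    (hF : Measurable F) :
    (k.factorial : ℝ≥0∞) * ∫⁻ Y, F Y ∂(historyLaw K Υ μ N T k) =
      ∫⁻ η, expNeg (pairSum K η) * F (∑ i, Measure.dirac (η i))
        ∂(Measure.pi fun _ : Fin k => singleLaw K Υ μ N T) := by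
  have := isFiniteMeasure_singleLaw (Υ := Υ) (μ := μ) (T := T) hK N
  induction k generalizing F with
  | zero =>
    rw [lintegral_historyLaw_zero hK N hF]
    simp [pairSum, expNeg_zero]
  | succ k ih =>
    have hm : ∀ k, Measurable fun η : Fin k → MeasurePath S T =>
        expNeg (pairSum K η) * F (∑ i, Measure.dirac (η i)) := fun k =>
      (measurable_expNeg.comp (measurable_pairSum hK k)).mul (hF.comp (measurable_sum_dirac k))
    have := sFinite_historyLaw (Υ := Υ) (μ := μ) (T := T) hK N k
    have hG : Measurable fun ξ => ∫⁻ Y, tilt K F ξ Y ∂(historyLaw K Υ μ N T k) :=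
      (measurable_tilt hK hF).lintegral_prod_right'
    rw [Nat.factorial_succ, Nat.cast_mul, mul_comm ((k + 1 : ℕ) : ℝ≥0∞), mul_assoc,
      lintegral_historyLaw_succ hK hKsymm N k hF, ← lintegral_const_mul _ hG,
      lintegral_pi_succ _ _ (hm (k + 1))]
    refine lintegral_congr fun ξ => ?_
    -- The induction hypothesis is applied to the tilted functional, which is why `F` is
    -- generalised.
    rw [ih (measurable_tilt_right hK hF ξ)]
    refine lintegral_congr fun η => ?_
    rw [tilt, finiteKernel_apply, lintegral_finsetSum_measure]
    simp_rw [lintegral_dirac' _ (measurable_pathInteraction_right hK ξ)]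
    rw [pairSum_cons, expNeg_add, Fin.sum_univ_succ]
    simp only [Fin.cons_zero, Fin.cons_succ]
    ring

end HistoryLaw

/-! ### The histories of particles are coagulation trajectories -/

section Steps

/-- A path that on `[0,T]` moves by finitely many steps and is constant in between. -/
def HasSteps {E : Type*} (step : E → E → Prop) (T : ℝ) (ζ : ℝ → E) : Prop :=
  ∃ (r : ℕ) (s : Fin (r + 1) → ℝ), StrictMono s ∧ s 0 = 0 ∧ (∀ i, s i ≤ T) ∧
    (∀ i t, s i ≤ t → t ≤ T → (∀ j, i < j → t < s j) → ζ t = ζ (s i)) ∧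
    ∀ i : Fin r, step (ζ (s i.castSucc)) (ζ (s i.succ))

theorem hasSteps_of_const {E : Type*} {step : E → E → Prop} {T : ℝ} (hT : 0 ≤ T) {ζ : ℝ → E} {a : E}
    (h : ∀ t ∈ Set.Icc 0 T, ζ t = a) : HasSteps step T ζ := by
  refine ⟨0, fun _ => 0, fun i j h => absurd h (by omega), rfl, fun _ => hT, fun i t h0 hT' _ => ?_,
    fun i => i.elim0⟩
  rw [h t ⟨h0, hT'⟩, h 0 ⟨le_rfl, hT⟩]

/-- A jump of the whole process may be invisible for the subprocess of the labels in a given set,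
hence the alternative `a = ζ' 0`. -/
theorem HasSteps.prepend {E : Type*} {step : E → E → Prop} {T s₀ : ℝ} (hs : 0 < s₀) {a : E}
    {ζ ζ' : ℝ → E} (h1 : ∀ t, 0 ≤ t → t < s₀ → ζ t = a) (h2 : ∀ t, s₀ ≤ t → ζ t = ζ' (t - s₀))
    (hstep : step a (ζ' 0) ∨ a = ζ' 0) (h : HasSteps step (T - s₀) ζ') : HasSteps step T ζ := by
  obtain ⟨r, s, hmono, h0, hle, hconst, hst⟩ := h
  have hpos : ∀ i, 0 ≤ s i := fun i => by
    rw [← h0]; exact hmono.monotone (Fin.zero_le i)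
  have hshift : ∀ x, 0 ≤ x → ζ (x + s₀) = ζ' x := fun x hx => by
    rw [h2 _ (by linarith), add_sub_cancel_right]
  have hζ0 : ζ 0 = a := h1 0 le_rfl hs
  rcases hstep with hstep | hstep
  · refine ⟨r + 1, Fin.cons 0 fun i => s i + s₀, ?_, rfl, ?_, ?_, ?_⟩
    · rw [Fin.strictMono_iff_lt_succ]
      intro i
      refine Fin.cases ?_ (fun i => ?_) i
      · simp only [Fin.castSucc_zero, Fin.cons_zero, Fin.cons_succ]
        linarith [hpos 0]
      · simp only [← Fin.succ_castSucc, Fin.cons_succ]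
        linarith [hmono (Fin.castSucc_lt_succ (i := i))]
    · intro i
      refine Fin.cases ?_ (fun i => ?_) i
      · simp only [Fin.cons_zero]
        linarith [hle 0, hpos 0]
      · simp only [Fin.cons_succ]
        linarith [hle i]
    · intro i t
      refine Fin.cases ?_ (fun i => ?_) i
      · simp only [Fin.cons_zero]
        intro ht htT hlt
        have := hlt (Fin.succ 0) (Fin.succ_pos 0)
        simp only [Fin.cons_succ, h0, zero_add] at this
        rw [h1 t ht this, hζ0]
      · simp only [Fin.cons_succ]
        intro ht htT hlt
        have hp := hpos i
        rw [h2 t (by linarith), hshift _ (hpos i)]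
        refine hconst i _ (by linarith) (by linarith) fun j hj => ?_
        have := hlt j.succ (Fin.succ_lt_succ_iff.2 hj)
        simp only [Fin.cons_succ] at this
        linarith
    · intro i
      refine Fin.cases ?_ (fun i => ?_) i
      · simp only [Fin.castSucc_zero, Fin.cons_zero, Fin.cons_succ]
        rw [hζ0, hshift _ (hpos 0), h0]
        exact hstep
      · simp only [← Fin.succ_castSucc, Fin.cons_succ]
        rw [hshift _ (hpos _), hshift _ (hpos _)]
        exact hst i
  -- The jump is invisible: the constant piece merges with the first interval of `ζ'`, so no time is
  -- added, time zero stays, and only the later times are shifted.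
  · have hs' : ∀ i, ζ (if i = 0 then 0 else s i + s₀) = ζ' (s i) := fun i => by
      split_ifs with hi
      · rw [hζ0, hi, h0, hstep]
      · exact hshift _ (hpos i)
    refine ⟨r, fun i => if i = 0 then 0 else s i + s₀, ?_, if_pos rfl, ?_, ?_, ?_⟩
    · intro i j hij
      have hj : j ≠ 0 := (lt_of_le_of_lt (Fin.zero_le i) hij).ne'
      simp only [if_neg hj]
      split_ifs
      · linarith [hpos j]
      · linarith [hmono hij]
    · intro i
      dsimp only
      split_ifs
      · linarith [hle 0, hpos 0]
      · linarith [hle i]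
    · intro i t ht htT hlt
      rw [hs']
      by_cases hts : t < s₀
      · have hi : i = 0 := by
          by_contra hi
          simp only [if_neg hi] at ht
          linarith [hpos i]
        subst hi
        simp only [if_pos] at ht
        rw [h1 t ht hts, h0, hstep]
      · rw [h2 t (not_lt.1 hts)]
        refine hconst i _ ?_ (by linarith) fun j hj => ?_
        · by_cases hi : i = 0
          · rw [hi, h0]; linarith
          · simp only [if_neg hi] at ht; linarith
        · have hj0 : j ≠ 0 := (lt_of_le_of_lt (Fin.zero_le i) hj).ne'
          have := hlt j hj
          simp only [if_neg hj0] at this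
          linarith
    · intro i
      dsimp only
      rw [hs', hs']
      exact hst i

end Steps

/-! ### Configurations of subfamilies move by coagulation steps. -/

section Trajectory

variable {ι S : Type*} [Fintype ι] [DecidableEq ι] [MeasurableSpace S] {T : ℝ≥0}

theorem mass_union {C D : Finset ι} (hC : C.Nonempty) (hD : D.Nonempty) (h : Disjoint C D) :
    mass (C ∪ D) = mass C + mass D := by
  refine PNat.eq ?_
  have h1 := Finset.card_pos.2 hC
  have h2 := Finset.card_pos.2 hD
  rw [PNat.add_coe, mass, mass, mass, Finset.card_union_of_disjoint h,
    Nat.toPNat'_coe, Nat.toPNat'_coe, Nat.toPNat'_coe, if_pos h1, if_pos h2, if_pos (by omega)]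

/-- Compared label set by label set: only `C`, `D` and `C ∪ D` change, and these are distinct
because the blocks are nonempty and disjoint. The additive form, without subtraction of measures, is
that of `IsStep`. -/
theorem subConfig_merge {z : State ι S} (hz : IsPartitionState z) {C D : Finset ι}
    (hC : C ∈ blocks z) (hD : D ∈ blocks z) (hCD : C ≠ D) (u : S) (A : Finset ι) :
    subConfig (merge z C D u) A + (if C ⊆ A then particleMeasure z C else 0) +
        (if D ⊆ A then particleMeasure z D else 0) =
      subConfig z A + if C ∪ D ⊆ A then Measure.dirac (u, mass (C ∪ D)) else 0 := by
  have hdis := hz.disjoint C hC D hD hCD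
  have hCn := hz.nonempty C hC
  have hDn := hz.nonempty D hD
  have hUC : C ∪ D ≠ C := fun h => by
    obtain ⟨i, hi⟩ := hDn
    exact Finset.disjoint_right.1 hdis hi (h ▸ Finset.mem_union_right C hi)
  have hUD : C ∪ D ≠ D := fun h => by
    obtain ⟨i, hi⟩ := hCn
    exact Finset.disjoint_left.1 hdis hi (h ▸ Finset.mem_union_left D hi)
  have hU : C ∪ D ∉ blocks z := fun h => by
    obtain ⟨i, hi⟩ := hCn
    exact Finset.disjoint_left.1 (hz.disjoint _ h C hC hUC) (Finset.mem_union_left D hi) hi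
  have e1 : (if C ⊆ A then particleMeasure z C else 0) =
      ∑ E, if E = C then (if C ⊆ A then particleMeasure z C else 0) else 0 := by simp
  have e2 : (if D ⊆ A then particleMeasure z D else 0) =
      ∑ E, if E = D then (if D ⊆ A then particleMeasure z D else 0) else 0 := by simp
  have e3 : (if C ∪ D ⊆ A then Measure.dirac (u, mass (C ∪ D)) else 0) =
      ∑ E, if E = C ∪ D then (if C ∪ D ⊆ A then Measure.dirac (u, mass (C ∪ D)) else 0) else 0 := by
    simp
  rw [subConfig_eq, subConfig_eq, e1, e2, e3, ← Finset.sum_add_distrib, ← Finset.sum_add_distrib,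
    ← Finset.sum_add_distrib]
  refine Finset.sum_congr rfl fun E _ => ?_
  by_cases hE : E = C ∪ D
  · subst hE
    rw [if_neg hUC, if_neg hUD, if_pos rfl, particleMeasure_of_notMem hU]
    simp [particleMeasure, merge]
  by_cases hE1 : E = C
  · subst hE1
    rw [if_neg hCD, if_neg hE, particleMeasure_of_inr (z := merge z E D u) (by simp [merge, hE])]
    simp
  by_cases hE2 : E = D
  · subst hE2
    rw [if_neg hE, particleMeasure_of_inr (z := merge z C E u) (by simp [merge, hE])]
    simp [hE1]
  · have : particleMeasure (merge z C D u) E = particleMeasure z E := by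
      simp [particleMeasure, merge, hE, hE1, hE2]
    simp [hE, hE1, hE2, this]

theorem particleMeasure_of_mem_blocks {z : State ι S} {C : Finset ι} (h : C ∈ blocks z) :
    ∃ x, particleMeasure z C = Measure.dirac (x, mass C) := by
  rw [mem_blocks] at h
  obtain ⟨x, hx⟩ := Sum.isLeft_iff.1 h
  exact ⟨x, by simp [particleMeasure, hx]⟩

theorem isStep_or_eq_subConfig_merge {z : State ι S} (hz : IsPartitionState z) {C D : Finset ι}
    (hC : C ∈ blocks z) (hD : D ∈ blocks z) (hCD : C ≠ D) (u : S) {A : Finset ι}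
    (hA : C ∪ D ⊆ A ∨ Disjoint (C ∪ D) A) :
    IsStep (subConfig z A) (subConfig (merge z C D u) A) ∨
      subConfig z A = subConfig (merge z C D u) A := by
  have h := subConfig_merge hz hC hD hCD u A
  have hCn := hz.nonempty C hC
  have hDn := hz.nonempty D hD
  rcases hA with hA | hA
  · left
    rw [if_pos hA, if_pos (Finset.subset_union_left.trans hA),
      if_pos (Finset.subset_union_right.trans hA)] at h
    obtain ⟨x, hx⟩ := particleMeasure_of_mem_blocks hC
    obtain ⟨y, hy⟩ := particleMeasure_of_mem_blocks hD
    refine ⟨x, y, u, mass C, mass D, ?_⟩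
    rw [← mass_union hCn hDn (hz.disjoint C hC D hD hCD), ← h, hx, hy]
  · right
    have n1 : ∀ {E : Finset ι}, E.Nonempty → E ⊆ C ∪ D → ¬ E ⊆ A := fun ⟨i, hi⟩ hE h =>
      Finset.disjoint_left.1 hA (hE hi) (h hi)
    rw [if_neg (n1 hCn Finset.subset_union_left), if_neg (n1 hDn Finset.subset_union_right),
      if_neg (n1 (hCn.mono Finset.subset_union_left) subset_rfl)] at h
    simpa using h.symm

theorem IsRealisation.stateAt_zero {z : State ι S} {w : JumpRecord ι S} (h : IsRealisation z w) :
    stateAt w 0 = z := by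
  cases h with
  | stay z w h => exact stateAt_of_top h 0
  | jump z C D u s v hs hC hD hCD hv => exact stateAt_consSeq_of_lt hs hs z v

/-- Since every particle up to time `T` is inside `A` or disjoint from it, a coagulation either
takes place inside `A`, and is a step, or does not touch `A`. -/
theorem IsRealisation.hasSteps {z : State ι S} {w : JumpRecord ι S} (h : IsRealisation z w)
    (hz : IsPartitionState z) {T : ℝ} (hT : 0 ≤ T) {A : Finset ι}
    (hA : ∀ t ∈ Set.Icc 0 T, ∀ E ∈ blocks (stateAt w t), E ⊆ A ∨ Disjoint E A) :
    HasSteps IsStep T fun t => subConfig (stateAt w t) A := by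
  induction h generalizing T with
  | stay z w h => exact hasSteps_of_const hT (a := subConfig z A) fun t _ => by rw [stateAt_of_top h]
  | jump z C D u s v hs hC hD hCD hv ih =>
    have e1 : ∀ t, t < s → stateAt (consSeq (ENNReal.ofReal s, z) v) t = z := fun t ht =>
      stateAt_consSeq_of_lt hs ht z v
    have e2 : ∀ t, s ≤ t → stateAt (consSeq (ENNReal.ofReal s, z) v) t = stateAt v (t - s) :=
      fun t ht => stateAt_consSeq_of_ge hs.le ht z hv.exists_top
    by_cases hsT : s ≤ T
    · refine HasSteps.prepend hs (a := subConfig z A) (ζ' := fun t => subConfig (stateAt v t) A)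
        (fun t _ ht => by rw [e1 t ht]) (fun t ht => by rw [e2 t ht]) ?_ ?_
      · rw [hv.stateAt_zero]
        refine isStep_or_eq_subConfig_merge hz hC hD hCD u (hA s ⟨hs.le, hsT⟩ _ ?_)
        rw [e2 s le_rfl, sub_self, hv.stateAt_zero]
        exact mem_blocks_merge.2 (Or.inl rfl)
      · refine ih (hz.merge hC hD u) (by linarith) fun t ht E hE => ?_
        refine hA (t + s) ⟨by linarith [ht.1], by linarith [ht.2]⟩ E ?_
        rw [e2 _ (by linarith [ht.1]), add_sub_cancel_right]
        exact hE
    · exact hasSteps_of_const hT (a := subConfig z A) fun t ht => by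
        rw [e1 t (by linarith [ht.2])]

theorem HasSteps.exists_timeInt {E : Type*} {step : E → E → Prop} {ζ : ℝ → E}
    (h : HasSteps step (T : ℝ) ζ) :
    ∃ (r : ℕ) (s : Fin (r + 1) → TimeInt T), StrictMono s ∧ s 0 = time0 T ∧
      (∀ i (t : TimeInt T), s i ≤ t → (∀ j, i < j → t < s j) → ζ t = ζ (s i)) ∧
      ∀ i : Fin r, step (ζ (s i.castSucc)) (ζ (s i.succ)) := by
  obtain ⟨r, s, hmono, h0, hle, hconst, hst⟩ := h
  have hpos : ∀ i, 0 ≤ s i := fun i => by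
    rw [← h0]; exact hmono.monotone (Fin.zero_le i)
  refine ⟨r, fun i => ⟨s i, hpos i, hle i⟩, fun i j hij => hmono hij, Subtype.ext h0, ?_, hst⟩
  exact fun i t h1 h2 => hconst i t h1 t.2.2 fun j hj => h2 j hj

theorem exists_nat_particleMeasure (z : State ι S) (D : Finset ι) {B : Set (Particle S)}
    (hB : MeasurableSet B) : ∃ n : ℕ, particleMeasure z D B = n := by
  classical
  unfold particleMeasure
  split
  · rw [Measure.dirac_apply' _ hB, Set.indicator_apply]
    split_ifs
    · exact ⟨1, by simp⟩
    · exact ⟨0, by simp⟩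
  · exact ⟨0, by simp⟩

theorem exists_nat_subConfig (z : State ι S) (A : Finset ι) {B : Set (Particle S)}
    (hB : MeasurableSet B) : ∃ n : ℕ, subConfig z A B = n := by
  choose f hf using fun D => exists_nat_particleMeasure z D hB
  refine ⟨∑ D, if D ⊆ A then f D else 0, ?_⟩
  rw [subConfig_eq, Measure.finsetSum_apply, Nat.cast_sum]
  refine Finset.sum_congr rfl fun D _ => ?_
  split_ifs
  · exact hf D
  · simp

theorem subConfig_univ_mass (z : State ι S) (A : Finset ι) :
    subConfig z A Set.univ = ((blocks z).filter (· ⊆ A)).card := by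
  rw [subConfig_eq, Measure.finsetSum_apply, Finset.card_filter, Nat.cast_sum, ← Finset.sum_filter_add_sum_filter_not Finset.univ (· ∈ blocks z)]
  have e : Finset.univ.filter (· ∈ blocks z) = blocks z := by ext; simp
  rw [e, Finset.sum_eq_zero (s := Finset.univ.filter fun D => D ∉ blocks z), add_zero]
  · refine Finset.sum_congr rfl fun D hD => ?_
    obtain ⟨x, hx⟩ := particleMeasure_of_mem_blocks hD
    split_ifs
    · rw [hx]; simp
    · simp
  · intro D hD
    rw [particleMeasure_of_notMem (Finset.mem_filter.1 hD).2]
    simp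

theorem subConfig_initState_ne_one (x : ι → S) (A : Finset ι) :
    subConfig (initState x) A {p | p.2 ≠ 1} = 0 := by
  have hm : MeasurableSet {p : Particle S | p.2 ≠ 1} :=
    (measurable_snd (measurableSet_singleton (1 : ℕ+))).compl
  rw [subConfig_eq, Measure.finsetSum_apply]
  refine Finset.sum_eq_zero fun D _ => ?_
  by_cases hD : ∃ i, D = {i}
  · obtain ⟨i, rfl⟩ := hD
    have : particleMeasure (initState x) {i} = Measure.dirac (x i, 1) := by
      simp [particleMeasure, initState_singleton, mass]
      rfl
    rw [this]
    split_ifs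
    · rw [Measure.dirac_apply' _ hm]; simp
    · simp
  · rw [particleMeasure_of_notMem fun h => hD (mem_blocks_initState.1 h)]
    simp

theorem IsRealisation.isTrajectory {x : ι → S} {w : JumpRecord ι S}
    (h : IsRealisation (initState x) w) {A : Finset ι}
    (hA : ∀ t ∈ Set.Icc (0 : ℝ) T, ∀ E ∈ blocks (stateAt w t), E ⊆ A ∨ Disjoint E A) :
    IsTrajectory T (pathConfig T (stateAt w) A) := by
  refine ⟨fun t B hB => exists_nat_subConfig _ _ hB, ?_, ?_⟩
  · have : pathConfig T (stateAt w) A (time0 T) = subConfig (initState x) A := by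
      rw [← h.stateAt_zero]; rfl
    rw [this]
    exact subConfig_initState_ne_one x A
  · exact (h.hasSteps (isPartitionState_initState x) T.coe_nonneg hA).exists_timeInt

/-- An earlier particle is contained in a final one, which is either `C` or disjoint from `C`. At
time `T` the only particle inside `C` is `C` itself. -/
theorem IsRealisation.isTrajectory_of_mem_blocks {x : ι → S} {w : JumpRecord ι S}
    (h : IsRealisation (initState x) w) {C : Finset ι} (hC : C ∈ blocks (stateAt w T)) :
    IsTrajectory T (pathConfig T (stateAt w) C) ∧
      pathConfig T (stateAt w) C (timeT T) Set.univ = 1 := by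
  have hp := h.isPartitionState (isPartitionState_initState x)
  constructor
  · refine h.isTrajectory fun t ht E hE => ?_
    obtain ⟨E', hE', hs⟩ := h.exists_superset_of_le ht.2 hE
    by_cases he : E' = C
    · exact Or.inl (he ▸ hs)
    · exact Or.inr (((hp T).disjoint E' hE' C hC he).mono_left hs)
  · have : pathConfig T (stateAt w) C (timeT T) = subConfig (stateAt w T) C := rfl
    rw [this, subConfig_univ_mass]
    have : (blocks (stateAt w T)).filter (· ⊆ C) = {C} := by
      ext E
      simp only [Finset.mem_filter, Finset.mem_singleton]
      constructor
      · rintro ⟨hE, hs⟩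
        by_contra hne
        obtain ⟨i, hi⟩ := (hp T).nonempty E hE
        exact Finset.disjoint_left.1 ((hp T).disjoint E hE C hC hne) hi (hs hi)
      · rintro rfl; exact ⟨hC, subset_rfl⟩
    rw [this]; simp

theorem IsRealisation.univ_mem_blocks {x : ι → S} {w : JumpRecord ι S}
    (h : IsRealisation (initState x) w)
    (h1 : pathConfig T (stateAt w) Finset.univ (timeT T) Set.univ = 1) :
    Finset.univ ∈ blocks (stateAt w T) := by
  have hp := h.isPartitionState (isPartitionState_initState x) T
  have e : pathConfig T (stateAt w) Finset.univ (timeT T) = subConfig (stateAt w T) Finset.univ := rfl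
  rw [e, subConfig_univ_mass] at h1
  have h2 : (blocks (stateAt w T)).card = 1 := by
    have : (blocks (stateAt w T)).filter (· ⊆ Finset.univ) = blocks (stateAt w T) := by simp
    rw [this] at h1
    exact_mod_cast h1
  obtain ⟨C, hC⟩ := Finset.card_eq_one.1 h2
  have : C = Finset.univ := by
    refine Finset.eq_univ_of_forall fun i => ?_
    obtain ⟨D, hD, hi⟩ := hp.cover i
    rw [hC, Finset.mem_singleton] at hD
    exact hD ▸ hi
  rw [hC, this]; simp

theorem IsRealisation.pathConfig_zero_univ {x : ι → S} {w : JumpRecord ι S}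
    (h : IsRealisation (initState x) w) :
    pathConfig T (stateAt w) Finset.univ (time0 T) Set.univ = Fintype.card ι := by
  have e : pathConfig T (stateAt w) Finset.univ (time0 T) = subConfig (initState x) Finset.univ := by
    rw [← h.stateAt_zero]; rfl
  rw [e, subConfig_univ_mass, ← card_blocks_initState x]
  simp

end Trajectory

/-! ### Finiteness and symmetry of the interaction -/

section FiniteInteraction

variable {S : Type*} [MeasurableSpace S] {K : Particle S → Particle S → ℝ≥0} {T : ℝ≥0}

theorem IsTrajectory.isFiniteMeasure {ξ : MeasurePath S T} (h : IsTrajectory T ξ) (t : TimeInt T) :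
    IsFiniteMeasure (ξ t) := by
  obtain ⟨n, hn⟩ := h.1 t Set.univ MeasurableSet.univ
  exact ⟨by rw [hn]; simp⟩

theorem IsTrajectory.isRightStepOn {ξ : MeasurePath S T} (h : IsTrajectory T ξ) :
    IsRightStepOn ξ := by
  obtain ⟨-, -, r, s, hmono, h0, hconst, -⟩ := h
  -- The largest index whose jump time does not exceed `t`.
  have hex : ∀ t : TimeInt T, ∃ i, s i ≤ t ∧ ∀ j, i < j → t < s j := by
    intro t
    have hne : (Finset.univ.filter fun i => s i ≤ t).Nonempty :=
      ⟨0, by simpa [h0] using (show time0 T ≤ t from t.2.1)⟩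
    obtain ⟨i, hi, hmax⟩ := Finset.exists_max_image _ id hne
    refine ⟨i, (Finset.mem_filter.1 hi).2, fun j hj => ?_⟩
    by_contra hle
    exact absurd (hmax j (Finset.mem_filter.2 ⟨Finset.mem_univ j, not_lt.1 hle⟩)) (not_le.2 hj)
  constructor
  · refine (Set.finite_range fun i => ξ (s i)).subset ?_
    rintro _ ⟨t, rfl⟩
    obtain ⟨i, h1, h2⟩ := hex t
    exact ⟨i, (hconst i t h1 h2).symm⟩
  · intro t ht
    obtain ⟨i, h1, h2⟩ := hex t
    have hev : ∀ᶠ ε in nhdsWithin (0 : ℝ) (Set.Ioi 0), ∀ j, i < j → (t : ℝ) + ε < s j := by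
      rw [Filter.eventually_all]
      intro j
      by_cases hj : i < j
      · have hlt : (t : ℝ) < s j := h2 j hj
        have : ∀ᶠ ε in nhdsWithin (0 : ℝ) (Set.Ioi 0), ε < (s j : ℝ) - t :=
          nhdsWithin_le_nhds (eventually_lt_nhds (sub_pos.2 hlt))
        filter_upwards [this] with ε hε _
        linarith
      · exact Filter.Eventually.of_forall fun _ h => absurd h hj
    obtain ⟨ε, hε, hpos⟩ := (hev.and self_mem_nhdsWithin).exists
    refine ⟨ε, hpos, fun t' h3 h4 => ?_⟩
    rw [hconst i t' (h1.trans h3) fun j hj => h4.trans (hε j hj), hconst i t h1 h2]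

/-- The numbers `φ {g > n}` decrease to zero and are integers, so they vanish eventually and `g` is
almost everywhere bounded. This replaces a representation of the values of a trajectory as sums of
Dirac measures. -/
theorem lintegral_ne_top_of_nat_valued {X : Type*} [MeasurableSpace X] {φ : Measure X}
    (h : ∀ B, MeasurableSet B → ∃ n : ℕ, φ B = n) {g : X → ℝ≥0∞} (hg : Measurable g)
    (hfin : ∀ x, g x ≠ ∞) : ∫⁻ x, g x ∂φ ≠ ∞ := by
  have : IsFiniteMeasure φ := by
    obtain ⟨n, hn⟩ := h Set.univ MeasurableSet.univ
    exact ⟨by rw [hn]; simp⟩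
  have hm : ∀ n : ℕ, MeasurableSet {x | (n : ℝ≥0∞) < g x} := fun n =>
    measurableSet_lt measurable_const hg
  have hlim := tendsto_measure_iInter_atTop (μ := φ) (fun n => (hm n).nullMeasurableSet)
    (fun i j hij x (hx : (j : ℝ≥0∞) < g x) => lt_of_le_of_lt (by exact_mod_cast hij) hx)
    ⟨0, measure_ne_top _ _⟩
  have hempty : ⋂ n : ℕ, {x | (n : ℝ≥0∞) < g x} = ∅ := by
    refine Set.eq_empty_of_forall_notMem fun x hx => ?_
    obtain ⟨n, hn⟩ := ENNReal.exists_nat_gt (hfin x)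
    exact lt_asymm hn (Set.mem_iInter.1 hx n)
  rw [hempty, measure_empty] at hlim
  obtain ⟨n, hn⟩ := (hlim.eventually_lt_const one_pos).exists
  have h0 : φ {x | (n : ℝ≥0∞) < g x} = 0 := by
    obtain ⟨k, hk⟩ := h _ (hm n)
    rw [Function.comp_apply, hk] at hn
    rw [hk]
    have : k < 1 := by exact_mod_cast hn
    simp [Nat.lt_one_iff.1 this]
  have hle : ∀ᵐ x ∂φ, g x ≤ n := by
    rw [ae_iff]
    simpa only [not_le] using h0
  refine ne_top_of_le_ne_top ?_ (lintegral_mono_ae hle)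
  rw [lintegral_const]
  exact ENNReal.mul_ne_top (by simp) (measure_ne_top _ _)

theorem measurable_lintegral_kernel_left (hK : Measurable (Function.uncurry K))
    (ψ : Measure (Particle S)) [IsFiniteMeasure ψ] :
    Measurable fun p => ∫⁻ q, (K p q : ℝ≥0∞) ∂ψ :=
  Measurable.lintegral_prod_right' (f := fun p : Particle S × Particle S => (K p.1 p.2 : ℝ≥0∞))
    hK.coe_nnreal_ennreal

theorem pairing_ne_top_of_nat_valued (hK : Measurable (Function.uncurry K))
    {φ ψ : Measure (Particle S)} (h : ∀ B, MeasurableSet B → ∃ n : ℕ, φ B = n)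
    (h' : ∀ B, MeasurableSet B → ∃ n : ℕ, ψ B = n) : pairing K φ ψ ≠ ∞ := by
  have : IsFiniteMeasure ψ := by
    obtain ⟨n, hn⟩ := h' Set.univ MeasurableSet.univ
    exact ⟨by rw [hn]; simp⟩
  refine lintegral_ne_top_of_nat_valued h (measurable_lintegral_kernel_left hK ψ) fun p => ?_
  exact lintegral_ne_top_of_nat_valued h' (hK.comp measurable_prodMk_left).coe_nnreal_ennreal
    fun q => ENNReal.coe_ne_top

theorem pathInteraction_traj (hK : Measurable (Function.uncurry K)) (ξ ξ' : Traj1 S T) :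
    pathInteraction K ξ.1 ξ'.1 = ∫⁻ t, pairing K (ξ.1 t) (ξ'.1 t) ∂(timeMeasure T) :=
  pathInteraction_eq ξ.2.1.isRightStepOn ξ'.2.1.isRightStepOn ξ.2.1.isFiniteMeasure
    ξ'.2.1.isFiniteMeasure fun t => pairing_ne_top_of_nat_valued hK (ξ.2.1.1 t) (ξ'.2.1.1 t)

theorem pathInteraction_traj_ne_top (hK : Measurable (Function.uncurry K)) (ξ ξ' : Traj1 S T) :
    pathInteraction K ξ.1 ξ'.1 ≠ ∞ := by
  rw [pathInteraction_traj hK]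
  have hs : IsRightStepOn fun t => pairing K (ξ.1 t) (ξ'.1 t) :=
    (ξ.2.1.isRightStepOn.prodMk ξ'.2.1.isRightStepOn).comp fun p => pairing K p.1 p.2
  obtain ⟨c, hc, hb⟩ := hs.exists_bound fun t =>
    pairing_ne_top_of_nat_valued hK (ξ.2.1.1 t) (ξ'.2.1.1 t)
  refine ne_top_of_le_ne_top ?_ (lintegral_mono hb)
  rw [lintegral_const]
  exact ENNReal.mul_ne_top hc (measure_ne_top _ _)

theorem interaction_eq (hK : Measurable (Function.uncurry K)) (ξ ξ' : Traj1 S T) :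
    interaction K ξ ξ' = (pathInteraction K ξ.1 ξ'.1).toReal := by
  rw [pathInteraction_traj hK]
  rfl

theorem pairing_comm (hK : Measurable (Function.uncurry K)) (hKsymm : ∀ p q, K p q = K q p)
    (φ ψ : Measure (Particle S)) [IsFiniteMeasure φ] [IsFiniteMeasure ψ] :
    pairing K φ ψ = pairing K ψ φ := by
  unfold pairing
  rw [lintegral_lintegral_swap (f := fun p q => (K p q : ℝ≥0∞))
    (by exact hK.coe_nnreal_ennreal.aemeasurable)]
  simp_rw [fun p q => hKsymm p q]

theorem pathInteraction_comm (hK : Measurable (Function.uncurry K))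
    (hKsymm : ∀ p q, K p q = K q p) (ξ ξ' : Traj1 S T) :
    pathInteraction K ξ.1 ξ'.1 = pathInteraction K ξ'.1 ξ.1 := by
  rw [pathInteraction_traj hK, pathInteraction_traj hK]
  refine lintegral_congr fun t => ?_
  have := ξ.2.1.isFiniteMeasure t
  have := ξ'.2.1.isFiniteMeasure t
  exact pairing_comm hK hKsymm _ _

end FiniteInteraction

/-! ### Measures on the space of one-particle trajectories -/

section TrajectoryMeasures

variable {ι S : Type*} [Fintype ι] [DecidableEq ι] [MeasurableSpace S] {T : ℝ≥0}
variable {K : Particle S → Particle S → ℝ≥0} {Υ : Kernel (Particle S × Particle S) S}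
  {μ : Measure S}

theorem diracTraj1_of_pos {ξ : MeasurePath S T}
    (h : IsTrajectory T ξ ∧ ξ (timeT T) Set.univ = 1) :
    diracTraj1 T ξ = Measure.dirac ⟨ξ, h⟩ := dif_pos h

theorem diracTraj1_of_neg {ξ : MeasurePath S T}
    (h : ¬ (IsTrajectory T ξ ∧ ξ (timeT T) Set.univ = 1)) : diracTraj1 T ξ = 0 := dif_neg h

open Classical in
/-- The Dirac measure at the history of `C`, if `C` is a particle at time `T`, for the
realisations that start from singletons. -/
def blockDirac (T : ℝ≥0) (C : Finset ι) (w : JumpRecord ι S) : Measure (Traj1 S T) :=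
  if w ∈ goodRecords ι S ∧ C ∈ blocks (stateAt w T) then
    diracTraj1 T (pathConfig T (stateAt w) C) else 0

/-- On good records the history of a final particle is a trajectory automatically, so the test
inside `diracTraj1` succeeds, and measurability of the set of trajectories plays no role. -/
theorem measurable_blockDirac [MeasurableEq S] (T : ℝ≥0) (C : Finset ι) :
    Measurable (blockDirac T C : JumpRecord ι S → Measure (Traj1 S T)) := by
  classical
  refine Measure.measurable_of_measurable_coe _ fun s hs => ?_
  obtain ⟨s', hs', rfl⟩ := hs
  have e : (fun w : JumpRecord ι S => blockDirac T C w (Subtype.val ⁻¹' s')) =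
      fun w => if w ∈ goodRecords ι S then if C ∈ blocks (stateAt w T) then
        s'.indicator 1 (pathConfig T (stateAt w) C) else 0 else 0 := by
    funext w
    unfold blockDirac
    by_cases h1 : w ∈ goodRecords ι S
    · by_cases h2 : C ∈ blocks (stateAt w T)
      · obtain ⟨x, hx⟩ := exists_isRealisation_of_mem_goodRecords h1
        rw [if_pos ⟨h1, h2⟩, if_pos h1, if_pos h2,
          diracTraj1_of_pos (hx.isTrajectory_of_mem_blocks h2),
          Measure.dirac_apply' _ (measurable_subtype_coe hs')]
        rfl
      · rw [if_neg fun h => h2 h.2, if_pos h1, if_neg h2]; rfl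
    · rw [if_neg fun h => h1 h.1, if_neg h1]; rfl
  rw [e]
  exact Measurable.ite measurableSet_goodRecords
    (Measurable.ite (measurableSet_mem_blocks_stateAt (T : ℝ) C)
    ((measurable_const.indicator hs').comp (measurable_pathConfig_stateAt T C)) measurable_const)
    measurable_const

theorem diracTraj1_wholeConfig {w : JumpRecord ι S} (h : w ∈ goodRecords ι S) :
    diracTraj1 T (wholeConfig T w) = blockDirac T Finset.univ w := by
  unfold blockDirac
  obtain ⟨x, hx⟩ := exists_isRealisation_of_mem_goodRecords h
  by_cases h2 : Finset.univ ∈ blocks (stateAt w T)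
  · rw [if_pos ⟨h, h2⟩]; rfl
  · rw [if_neg fun h => h2 h.2]
    exact diracTraj1_of_neg fun h' => h2 (hx.univ_mem_blocks h'.2)

theorem empirical_eq {w : JumpRecord ι S} (h : w ∈ goodRecords ι S) (N : ℕ) :
    empirical N T w = (N : ℝ≥0∞)⁻¹ • ∑ C, blockDirac T C w := by
  unfold empirical
  congr 1
  refine Finset.sum_congr rfl fun C _ => ?_
  unfold blockDirac
  by_cases hC : C ∈ blocks (stateAt w T)
  · rw [if_pos ⟨h, hC⟩]
    obtain ⟨x, hx⟩ := Sum.isLeft_iff.1 (mem_blocks.1 hC)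
    rw [hx]; rfl
  · rw [if_neg fun h => hC h.2]
    rw [mem_blocks, Bool.not_eq_true, Sum.isLeft_eq_false, Sum.isRight_iff] at hC
    obtain ⟨u, hu⟩ := hC
    rw [hu]

theorem map_blockDirac {w : JumpRecord ι S} (h : w ∈ goodRecords ι S) (C : Finset ι) :
    (blockDirac T C w).map Subtype.val =
      if C ∈ blocks (stateAt w T) then Measure.dirac (pathConfig T (stateAt w) C) else 0 := by
  unfold blockDirac
  obtain ⟨x, hx⟩ := exists_isRealisation_of_mem_goodRecords h
  by_cases h2 : C ∈ blocks (stateAt w T)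
  · rw [if_pos ⟨h, h2⟩, if_pos h2, diracTraj1_of_pos (hx.isTrajectory_of_mem_blocks h2),
      Measure.map_dirac' measurable_subtype_coe]
  · rw [if_neg fun h => h2 h.2, if_neg h2, Measure.map_zero]

theorem map_finsetSum {X Y A : Type*} [MeasurableSpace X] [MeasurableSpace Y] (s : Finset A)
    (ν : A → Measure X) {g : X → Y} (hg : Measurable g) :
    (∑ i ∈ s, ν i).map g = ∑ i ∈ s, (ν i).map g := by
  ext B hB
  simp only [Measure.map_apply hg hB, Measure.finsetSum_apply]

theorem map_empirical {w : JumpRecord ι S} (h : w ∈ goodRecords ι S) (N : ℕ) :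
    (empirical N T w).map Subtype.val = (N : ℝ≥0∞)⁻¹ • historyMeasure T (stateAt w) := by
  rw [empirical_eq h, Measure.map_smul, map_finsetSum _ _ measurable_subtype_coe]
  simp_rw [map_blockDirac h]
  rfl

end TrajectoryMeasures

/-! ### The poissonised process, and the reference measure as a density. -/

section Poissonised

variable {S : Type*} [MeasurableSpace S] {T : ℝ≥0}
variable {K : Particle S → Particle S → ℝ≥0} {Υ : Kernel (Particle S × Particle S) S}
  {μ : Measure S}

theorem measurable_of_sigma {A : Type*} {B : A → Type*} [∀ a, MeasurableSpace (B a)] {X : Type*}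
    [MeasurableSpace X] {g : (Σ a, B a) → X} (h : ∀ a, Measurable fun b => g ⟨a, b⟩) :
    Measurable g := by
  intro s hs
  rw [Sigma.instMeasurableSpace, MeasurableSpace.measurableSet_iInf]
  exact fun a => h a hs

theorem measurable_sigmaMk {A : Type*} {B : A → Type*} [∀ a, MeasurableSpace (B a)] (a : A) :
    Measurable (Sigma.mk a : B a → Σ a, B a) := Measurable.of_le_map (iInf_le _ a)

theorem lintegral_poissonMeasure (r : ℝ≥0) (g : ℕ → ℝ≥0∞) :
    ∫⁻ n, g n ∂(poissonMeasure r) =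
      ∑' n : ℕ, ENNReal.ofReal (Real.exp (-r) * r ^ n / n.factorial) * g n := by
  rw [poissonMeasure, lintegral_sum_measure]
  refine tsum_congr fun n => ?_
  rw [lintegral_smul_measure, lintegral_dirac, smul_eq_mul]

variable [IsProbabilityMeasure μ] [IsMarkovKernel Υ]

theorem poissonisedLaw_eq (K : Particle S → Particle S → ℝ≥0)
    (Υ : Kernel (Particle S × Particle S) S) (γ : ℝ≥0) (μ : Measure S) :
    poissonisedLaw K Υ γ μ =
      (poissonMeasure γ).bind fun n => (initLaw (Fin n) K Υ μ).map (Sigma.mk n) := by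
  unfold poissonisedLaw initLaw
  simp_rw [labelledLaw_eq]

theorem lintegral_poissonisedLaw (γ : ℝ≥0) {F : (Σ n : ℕ, JumpRecord (Fin n) S) → ℝ≥0∞}
    (hF : Measurable F) :
    ∫⁻ w, F w ∂(poissonisedLaw K Υ γ μ) =
      ∑' n : ℕ, ENNReal.ofReal (Real.exp (-γ) * γ ^ n / n.factorial) *
        ∫⁻ w, F ⟨n, w⟩ ∂(initLaw (Fin n) K Υ μ) := by
  rw [poissonisedLaw_eq, Measure.lintegral_bind (measurable_of_countable _).aemeasurable
    hF.aemeasurable, lintegral_poissonMeasure]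
  refine tsum_congr fun n => ?_
  rw [lintegral_map hF (measurable_sigmaMk n)]

theorem isProbabilityMeasure_poissonisedLaw (hK : Measurable (Function.uncurry K)) (γ : ℝ≥0) :
    IsProbabilityMeasure (poissonisedLaw K Υ γ μ) := by
  constructor
  rw [← lintegral_one, lintegral_poissonisedLaw γ measurable_const]
  have e : ∀ n, ∫⁻ _, 1 ∂(initLaw (Fin n) K Υ μ) = 1 := fun n => by
    have := isProbabilityMeasure_initLaw (ι := Fin n) (Υ := Υ) (μ := μ) hK
    simp
  simp_rw [e]
  rw [← lintegral_poissonMeasure γ fun _ => 1]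
  simp

theorem measurableSet_sigma_goodRecords [MeasurableEq S] :
    MeasurableSet {w : Σ n : ℕ, JumpRecord (Fin n) S | w.2 ∈ goodRecords (Fin w.1) S} := by
  rw [Sigma.instMeasurableSpace, MeasurableSpace.measurableSet_iInf]
  exact fun n => measurableSet_goodRecords

theorem ae_poissonisedLaw_mem_goodRecords [MeasurableEq S] (hK : Measurable (Function.uncurry K))
    (γ : ℝ≥0) : ∀ᵐ w ∂(poissonisedLaw K Υ γ μ), w.2 ∈ goodRecords (Fin w.1) S := by
  classical
  have hm : MeasurableSet {w : Σ n : ℕ, JumpRecord (Fin n) S | w.2 ∉ goodRecords (Fin w.1) S} :=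
    measurableSet_sigma_goodRecords.compl
  rw [ae_iff, ← mul_one (poissonisedLaw K Υ γ μ _), mul_comm, ← lintegral_indicator_const hm,
    lintegral_poissonisedLaw γ (measurable_const.indicator hm)]
  refine ENNReal.tsum_eq_zero.2 fun n => ?_
  have : ∫⁻ w, {w : Σ n : ℕ, JumpRecord (Fin n) S | w.2 ∉ goodRecords (Fin w.1) S}.indicator
      (fun _ => (1 : ℝ≥0∞)) ⟨n, w⟩ ∂(initLaw (Fin n) K Υ μ) = 0 := by
    rw [← lintegral_zero (μ := initLaw (Fin n) K Υ μ)]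
    refine lintegral_congr_ae ?_
    filter_upwards [ae_initLaw_mem_goodRecords hK] with w hw
    exact Set.indicator_of_notMem (not_not.2 hw) _
  rw [this, mul_zero]

/-- The law of the whole configuration, restricted to the one-particle trajectories. -/
def trajLaw (K : Particle S → Particle S → ℝ≥0) (Υ : Kernel (Particle S × Particle S) S)
    (γ : ℝ≥0) (μ : Measure S) (T : ℝ≥0) : Measure (Traj1 S T) :=
  (poissonisedLaw K Υ γ μ).bind fun w => diracTraj1 T (wholeConfig T w.2)

theorem measurable_sigma_blockDirac_univ [MeasurableEq S] :
    Measurable fun w : Σ n : ℕ, JumpRecord (Fin n) S => blockDirac T Finset.univ w.2 :=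
  measurable_of_sigma fun _ => measurable_blockDirac T Finset.univ

theorem lintegral_blockDirac {ι : Type*} [Fintype ι] [DecidableEq ι] {w : JumpRecord ι S}
    (h : w ∈ goodRecords ι S) (C : Finset ι) {G : MeasurePath S T → ℝ≥0∞} (hG : Measurable G) :
    ∫⁻ ξ, G ξ.1 ∂(blockDirac T C w) =
      if C ∈ blocks (stateAt w T) then G (pathConfig T (stateAt w) C) else 0 := by
  rw [← lintegral_map hG measurable_subtype_coe, map_blockDirac h]
  split_ifs
  · rw [lintegral_dirac' _ hG]
  · rw [lintegral_zero_measure]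

theorem lintegral_trajLaw [MeasurableEq S] (hK : Measurable (Function.uncurry K)) (γ : ℝ≥0)
    {G : MeasurePath S T → ℝ≥0∞} (hG : Measurable G) :
    ∫⁻ ξ, G ξ.1 ∂(trajLaw K Υ γ μ T) =
      ∑' n : ℕ, ENNReal.ofReal (Real.exp (-γ) * γ ^ n / n.factorial) *
        ∫⁻ w, (if Finset.univ ∈ blocks (stateAt w T) then
          G (pathConfig T (stateAt w) Finset.univ) else 0) ∂(initLaw (Fin n) K Υ μ) := by
  -- The map being integrated over is replaced by the measurable `blockDirac`, with which it agrees
  -- on good records; this gives the almost everywhere measurability needed for the bind.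
  have hae : (fun w : Σ n : ℕ, JumpRecord (Fin n) S => diracTraj1 T (wholeConfig T w.2))
      =ᵐ[poissonisedLaw K Υ γ μ] fun w => blockDirac T Finset.univ w.2 := by
    filter_upwards [ae_poissonisedLaw_mem_goodRecords hK γ] with w hw
    exact diracTraj1_wholeConfig hw
  have hG' : Measurable fun ξ : Traj1 S T => G ξ.1 := hG.comp measurable_subtype_coe
  have hm : Measurable fun w : Σ n : ℕ, JumpRecord (Fin n) S =>
      ∫⁻ ξ, G ξ.1 ∂(blockDirac T Finset.univ w.2) :=
    (Measure.measurable_lintegral hG').comp measurable_sigma_blockDirac_univ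
  rw [trajLaw, Measure.lintegral_bind ⟨_, measurable_sigma_blockDirac_univ, hae⟩
    hG'.aemeasurable, lintegral_congr_ae (g := fun w => ∫⁻ ξ, G ξ.1 ∂(blockDirac T Finset.univ w.2))
      (hae.mono fun w hw => by simp only at hw; simp only [hw]), lintegral_poissonisedLaw γ hm]
  refine tsum_congr fun n => ?_
  congr 1
  refine lintegral_congr_ae ?_
  filter_upwards [ae_initLaw_mem_goodRecords hK] with w hw
  exact lintegral_blockDirac hw _ hG

/-- The number of atoms of a path, as a measurable functional. -/
def atomCount (η : MeasurePath S T) : ℝ≥0∞ := η (time0 T) Set.univ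

theorem measurable_atomCount : Measurable (atomCount : MeasurePath S T → ℝ≥0∞) :=
  (Measure.measurable_coe MeasurableSet.univ).comp (measurable_pi_apply (time0 T))

/-- Given `n` atoms, the initial configuration almost surely has mass `n`, so a density in the
number of atoms is constant on each term. -/
theorem lintegral_trajLaw_weight [MeasurableEq S] (hK : Measurable (Function.uncurry K)) (γ : ℝ≥0)
    {ρ : ℝ → ℝ≥0∞} (hρ : Measurable ρ) {G : MeasurePath S T → ℝ≥0∞} (hG : Measurable G) :
    ∫⁻ ξ, G ξ.1 ∂((trajLaw K Υ γ μ T).withDensity fun ξ => ρ (atomCount ξ.1).toReal) =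
      ∑' n : ℕ, ENNReal.ofReal (Real.exp (-γ) * γ ^ n / n.factorial) * ρ n *
        ∫⁻ w, (if Finset.univ ∈ blocks (stateAt w T) then
          G (pathConfig T (stateAt w) Finset.univ) else 0) ∂(initLaw (Fin n) K Υ μ) := by
  have hρ' : Measurable fun η : MeasurePath S T => ρ (atomCount η).toReal :=
    hρ.comp measurable_atomCount.ennreal_toReal
  have hρG : Measurable fun η : MeasurePath S T => ρ (atomCount η).toReal * G η := hρ'.mul hG
  have h1 : Measurable fun ξ : Traj1 S T => ρ (atomCount ξ.1).toReal :=
    hρ'.comp measurable_subtype_coe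
  have h2 : Measurable fun ξ : Traj1 S T => G ξ.1 := hG.comp measurable_subtype_coe
  rw [lintegral_withDensity_eq_lintegral_mul _ h1 h2]
  have := lintegral_trajLaw (K := K) (Υ := Υ) (μ := μ) hK γ hρG
  refine Eq.trans this (tsum_congr fun n => ?_)
  rw [mul_assoc]
  congr 1
  have hm : Measurable fun w : JumpRecord (Fin n) S => if Finset.univ ∈ blocks (stateAt w T) then
      G (pathConfig T (stateAt w) Finset.univ) else 0 :=
    Measurable.ite (measurableSet_mem_blocks_stateAt (T : ℝ) _)
      (hG.comp (measurable_pathConfig_stateAt T _)) measurable_const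
  rw [← lintegral_const_mul _ hm]
  refine lintegral_congr_ae ?_
  filter_upwards [ae_initLaw_isRealisation hK] with w ⟨x, hw⟩
  have : atomCount (pathConfig T (stateAt w) Finset.univ) = n := by
    rw [atomCount, hw.pathConfig_zero_univ, Fintype.card_fin]
  rw [this]
  split_ifs <;> simp

/-- The one-particle trajectories, where those with `n` atoms have weight `N^n / n!`. -/
def singleTraj (K : Particle S → Particle S → ℝ≥0) (Υ : Kernel (Particle S × Particle S) S)
    (μ : Measure S) (N : ℕ) (T : ℝ≥0) : Measure (Traj1 S T) :=
  ENNReal.ofReal (Real.exp N) • trajLaw K Υ N μ T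

theorem ofReal_exp_mul_poisson (N n : ℕ) :
    ENNReal.ofReal (Real.exp N) * ENNReal.ofReal (Real.exp (-(N : ℝ)) * (N : ℝ) ^ n / n.factorial) =
      poissonWeight N n := by
  rw [← ENNReal.ofReal_mul (Real.exp_nonneg _), poissonWeight, mul_div_assoc, ← mul_assoc,
    ← Real.exp_add, add_neg_cancel, Real.exp_zero, one_mul,
    ENNReal.ofReal_div_of_pos (by positivity), ENNReal.ofReal_pow (by positivity),
      ENNReal.ofReal_natCast, ENNReal.ofReal_natCast]

theorem lintegral_singleTraj [MeasurableEq S] (hK : Measurable (Function.uncurry K)) (N : ℕ)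
    {G : MeasurePath S T → ℝ≥0∞} (hG : Measurable G) :
    ∫⁻ ξ, G ξ.1 ∂(singleTraj K Υ μ N T) =
      ∑' n : ℕ, poissonWeight N n *
        ∫⁻ w, (if Finset.univ ∈ blocks (stateAt w T) then
          G (pathConfig T (stateAt w) Finset.univ) else 0) ∂(initLaw (Fin n) K Υ μ) := by
  rw [singleTraj, lintegral_smul_measure, lintegral_trajLaw hK _ hG, smul_eq_mul,
    ← ENNReal.tsum_mul_left]
  refine tsum_congr fun n => ?_
  rw [← mul_assoc, NNReal.coe_natCast, ofReal_exp_mul_poisson]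

theorem map_singleTraj [MeasurableEq S] (hK : Measurable (Function.uncurry K)) (N : ℕ) :
    (singleTraj K Υ μ N T).map Subtype.val = singleLaw K Υ μ N T := by
  refine Measure.ext_of_lintegral _ fun G hG => ?_
  rw [lintegral_map hG measurable_subtype_coe, lintegral_singleTraj hK N hG,
    lintegral_singleLaw N hG]

/-- The relative weight `e^{1-b} b^n` of the trajectories with `n` atoms. -/
def atomWeight (b : ℝ≥0) (x : ℝ) : ℝ≥0∞ :=
  ENNReal.ofReal (Real.exp (1 - b) * (b : ℝ) ^ x)

theorem measurable_atomWeight (b : ℝ≥0) : Measurable (atomWeight b) :=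
  (measurable_const.mul (measurable_const.pow measurable_id)).ennreal_ofReal

theorem traj_measure_ext {ν ν' : Measure (Traj1 S T)}
    (h : ∀ G : MeasurePath S T → ℝ≥0∞, Measurable G → ∫⁻ ξ, G ξ.1 ∂ν = ∫⁻ ξ, G ξ.1 ∂ν') :
    ν = ν' := by
  ext s hs
  obtain ⟨s', hs', rfl⟩ := hs
  have := h _ (measurable_const.indicator hs' (f := fun _ => 1))
  have e : ∀ ν : Measure (Traj1 S T), ∫⁻ ξ, s'.indicator (fun _ => 1) ξ.1 ∂ν =
      ν (Subtype.val ⁻¹' s') := fun ν => by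
    rw [← lintegral_map (measurable_const.indicator hs') measurable_subtype_coe,
      lintegral_indicator_const hs', one_mul, Measure.map_apply measurable_subtype_coe hs']
  rwa [e, e] at this

/-- For trajectories with `n` atoms this is the identity `N · N^{n-1} e · e^{-b} b^n / n! = (N^n /
n!) · e^{1-b} b^n`. -/
theorem smul_refMeasure_eq [MeasurableEq S] (hK : Measurable (Function.uncurry K)) {N : ℕ}
    (hN : 0 < N) (b : ℝ≥0) :
    (N : ℝ≥0∞) • refMeasure K Υ b μ N T =
      (singleTraj K Υ μ N T).withDensity fun ξ => atomWeight b (atomCount ξ.1).toReal := by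
  refine traj_measure_ext fun G hG => ?_
  have hρ : Measurable fun x : ℝ => ENNReal.ofReal ((N : ℝ) ^ (x - 1) * Real.exp 1) :=
    ((measurable_const.pow (measurable_id.sub_const 1)).mul_const _).ennreal_ofReal
  have h1 : refMeasure K Υ b μ N T = (trajLaw K Υ b μ T).withDensity fun ξ =>
      (fun x : ℝ => ENNReal.ofReal ((N : ℝ) ^ (x - 1) * Real.exp 1)) (atomCount ξ.1).toReal := rfl
  rw [lintegral_smul_measure, h1, lintegral_trajLaw_weight hK b hρ hG, singleTraj,
    withDensity_smul_measure, lintegral_smul_measure,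
    lintegral_trajLaw_weight hK _ (measurable_atomWeight b) hG, smul_eq_mul, smul_eq_mul,
    ← ENNReal.tsum_mul_left, ← ENNReal.tsum_mul_left]
  refine tsum_congr fun n => ?_
  simp only [← mul_assoc]
  congr 1
  have ha : atomWeight b n = ENNReal.ofReal (Real.exp (1 - b) * (b : ℝ) ^ (n : ℝ)) := rfl
  rw [← ENNReal.ofReal_natCast, ha, ← ENNReal.ofReal_mul (by positivity),
    ← ENNReal.ofReal_mul (by positivity), ← ENNReal.ofReal_mul (by positivity),
    ← ENNReal.ofReal_mul (by positivity)]
  congr 1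
  have hN' : (N : ℝ) ≠ 0 := by exact_mod_cast hN.ne'
  rw [Real.rpow_sub_one hN', Real.rpow_natCast, Real.rpow_natCast, NNReal.coe_natCast, sub_eq_add_neg, Real.exp_add]
  have h2 : Real.exp N * Real.exp (-(N : ℝ)) = 1 := by rw [← Real.exp_add]; simp
  field_simp
  linear_combination (-(b : ℝ) ^ n) * h2

/-- Bounding the probability of a single final particle by one leaves an exponential series in `bN`;
this works for every `b`. -/
theorem smul_refMeasure_univ_lt_top [MeasurableEq S] (hK : Measurable (Function.uncurry K)) {N : ℕ}
    (hN : 0 < N) (b : ℝ≥0) : ((N : ℝ≥0∞) • refMeasure K Υ b μ N T) Set.univ < ∞ := by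
  have h := lintegral_trajLaw_weight (K := K) (Υ := Υ) (μ := μ) (T := T) hK N
    (measurable_atomWeight b) (G := fun _ => 1) measurable_const
  rw [smul_refMeasure_eq hK hN, singleTraj, withDensity_smul_measure, ← lintegral_one,
    lintegral_smul_measure, h, smul_eq_mul]
  refine ENNReal.mul_lt_top ENNReal.ofReal_lt_top ?_
  have hs : Summable fun n : ℕ => Real.exp (1 - b) * ((b * N : ℝ) ^ n / n.factorial) :=
    (Real.summable_pow_div_factorial _).mul_left _
  refine lt_of_le_of_lt (ENNReal.tsum_le_tsum fun n => ?_) hs.tsum_ofReal_lt_top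
  have := isProbabilityMeasure_initLaw (ι := Fin n) (Υ := Υ) (μ := μ) hK
  have hle : ∫⁻ w, (if Finset.univ ∈ blocks (stateAt w T) then 1 else 0)
      ∂(initLaw (Fin n) K Υ μ) ≤ 1 := by
    refine (lintegral_mono (g := fun _ => 1) fun w => ?_).trans (by simp)
    split_ifs <;> simp
  refine (mul_le_of_le_one_right' hle).trans ?_
  have ha : atomWeight b n = ENNReal.ofReal (Real.exp (1 - b) * (b : ℝ) ^ (n : ℝ)) := rfl
  rw [ha, ← ENNReal.ofReal_mul (by positivity), Real.rpow_natCast, NNReal.coe_natCast]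
  refine ENNReal.ofReal_le_ofReal ?_
  have h1 : Real.exp (-(N : ℝ)) ≤ 1 := Real.exp_le_one_iff.2 (by simp)
  calc Real.exp (-(N : ℝ)) * (N : ℝ) ^ n / n.factorial * (Real.exp (1 - b) * (b : ℝ) ^ n)
      = Real.exp (-(N : ℝ)) * (Real.exp (1 - b) * ((b * N : ℝ) ^ n / n.factorial)) := by
        rw [mul_pow]; ring
    _ ≤ _ := mul_le_of_le_one_left (by positivity) h1

end Poissonised

/-! ### The law of a Poisson point process -/

section PoissonProcess

variable {X : Type*} [MeasurableSpace X]

/-- The evaluations at measurable sets embed the measures into a product space and generate their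
σ-algebra; there, finite-dimensional marginals determine a finite measure. -/
theorem measure_ext_of_eval {P P' : Measure (Measure X)} [IsFiniteMeasure P] [IsFiniteMeasure P']
    (h : ∀ J : Finset {A : Set X // MeasurableSet A},
      P.map (fun ν (A : J) => ν A.1.1) = P'.map fun ν (A : J) => ν A.1.1) : P = P' := by
  let e : Measure X → {A : Set X // MeasurableSet A} → ℝ≥0∞ := fun ν A => ν A.1
  have he : Measurable e := measurable_pi_lambda _ fun A => Measure.measurable_coe A.2
  have hr : ∀ (R : Measure (Measure X)) (J : Finset {A : Set X // MeasurableSet A}),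
      (R.map e).map J.restrict = R.map fun ν (A : J) => ν A.1.1 := fun R J => by
    rw [Measure.map_map (Finset.measurable_restrict J) he]; rfl
  have hlim : P.map e = P'.map e := by
    refine IsProjectiveLimit.unique (P := fun J => P.map fun ν (A : J) => ν A.1.1)
      (fun J => hr P J) fun J => ?_
    rw [hr P' J]
    exact (h J).symm
  have hle : ∀ s : Set (Measure X), MeasurableSet s →
      MeasurableSet[MeasurableSpace.comap e inferInstance] s := by
    intro s hs
    have : @Measurable _ _ (MeasurableSpace.comap e inferInstance) _ (id : Measure X → Measure X) :=
      @Measure.measurable_of_measurable_coe X (Measure X) _ (MeasurableSpace.comap e inferInstance)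
        id fun A hA => (measurable_pi_apply (⟨A, hA⟩ : {A : Set X // MeasurableSet A})).comp
          (comap_measurable e)
    exact this hs
  ext s hs
  obtain ⟨s', hs', rfl⟩ := hle s hs
  rw [← Measure.map_apply he hs', hlim, Measure.map_apply he hs']

theorem measurable_simpleFunc_integral (g : SimpleFunc X ℝ) :
    Measurable fun ν : Measure X => g.integral ν := by
  simp_rw [SimpleFunc.integral_eq]
  refine Finset.measurable_fun_sum _ fun c _ => ?_
  exact (Measure.measurable_coe (g.measurableSet_fiber c)).ennreal_toReal.mul_const _

/-- The function `∑ t_A 1_A`. -/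
def indicatorSum (J : Finset {A : Set X // MeasurableSet A}) (t : J → ℝ) : SimpleFunc X ℝ where
  toFun x := ∑ A : J, A.1.1.indicator (fun _ => t A) x
  measurableSet_fiber' c := by
    have : Measurable fun x => ∑ A : J, A.1.1.indicator (fun _ => t A) x :=
      Finset.measurable_fun_sum _ fun A _ => measurable_const.indicator A.1.2
    exact this (measurableSet_singleton c)
  finite_range' := by
    classical
    refine (Set.finite_range fun b : J → Bool => ∑ A : J, if b A then t A else 0).subset ?_
    rintro _ ⟨x, rfl⟩
    refine ⟨fun A => decide (x ∈ A.1.1), ?_⟩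
    simp [Set.indicator_apply]

theorem integral_indicatorSum (J : Finset {A : Set X // MeasurableSet A}) (t : J → ℝ)
    (ν : Measure X) [IsFiniteMeasure ν] :
    (indicatorSum J t).integral ν = ∑ A : J, (ν A.1.1).toReal * t A := by
  rw [SimpleFunc.integral_eq_integral _ (SimpleFunc.integrable_of_isFiniteMeasure _)]
  have : ∀ x, indicatorSum J t x = ∑ A : J, A.1.1.indicator (fun _ => t A) x := fun _ => rfl
  simp_rw [this]
  rw [integral_finsetSum _ fun A _ => (integrable_const (t A)).indicator A.1.2]
  refine Finset.sum_congr rfl fun A _ => ?_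
  rw [integral_indicator_const _ A.1.2]
  rfl

/-- A linear functional of the finitely many masses `ν(A)` is the integral of a simple function, so
the hypothesis determines the characteristic function of every finite vector of masses. -/
theorem measure_ext_of_characteristic {P P' : Measure (Measure X)} [IsFiniteMeasure P]
    [IsFiniteMeasure P'] (hP : ∀ᵐ ν ∂P, ν Set.univ < ∞) (hP' : ∀ᵐ ν ∂P', ν Set.univ < ∞)
    (h : ∀ g : SimpleFunc X ℝ, ∫ ν, Complex.exp ((g.integral ν : ℝ) * Complex.I) ∂P =
      ∫ ν, Complex.exp ((g.integral ν : ℝ) * Complex.I) ∂P') : P = P' := by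
  classical
  refine measure_ext_of_eval fun J => ?_
  let v : Measure X → J → ℝ := fun ν A => (ν A.1.1).toReal
  have hv : Measurable v :=
    measurable_pi_lambda _ fun A => (Measure.measurable_coe A.1.2).ennreal_toReal
  have hchar : ∀ (P₀ : Measure (Measure X)), (∀ᵐ ν ∂P₀, ν Set.univ < ∞) →
      ∀ L : StrongDual ℝ (J → ℝ), charFunDual (P₀.map v) L =
        ∫ ν, Complex.exp (((indicatorSum J fun A => L fun j => if A = j then 1 else 0).integral ν
          : ℝ) * Complex.I) ∂P₀ := by
    intro P₀ h₀ L
    rw [charFunDual_apply, integral_map hv.aemeasurable (by fun_prop)]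
    refine integral_congr_ae ?_
    filter_upwards [h₀] with ν hν
    have : IsFiniteMeasure ν := ⟨hν⟩
    rw [integral_indicatorSum]
    congr 3
    exact LinearMap.pi_apply_eq_sum_univ (L : (J → ℝ) →ₗ[ℝ] ℝ) (v ν)
  have hmap : P.map v = P'.map v := by
    refine Measure.ext_of_charFunDual (funext fun L => ?_)
    rw [hchar P hP, hchar P' hP', h]
  -- Passing to real numbers loses nothing, because almost all masses are finite.
  have hback : ∀ (P₀ : Measure (Measure X)), (∀ᵐ ν ∂P₀, ν Set.univ < ∞) →
      P₀.map (fun ν (A : J) => ν A.1.1) =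
        (P₀.map v).map fun y (A : J) => ENNReal.ofReal (y A) := by
    intro P₀ h₀
    rw [Measure.map_map (measurable_pi_lambda _ fun A =>
      (measurable_pi_apply A).ennreal_ofReal) hv]
    refine Measure.map_congr ?_
    filter_upwards [h₀] with ν hν
    funext A
    exact (ENNReal.ofReal_toReal ((measure_mono (Set.subset_univ _)).trans_lt hν).ne).symm
  rw [hback P hP, hback P' hP', hmap]

/-- The law of `∑_{i < κ} δ_{ξ_i}` with `κ` Poisson distributed and i.i.d. points `ξ_i`. -/
def poissonMixture (M : Measure X) : Measure (Measure X) :=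
  Measure.sum fun k : ℕ => ENNReal.ofReal (Real.exp (-M.real Set.univ) / k.factorial) •
    (Measure.pi fun _ : Fin k => M).map fun η => ∑ i, Measure.dirac (η i)

theorem lintegral_poissonMixture (M : Measure X) {F : Measure X → ℝ≥0∞} (hF : Measurable F) :
    ∫⁻ ν, F ν ∂(poissonMixture M) = ∑' k : ℕ,
      ENNReal.ofReal (Real.exp (-M.real Set.univ) / k.factorial) *
        ∫⁻ η, F (∑ i, Measure.dirac (η i)) ∂(Measure.pi fun _ : Fin k => M) := by
  rw [poissonMixture, lintegral_sum_measure]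
  refine tsum_congr fun k => ?_
  rw [lintegral_smul_measure, lintegral_map hF (measurable_sum_dirac k), smul_eq_mul]

variable {M : Measure X} [IsFiniteMeasure M]

/-- The product measures are not normalised: `M^k` contributes `|M|^k`, which completes
`e^{-|M|}/k!` to the Poisson weights. -/
instance isProbabilityMeasure_poissonMixture : IsProbabilityMeasure (poissonMixture M) := by
  constructor
  rw [← lintegral_one, lintegral_poissonMixture M measurable_const]
  have e : ∀ k : ℕ, ENNReal.ofReal (Real.exp (-M.real Set.univ) / k.factorial) *
      ∫⁻ _, 1 ∂(Measure.pi fun _ : Fin k => M) =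
      ENNReal.ofReal (Real.exp (-M.real Set.univ) * (M.real Set.univ ^ k / k.factorial)) := by
    intro k
    rw [lintegral_one, Measure.pi_univ, Finset.prod_const, Finset.card_univ, Fintype.card_fin,
      ← ENNReal.ofReal_toReal (measure_ne_top M Set.univ), ← ENNReal.ofReal_pow (by positivity),
      ← ENNReal.ofReal_mul (by positivity)]
    congr 1
    simp only [measureReal_def]
    ring
  have h := (NormedSpace.expSeries_div_hasSum_exp (𝔸 := ℝ) (M.real Set.univ)).mul_left
    (Real.exp (-M.real Set.univ))
  simp_rw [e]
  rw [← ENNReal.ofReal_tsum_of_nonneg (fun k => by positivity) h.summable, h.tsum_eq,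
    ← Real.exp_eq_exp_ℝ, ← Real.exp_add]
  simp

theorem ae_poissonMixture_lt_top : ∀ᵐ ν ∂(poissonMixture M), ν Set.univ < ∞ := by
  have hm : MeasurableSet {ν : Measure X | ¬ ν Set.univ < ∞} :=
    (measurableSet_lt (Measure.measurable_coe MeasurableSet.univ) measurable_const).compl
  rw [ae_iff, ← one_mul (poissonMixture M _), ← lintegral_indicator_const hm,
    lintegral_poissonMixture M (measurable_const.indicator hm)]
  refine ENNReal.tsum_eq_zero.2 fun k => ?_
  simp

theorem simpleFunc_integral_sum_dirac {A : Type*} (g : SimpleFunc X ℝ) (s : Finset A)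
    (x : A → X) : g.integral (∑ i ∈ s, Measure.dirac (x i)) = ∑ i ∈ s, g (x i) := by
  rw [SimpleFunc.integral_eq_integral _ (SimpleFunc.integrable_of_isFiniteMeasure _),
    integral_finsetSum_measure fun i _ => SimpleFunc.integrable_of_isFiniteMeasure _]
  exact Finset.sum_congr rfl fun i _ => integral_dirac' _ _ g.stronglyMeasurable

theorem integrable_cexp_I {Ω : Type*} [MeasurableSpace Ω] (Q : Measure Ω) [IsFiniteMeasure Q]
    {Y : Ω → ℝ} (hY : Measurable Y) : Integrable (fun ω => Complex.exp (Y ω * Complex.I)) Q := by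
  refine Integrable.of_bound (C := 1) ?_ (Filter.Eventually.of_forall fun ω => ?_)
  · exact (Complex.measurable_exp.comp
      ((Complex.measurable_ofReal.comp hY).mul_const _)).aestronglyMeasurable
  · rw [Complex.norm_exp_ofReal_mul_I]

theorem integral_cexp_sub_one (M : Measure X) [IsFiniteMeasure M] (g : SimpleFunc X ℝ) :
    ∫ x, (Complex.exp (g x * Complex.I) - 1) ∂M =
      (∫ x, Complex.exp (g x * Complex.I) ∂M) - M.real Set.univ := by
  rw [integral_sub (integrable_cexp_I M g.measurable) (integrable_const _)]
  simp

/-- For `k` points the integral is a `k`-th power by independence, and the sum over `k` is the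
exponential series. -/
theorem characteristic_poissonMixture (g : SimpleFunc X ℝ) :
    ∫ ν, Complex.exp ((g.integral ν : ℝ) * Complex.I) ∂(poissonMixture M) =
      Complex.exp (∫ x, (Complex.exp (g x * Complex.I) - 1) ∂M) := by
  have hi : Integrable (fun ν : Measure X => Complex.exp ((g.integral ν : ℝ) * Complex.I))
      (poissonMixture M) := integrable_cexp_I _ (measurable_simpleFunc_integral g)
  have hm : Measurable fun ν : Measure X => Complex.exp ((g.integral ν : ℝ) * Complex.I) :=
    Complex.measurable_exp.comp
      ((Complex.measurable_ofReal.comp (measurable_simpleFunc_integral g)).mul_const _)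
  have hterm : ∀ k : ℕ, ∫ ν, Complex.exp ((g.integral ν : ℝ) * Complex.I)
      ∂(ENNReal.ofReal (Real.exp (-M.real Set.univ) / k.factorial) •
      (Measure.pi fun _ : Fin k => M).map fun η => ∑ i, Measure.dirac (η i)) =
      Complex.exp (-(M.real Set.univ : ℝ)) *
        ((∫ x, Complex.exp (g x * Complex.I) ∂M) ^ k / k.factorial) := by
    intro k
    rw [integral_smul_measure, integral_map (measurable_sum_dirac k).aemeasurable
      hm.aestronglyMeasurable, ENNReal.toReal_ofReal (by positivity)]
    have e : ∀ η : Fin k → X, Complex.exp ((g.integral (∑ i, Measure.dirac (η i)) : ℝ) *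
        Complex.I) = ∏ i, Complex.exp (g (η i) * Complex.I) := fun η => by
      rw [simpleFunc_integral_sum_dirac, ← Complex.exp_sum, Complex.ofReal_sum, Finset.sum_mul]
    simp_rw [e]
    rw [integral_fintype_prod_eq_pow (ι := Fin k) (fun x => Complex.exp (g x * Complex.I)),
      Fintype.card_fin, Complex.real_smul]
    push_cast
    ring
  have h1 := hasSum_integral_measure hi
  simp_rw [hterm] at h1
  have h2 := (NormedSpace.expSeries_div_hasSum_exp (𝔸 := ℂ)
    (∫ x, Complex.exp (g x * Complex.I) ∂M)).mul_left (Complex.exp (-(M.real Set.univ : ℝ)))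
  refine (h1.unique h2).trans ?_
  rw [← Complex.exp_eq_exp_ℂ, ← Complex.exp_add, integral_cexp_sub_one]
  congr 1
  ring

variable {Ω : Type*} [MeasurableSpace Ω] {Q : Measure Ω} [IsProbabilityMeasure Q] {n : Ω → ℕ}
  {ξ : ℕ → Ω → X}

theorem IsPoissonPointProcess.measurable (h : IsPoissonPointProcess M Q n ξ) :
    Measurable fun ω => pointMeasure (n ω) fun i => ξ i ω := by
  have hm : Measurable fun p : ℕ × Ω => pointMeasure p.1 fun i => ξ i p.2 := by
    refine measurable_from_prod_countable_right fun k => ?_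
    simp only [pointMeasure]
    exact measurable_measure_sum (Finset.range k) fun i =>
      Measurable.comp Measure.measurable_dirac (h.measurable_point i)
  exact Measurable.comp (g := fun p : ℕ × Ω => pointMeasure p.1 fun i => ξ i p.2)
    (f := fun ω => (n ω, ω)) hm (h.measurable_number.prodMk measurable_id)

instance (k : ℕ) (x : ℕ → X) : IsFiniteMeasure (pointMeasure k x) := by
  unfold pointMeasure; infer_instance

theorem IsPoissonPointProcess.integral_cexp_count (h : IsPoissonPointProcess M Q n ξ) {A : Set X}
    (hA : MeasurableSet A) (c : ℝ) :
    ∫ ω, Complex.exp (((pointMeasure (n ω) (fun i => ξ i ω) A).toReal * c : ℝ) * Complex.I) ∂Q =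
      Complex.exp (M.real A * (Complex.exp (c * Complex.I) - 1)) := by
  have hY : Measurable fun ω => pointMeasure (n ω) (fun i => ξ i ω) A :=
    (Measure.measurable_coe hA).comp h.measurable
  have hm : Measurable fun y : ℝ≥0∞ => Complex.exp ((y.toReal * c : ℝ) * Complex.I) :=
    Complex.measurable_exp.comp
      ((Complex.measurable_ofReal.comp (ENNReal.measurable_toReal.mul_const c)).mul_const _)
  rw [← integral_map (φ := fun ω => pointMeasure (n ω) (fun i => ξ i ω) A)
    (f := fun y : ℝ≥0∞ => Complex.exp ((y.toReal * c : ℝ) * Complex.I)) hY.aemeasurable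
    hm.aestronglyMeasurable, h.law_count A hA, integral_map (by fun_prop) hm.aestronglyMeasurable]
  have hc := charFun_map_cast_poissonMeasure (M A).toNNReal c
  rw [charFun_apply, integral_map (by fun_prop) (by fun_prop)] at hc
  have e : (((M A).toNNReal : ℝ≥0) : ℂ) = (M.real A : ℂ) := rfl
  rw [e] at hc
  rw [← hc]
  simp [mul_comm]

/-- The integral of `g` is a linear combination of the numbers of points in the level sets of `g`.
These sets are disjoint, so the counts are independent Poisson variables and the characteristic
functions multiply. -/
theorem IsPoissonPointProcess.characteristic (h : IsPoissonPointProcess M Q n ξ)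
    (g : SimpleFunc X ℝ) :
    ∫ ω, Complex.exp ((g.integral (pointMeasure (n ω) fun i => ξ i ω) : ℝ) * Complex.I) ∂Q =
      Complex.exp (∫ x, (Complex.exp (g x * Complex.I) - 1) ∂M) := by
  -- The values of `g` are enumerated by `Fin`, the index type for which independence of the counts
  -- is given.
  let e := g.range.equivFin
  let c : Fin g.range.card → ℝ := fun l => (e.symm l : ℝ)
  have hcinj : Function.Injective c := Subtype.val_injective.comp e.symm.injective
  have hsum : ∀ {E : Type} [AddCommMonoid E] (φ : ℝ → E), ∑ x ∈ g.range, φ x = ∑ l, φ (c l) := by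
    intro E _ φ
    rw [← Finset.sum_coe_sort]
    exact Fintype.sum_equiv e _ _ fun x => by simp [c]
  have hmeas : ∀ l, MeasurableSet (g ⁻¹' {c l}) := fun l => g.measurableSet_fiber _
  have hind := h.indep_count _ (fun l => g ⁻¹' {c l}) hmeas fun i j hij =>
    Disjoint.preimage g (by simpa using hcinj.ne hij)
  have hm : ∀ l, Measurable fun y : ℝ≥0∞ => Complex.exp ((y.toReal * c l : ℝ) * Complex.I) :=
    fun l => Complex.measurable_exp.comp ((Complex.measurable_ofReal.comp
      (ENNReal.measurable_toReal.mul_const (c l))).mul_const _)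
  have hprod := hind.integral_fun_prod_comp
    (f := fun l (y : ℝ≥0∞) => Complex.exp ((y.toReal * c l : ℝ) * Complex.I))
    (fun l => ((Measure.measurable_coe (hmeas l)).comp h.measurable).aemeasurable)
    fun l => (hm l).aestronglyMeasurable
  simp_rw [h.integral_cexp_count (hmeas _)] at hprod
  have e1 : ∀ ω, Complex.exp ((g.integral (pointMeasure (n ω) fun i => ξ i ω) : ℝ) * Complex.I) =
      ∏ l, Complex.exp ((((pointMeasure (n ω) fun i => ξ i ω) (g ⁻¹' {c l})).toReal * c l : ℝ) *
        Complex.I) := fun ω => by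
    rw [← Complex.exp_sum, SimpleFunc.integral_eq, hsum, Complex.ofReal_sum, Finset.sum_mul]
    rfl
  simp_rw [e1]
  rw [hprod, ← Complex.exp_sum]
  congr 1
  have h2 := SimpleFunc.map_integral (μ := M) g (fun x : ℝ => Complex.exp (x * Complex.I) - 1)
    (SimpleFunc.integrable_of_isFiniteMeasure _) (by simp)
  rw [SimpleFunc.integral_eq_integral _ (SimpleFunc.integrable_of_isFiniteMeasure _), hsum] at h2
  simp only [SimpleFunc.coe_map, Function.comp_apply] at h2
  rw [h2]
  simp

/-- Any Poisson process with intensity `M`, on whatever probability space, has the law of the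
explicit mixture, since the characteristic functionals agree. -/
theorem IsPoissonPointProcess.map_eq (h : IsPoissonPointProcess M Q n ξ) :
    Q.map (fun ω => pointMeasure (n ω) fun i => ξ i ω) = poissonMixture M := by
  have hQ : IsProbabilityMeasure (Q.map fun ω => pointMeasure (n ω) fun i => ξ i ω) :=
    Measure.isProbabilityMeasure_map h.measurable.aemeasurable
  refine measure_ext_of_characteristic ?_ ae_poissonMixture_lt_top fun g => ?_
  · have hm : MeasurableSet {ν : Measure X | ν Set.univ < ∞} :=
      measurableSet_lt (Measure.measurable_coe MeasurableSet.univ) measurable_const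
    rw [ae_map_iff h.measurable.aemeasurable hm]
    exact Filter.Eventually.of_forall fun ω => measure_lt_top _ _
  · have hm : Measurable fun ν : Measure X => Complex.exp ((g.integral ν : ℝ) * Complex.I) :=
      Complex.measurable_exp.comp
        ((Complex.measurable_ofReal.comp (measurable_simpleFunc_integral g)).mul_const _)
    rw [integral_map h.measurable.aemeasurable hm.aestronglyMeasurable, h.characteristic,
      characteristic_poissonMixture]

theorem IsPoissonPointProcess.lintegral_eq (h : IsPoissonPointProcess M Q n ξ)
    {F : Measure X → ℝ≥0∞} (hF : Measurable F) :
    ∫⁻ ω, F (pointMeasure (n ω) fun i => ξ i ω) ∂Q = ∑' k : ℕ,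
      ENNReal.ofReal (Real.exp (-M.real Set.univ) / k.factorial) *
        ∫⁻ η, F (∑ i, Measure.dirac (η i)) ∂(Measure.pi fun _ : Fin k => M) := by
  rw [← lintegral_poissonMixture M hF, ← h.map_eq, lintegral_map hF h.measurable]

end PoissonProcess

/-! ### The Poissonian description -/

section Products

variable {X : Type*} [MeasurableSpace X]

/-- Products of finite measures with densities. -/
theorem lintegral_pi_withDensity (m : Measure X) [IsFiniteMeasure m] {ρ : X → ℝ≥0∞}
    (hρ : Measurable ρ) [IsFiniteMeasure (m.withDensity ρ)] (k : ℕ) :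
    ∀ {H : (Fin k → X) → ℝ≥0∞}, Measurable H →
    ∫⁻ η, H η ∂(Measure.pi fun _ : Fin k => m.withDensity ρ) =
      ∫⁻ η, (∏ i, ρ (η i)) * H η ∂(Measure.pi fun _ : Fin k => m) := by
  induction k with
  | zero =>
    intro H _
    rw [Measure.pi_of_empty, Measure.pi_of_empty]
    simp
  | succ k ih =>
    intro H hH
    have hprod : ∀ l : ℕ, Measurable fun η : Fin l → X => ∏ i, ρ (η i) := fun l =>
      Finset.measurable_fun_prod _ fun i _ => hρ.comp (measurable_pi_apply i)
    have hcons : Measurable fun p : X × (Fin k → X) => (Fin.cons p.1 p.2 : Fin (k + 1) → X) := by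
      refine measurable_pi_lambda _ fun i => ?_
      refine Fin.cases ?_ (fun j => ?_) i
      · exact measurable_fst
      · exact (measurable_pi_apply j).comp measurable_snd
    have hH1 : Measurable fun p : X × (Fin k → X) => H (Fin.cons p.1 p.2) := hH.comp hcons
    have hH2 : ∀ ξ : X, Measurable fun η : Fin k → X => H (Fin.cons ξ η) := fun ξ =>
      Measurable.comp (g := fun p : X × (Fin k → X) => H (Fin.cons p.1 p.2))
        (f := fun η => (ξ, η)) hH1 measurable_prodMk_left
    have hH3 : Measurable fun p : X × (Fin k → X) => (∏ i, ρ (p.2 i)) * H (Fin.cons p.1 p.2) :=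
      Measurable.mul (Measurable.comp (g := fun η : Fin k → X => ∏ i, ρ (η i)) (hprod k)
        measurable_snd) hH1
    rw [lintegral_pi_succ _ k hH, lintegral_pi_succ (G := fun η => (∏ i, ρ (η i)) * H η) _ k
      ((hprod (k + 1)).mul hH)]
    simp_rw [ih (hH2 _)]
    rw [lintegral_withDensity_eq_lintegral_mul _ hρ hH3.lintegral_prod_right']
    refine lintegral_congr fun ξ => ?_
    rw [Pi.mul_apply]
    refine (lintegral_const_mul (f := fun η : Fin k → X => (∏ i, ρ (η i)) * H (Fin.cons ξ η)) _
      ((hprod k).mul (hH2 ξ))).symm.trans ?_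
    refine lintegral_congr fun η => ?_
    rw [Fin.prod_univ_succ]
    simp only [Fin.cons_zero, Fin.cons_succ, mul_assoc]

/-- The σ-algebra on measures on a subtype is pulled back from the measures on `X` by the image
under the inclusion, so a measurable function factors through that image. The predicate `p` may be
arbitrary, as is needed for the set of trajectories. -/
theorem exists_measurable_factor_map {X : Type*} [MeasurableSpace X] {p : X → Prop}
    {f : Measure (Subtype p) → ℝ≥0} (hf : Measurable f) :
    ∃ f' : Measure X → ℝ≥0, Measurable f' ∧ ∀ ν, f ν = f' (ν.map Subtype.val) := by
  have hle : ∀ s : Set (Measure (Subtype p)), MeasurableSet s → MeasurableSet[MeasurableSpace.comap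
      (fun ν : Measure (Subtype p) => ν.map Subtype.val) inferInstance] s := by
    intro s hs
    have : @Measurable _ _ (MeasurableSpace.comap
        (fun ν : Measure (Subtype p) => ν.map Subtype.val) inferInstance) _
        (id : Measure (Subtype p) → Measure (Subtype p)) := by
      refine @Measure.measurable_of_measurable_coe _ _ _ (MeasurableSpace.comap
        (fun ν : Measure (Subtype p) => ν.map Subtype.val) inferInstance) id fun A hA => ?_
      obtain ⟨A', hA', rfl⟩ := hA
      have h := (Measure.measurable_coe hA').comp
        (comap_measurable fun ν : Measure (Subtype p) => ν.map Subtype.val)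
      have e : (fun ν : Measure (Subtype p) => (id ν) (Subtype.val ⁻¹' A')) =
          (fun ν : Measure X => ν A') ∘ fun ν : Measure (Subtype p) => ν.map Subtype.val := by
        funext ν
        exact (Measure.map_apply measurable_subtype_coe hA').symm
      rw [e]
      exact h
    exact this hs
  obtain ⟨f', hf', h⟩ := Measurable.exists_eq_measurable_comp
    (f := fun ν : Measure (Subtype p) => ν.map Subtype.val) (fun s hs => hle _ (hf hs))
  exact ⟨f', hf', fun ν => congrFun h ν⟩

end Products

/-! ### The left-hand side as a series over the number of final particles. -/

section Labelled

variable {S : Type*} [MeasurableSpace S] [MeasurableEq S] {T : ℝ≥0}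
  {K : Particle S → Particle S → ℝ≥0} {Υ : Kernel (Particle S × Particle S) S} {μ : Measure S}
  [IsProbabilityMeasure μ] [IsMarkovKernel Υ]

theorem isFiniteMeasure_singleTraj (hK : Measurable (Function.uncurry K)) (N : ℕ) :
    IsFiniteMeasure (singleTraj K Υ μ N T) := by
  have h := isFiniteMeasure_singleLaw (Υ := Υ) (μ := μ) (T := T) hK N
  rw [← map_singleTraj hK N] at h
  exact Measure.isFiniteMeasure_of_map measurable_subtype_coe.aemeasurable

theorem measurable_historyMeasure_sigma (T : ℝ≥0) :
    Measurable fun w : Σ n : ℕ, JumpRecord (Fin n) S => historyMeasure T (stateAt w.2) :=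
  measurable_of_sigma fun _ => measurable_historyMeasure_stateAt T

/-- The law of the empirical measure is a sum over the number of particles at time `T`. -/
theorem lintegral_poissonisedLaw_historyMeasure (hK : Measurable (Function.uncurry K))
    (hKsymm : ∀ p q, K p q = K q p) (N : ℕ) {F : Measure (MeasurePath S T) → ℝ≥0∞}
    (hF : Measurable F) :
    ∫⁻ w, F (historyMeasure T (stateAt w.2)) ∂(poissonisedLaw K Υ N μ) =
      ENNReal.ofReal (Real.exp (-N)) * ∑' k : ℕ, (k.factorial : ℝ≥0∞)⁻¹ *
        ∫⁻ η, expNeg (pairSum K η) * F (∑ i, Measure.dirac (η i))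
          ∂(Measure.pi fun _ : Fin k => singleLaw K Υ μ N T) := by
  have hk : ∀ k : ℕ, (k.factorial : ℝ≥0∞)⁻¹ *
      ∫⁻ η, expNeg (pairSum K η) * F (∑ i, Measure.dirac (η i))
        ∂(Measure.pi fun _ : Fin k => singleLaw K Υ μ N T) =
      ∫⁻ Y, F Y ∂(historyLaw K Υ μ N T k) := fun k => by
    rw [← lintegral_historyLaw_eq hK hKsymm N k hF, ← mul_assoc, ENNReal.inv_mul_cancel
      (by exact_mod_cast k.factorial_ne_zero) (ENNReal.natCast_ne_top _), one_mul]
  simp_rw [hk, lintegral_historyLaw N _ hF]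
  have hFm := hF.comp (measurable_historyMeasure_sigma (S := S) T)
  -- The sums over the number `k` of final particles and the number `n` of atoms are exchanged; for
  -- fixed `n` the sum over `k` removes the restriction on the number of blocks.
  rw [ENNReal.tsum_comm, ← ENNReal.tsum_mul_left]
  refine (lintegral_poissonisedLaw (N : ℝ≥0) hFm).trans (tsum_congr fun n => ?_)
  have hm : ∀ k : ℕ, Measurable fun w : JumpRecord (Fin n) S =>
      if (blocks (stateAt w T)).card = k then F (historyMeasure T (stateAt w)) else 0 := fun k =>
    Measurable.ite (measurableSet_card_blocks_stateAt T k)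
      (hF.comp (measurable_historyMeasure_stateAt T)) measurable_const
  rw [ENNReal.tsum_mul_left, ← lintegral_tsum fun k => (hm k).aemeasurable, ← mul_assoc]
  congr 1
  · rw [poissonWeight, mul_div_assoc, ENNReal.ofReal_mul (by positivity),
      ENNReal.ofReal_div_of_pos (by positivity), ENNReal.ofReal_pow (by positivity)]
    simp
  · refine lintegral_congr fun w => ?_
    rw [tsum_eq_single (blocks (stateAt w T)).card fun k hk => if_neg hk.symm, if_pos rfl]
    rfl

end Labelled

/-! ### The weights in the Poisson expectation and their cancellation. -/

section Weights

variable {S : Type*} [MeasurableSpace S] {T : ℝ≥0} {K : Particle S → Particle S → ℝ≥0}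

/-- The functional of the Poisson process on the right-hand side of the description, as a function
of the point measure. -/
def tiltedFunctional (K : Particle S → Particle S → ℝ≥0) (b : ℝ≥0) (N : ℕ)
    (f : Measure (Traj1 S T) → ℝ≥0) (Y : Measure (Traj1 S T)) : ℝ :=
  Real.exp (-(1 / 2 : ℝ) * ((∫⁻ ξ, ∫⁻ ξ', pathInteraction K ξ.1 ξ'.1
      ∂(finiteKernel (Traj1 S T) Y) ∂(finiteKernel (Traj1 S T) Y)).toReal -
      (∫⁻ ξ, pathInteraction K ξ.1 ξ.1 ∂(finiteKernel (Traj1 S T) Y)).toReal)) *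
    Real.exp (((b : ℝ) - 1) * (Y Set.univ).toReal) *
    (b : ℝ) ^ (-(∫⁻ ξ, atomCount ξ.1 ∂(finiteKernel (Traj1 S T) Y)).toReal) *
    (f ((N : ℝ≥0∞)⁻¹ • Y) : ℝ)

theorem measurable_tiltedFunctional (hK : Measurable (Function.uncurry K)) (b : ℝ≥0) (N : ℕ)
    {f : Measure (Traj1 S T) → ℝ≥0} (hf : Measurable f) :
    Measurable (tiltedFunctional K b N f) := by
  have hi : Measurable fun p : Traj1 S T × Traj1 S T => pathInteraction K p.1.1 p.2.1 :=
    Measurable.comp (g := fun p : MeasurePath S T × MeasurePath S T => pathInteraction K p.1 p.2)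
      (f := fun p : Traj1 S T × Traj1 S T => (p.1.1, p.2.1)) (measurable_pathInteraction hK)
      ((measurable_subtype_coe.comp measurable_fst).prodMk
        (measurable_subtype_coe.comp measurable_snd))
  have hdiag : Measurable fun ξ : Traj1 S T => pathInteraction K ξ.1 ξ.1 :=
    Measurable.comp (g := fun p : Traj1 S T × Traj1 S T => pathInteraction K p.1.1 p.2.1)
      (f := fun ξ => (ξ, ξ)) hi (measurable_id.prodMk measurable_id)
  have hsingle : ∀ {g : Traj1 S T → ℝ≥0∞}, Measurable g → Measurable fun Y : Measure (Traj1 S T) =>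
      ∫⁻ ξ, g ξ ∂(finiteKernel (Traj1 S T) Y) := fun hg => hg.lintegral_kernel
  have hin : Measurable fun p : Measure (Traj1 S T) × Traj1 S T =>
      ∫⁻ ξ', pathInteraction K p.2.1 ξ'.1 ∂(finiteKernel (Traj1 S T) p.1) :=
    measurable_lintegral_finiteKernel
      (f := fun (p : Measure (Traj1 S T) × Traj1 S T) (ξ' : Traj1 S T) =>
        pathInteraction K p.2.1 ξ'.1)
      (Measurable.comp (g := fun p : Traj1 S T × Traj1 S T => pathInteraction K p.1.1 p.2.1)
        (f := fun q : (Measure (Traj1 S T) × Traj1 S T) × Traj1 S T => (q.1.2, q.2)) hi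
        ((measurable_snd.comp measurable_fst).prodMk measurable_snd)) measurable_fst
  have hdouble : Measurable fun Y : Measure (Traj1 S T) => ∫⁻ ξ, ∫⁻ ξ', pathInteraction K ξ.1 ξ'.1
      ∂(finiteKernel (Traj1 S T) Y) ∂(finiteKernel (Traj1 S T) Y) :=
    measurable_lintegral_finiteKernel
      (f := fun (Y : Measure (Traj1 S T)) (ξ : Traj1 S T) =>
        ∫⁻ ξ', pathInteraction K ξ.1 ξ'.1 ∂(finiteKernel (Traj1 S T) Y)) hin measurable_id
  have hatom := hsingle (measurable_atomCount.comp (measurable_subtype_coe (p := fun ξ :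
    TimeInt T → Measure (Particle S) => IsTrajectory T ξ ∧ ξ (timeT T) Set.univ = 1)))
  have hsmul : Measurable fun Y : Measure (Traj1 S T) => (N : ℝ≥0∞)⁻¹ • Y :=
    Measure.measurable_of_measurable_coe _ fun A hA => by
      simp only [Measure.smul_apply, smul_eq_mul]
      exact (Measure.measurable_coe hA).const_mul _
  unfold tiltedFunctional
  refine Measurable.mul (Measurable.mul (Measurable.mul ?_ ?_) ?_) ?_
  · exact Real.measurable_exp.comp
      ((hdouble.ennreal_toReal.sub (hsingle hdiag).ennreal_toReal).const_mul _)
  · exact Real.measurable_exp.comp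
      ((Measure.measurable_coe MeasurableSet.univ).ennreal_toReal.const_mul _)
  · exact measurable_const.pow hatom.ennreal_toReal.neg
  · exact (hf.comp hsmul).coe_nnreal_real

theorem lintegral_sum_dirac_of_measurable {X A : Type*} [MeasurableSpace X] (s : Finset A)
    (x : A → X) {g : X → ℝ≥0∞} (hg : Measurable g) :
    ∫⁻ y, g y ∂(∑ i ∈ s, Measure.dirac (x i)) = ∑ i ∈ s, g (x i) := by
  rw [lintegral_finsetSum_measure]
  exact Finset.sum_congr rfl fun i _ => lintegral_dirac' _ hg

/-- The full double integral runs over all pairs of indices; subtracting the diagonal integral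
removes exactly the pairs `i = j`, even if two indices carry the same trajectory. All interactions
are finite, so the subtraction in the reals is legitimate. -/
theorem tiltedFunctional_sum_dirac {A : Type*} [DecidableEq A]
    (hK : Measurable (Function.uncurry K)) (b : ℝ≥0) (N : ℕ) (f : Measure (Traj1 S T) → ℝ≥0)
    (s : Finset A) (x : A → Traj1 S T) :
    tiltedFunctional K b N f (∑ i ∈ s, Measure.dirac (x i)) =
      Real.exp (-(1 / 2 : ℝ) * ∑ i ∈ s, ∑ j ∈ s,
          if i = j then 0 else interaction K (x i) (x j)) *
        Real.exp (((b : ℝ) - 1) * (s.card : ℝ)) *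
        (b : ℝ) ^ (-∑ i ∈ s, numAtoms (x i)) *
        (f ((N : ℝ≥0∞)⁻¹ • ∑ i ∈ s, Measure.dirac (x i)) : ℝ) := by
  have hi : Measurable fun p : Traj1 S T × Traj1 S T => pathInteraction K p.1.1 p.2.1 :=
    Measurable.comp (g := fun p : MeasurePath S T × MeasurePath S T => pathInteraction K p.1 p.2)
      (f := fun p : Traj1 S T × Traj1 S T => (p.1.1, p.2.1)) (measurable_pathInteraction hK)
      ((measurable_subtype_coe.comp measurable_fst).prodMk
        (measurable_subtype_coe.comp measurable_snd))
  have hright : ∀ ξ : Traj1 S T, Measurable fun ξ' : Traj1 S T => pathInteraction K ξ.1 ξ'.1 :=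
    fun ξ => (measurable_pathInteraction_right hK ξ.1).comp measurable_subtype_coe
  have hleft : ∀ ξ' : Traj1 S T, Measurable fun ξ : Traj1 S T => pathInteraction K ξ.1 ξ'.1 :=
    fun ξ' => Measurable.comp (g := fun p : Traj1 S T × Traj1 S T => pathInteraction K p.1.1 p.2.1)
      (f := fun ξ => (ξ, ξ')) hi measurable_prodMk_right
  have hdiag : Measurable fun ξ : Traj1 S T => pathInteraction K ξ.1 ξ.1 :=
    Measurable.comp (g := fun p : Traj1 S T × Traj1 S T => pathInteraction K p.1.1 p.2.1)
      (f := fun ξ => (ξ, ξ)) hi (measurable_id.prodMk measurable_id)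
  have hatom : Measurable fun ξ : Traj1 S T => atomCount ξ.1 :=
    measurable_atomCount.comp measurable_subtype_coe
  have hcount : ∀ ξ : Traj1 S T, atomCount ξ.1 ≠ ∞ := fun ξ => by
    have := ξ.2.1.isFiniteMeasure (time0 T)
    exact measure_ne_top _ _
  rw [tiltedFunctional, finiteKernel_apply]
  simp_rw [lintegral_sum_dirac_of_measurable s x (hright _)]
  rw [lintegral_sum_dirac_of_measurable s x (Finset.measurable_fun_sum _ fun j _ => hleft (x j)),
    lintegral_sum_dirac_of_measurable s x hdiag, lintegral_sum_dirac_of_measurable s x hatom,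
    ENNReal.toReal_sum fun i _ => ENNReal.sum_ne_top.2 fun j _ =>
      pathInteraction_traj_ne_top hK (x i) (x j),
    ENNReal.toReal_sum fun i _ => pathInteraction_traj_ne_top hK (x i) (x i),
    ENNReal.toReal_sum fun i _ => hcount (x i), ← Finset.sum_sub_distrib]
  congr 4
  · congr 1
    refine Finset.sum_congr rfl fun i hi' => ?_
    rw [ENNReal.toReal_sum fun j _ => pathInteraction_traj_ne_top hK (x i) (x j)]
    simp_rw [interaction_eq hK]
    rw [← Finset.add_sum_erase s _ hi', ← Finset.add_sum_erase s (fun j =>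
      if i = j then (0 : ℝ) else _) hi']
    simp only [if_true, zero_add, add_sub_cancel_left]
    exact Finset.sum_congr rfl fun j hj => (if_neg (Finset.ne_of_mem_erase hj).symm).symm
  · rw [Measure.finsetSum_apply]
    simp

theorem sum_offDiag_eq_two_mul {k : ℕ} {r : Fin k → Fin k → ℝ} (hr : ∀ i j, r i j = r j i) :
    ∑ i, ∑ j, (if i = j then 0 else r i j) = 2 * ∑ i, ∑ j, if i < j then r i j else 0 := by
  have h : ∀ i j, (if i = j then 0 else r i j) =
      (if i < j then r i j else 0) + if j < i then r j i else 0 := by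
    intro i j
    rcases lt_trichotomy i j with h | h | h
    · simp [h, h.ne, h.not_gt]
    · simp [h]
    · simp [h, h.ne', h.not_gt, hr i j]
  simp_rw [h, Finset.sum_add_distrib]
  rw [two_mul]
  congr 1
  exact Finset.sum_comm

/-- By symmetry of the interaction, half the sum over `i ≠ j` is the sum over `i < j` produced by
the splitting. -/
theorem expNeg_pairSum (hK : Measurable (Function.uncurry K)) (hKsymm : ∀ p q, K p q = K q p)
    {k : ℕ} (x : Fin k → Traj1 S T) :
    expNeg (pairSum K fun i => (x i).1) = ENNReal.ofReal (Real.exp (-(1 / 2 : ℝ) *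
      ∑ i, ∑ j, if i = j then 0 else interaction K (x i) (x j))) := by
  have hne : ∀ i j : Fin k,
      (if i < j then pathInteraction K (x i).1 (x j).1 else 0) ≠ ∞ := fun i j => by
    split_ifs
    · exact pathInteraction_traj_ne_top hK _ _
    · exact ENNReal.zero_ne_top
  have hne' : ∀ i : Fin k,
      (∑ j, if i < j then pathInteraction K (x i).1 (x j).1 else 0) ≠ ∞ := fun i =>
    ENNReal.sum_ne_top.2 fun j _ => hne i j
  rw [sum_offDiag_eq_two_mul fun i j => by
    rw [interaction_eq hK, interaction_eq hK, pathInteraction_comm hK hKsymm]]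
  rw [pairSum, expNeg_of_ne_top (ENNReal.sum_ne_top.2 fun i _ => hne' i),
    ENNReal.toReal_sum fun i _ => hne' i]
  congr 2
  rw [← mul_assoc]
  norm_num
  refine Finset.sum_congr rfl fun i _ => ?_
  rw [ENNReal.toReal_sum fun j _ => hne i j]
  refine Finset.sum_congr rfl fun j _ => ?_
  split_ifs
  · rw [interaction_eq hK]
  · rfl

/-- The density `∏ e^{1-b} b^{|ξ_i|}` of the intensity cancels `e^{(b-1)k}` and `b^{-∑|ξ_i|}`, so
that `b` disappears. -/
theorem prod_atomWeight_mul_tiltedFunctional (hK : Measurable (Function.uncurry K))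
    (hKsymm : ∀ p q, K p q = K q p) {b : ℝ≥0} (hb : 0 < b) (N : ℕ)
    (f : Measure (Traj1 S T) → ℝ≥0) {k : ℕ} (x : Fin k → Traj1 S T) :
    (∏ i, atomWeight b (atomCount (x i).1).toReal) *
        ENNReal.ofReal (tiltedFunctional K b N f (∑ i, Measure.dirac (x i))) =
      expNeg (pairSum K fun i => (x i).1) *
        (f ((N : ℝ≥0∞)⁻¹ • ∑ i, Measure.dirac (x i)) : ℝ≥0∞) := by
  have hb' : (0 : ℝ) < b := hb
  have hw : ∏ i, atomWeight b (atomCount (x i).1).toReal =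
      ENNReal.ofReal (Real.exp ((1 - b) * k) * (b : ℝ) ^ (∑ i, numAtoms (x i))) := by
    have e : ∀ i, atomWeight b (atomCount (x i).1).toReal =
        ENNReal.ofReal (Real.exp (1 - b) * (b : ℝ) ^ (numAtoms (x i))) := fun i => rfl
    simp_rw [e]
    rw [← ENNReal.ofReal_prod_of_nonneg fun i _ => by positivity, Finset.prod_mul_distrib,
      Finset.prod_const, Finset.card_univ, Fintype.card_fin, ← Real.exp_nat_mul,
      Real.rpow_sum_of_pos hb', mul_comm (k : ℝ)]
  rw [hw, tiltedFunctional_sum_dirac hK, expNeg_pairSum hK hKsymm,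
    ← ENNReal.ofReal_mul (by positivity), ← ENNReal.ofReal_coe_nnreal,
    ← ENNReal.ofReal_mul (by positivity), Finset.card_univ, Fintype.card_fin, Real.rpow_neg hb'.le]
  congr 1
  have h1 : Real.exp ((1 - b) * k) * Real.exp (((b : ℝ) - 1) * k) = 1 := by
    rw [← Real.exp_add, ← Real.exp_zero]
    congr 1
    ring
  have h2 : (b : ℝ) ^ (∑ i, numAtoms (x i)) * ((b : ℝ) ^ (∑ i, numAtoms (x i)))⁻¹ = 1 :=
    mul_inv_cancel₀ (Real.rpow_pos_of_pos hb' _).ne'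
  generalize (b : ℝ) ^ (∑ i, numAtoms (x i)) = β at h2 ⊢
  generalize Real.exp ((1 - b) * k) = α at h1 ⊢
  generalize Real.exp (((b : ℝ) - 1) * k) = α' at h1 ⊢
  linear_combination (Real.exp (-(1 / 2 : ℝ) * ∑ i, ∑ j,
    if i = j then 0 else interaction K (x i) (x j)) *
    (f ((N : ℝ≥0∞)⁻¹ • ∑ i, Measure.dirac (x i)) : ℝ)) * (β * β⁻¹ * h1 + h2)

end Weights

/-! ### Both expectations as multiples of one series. -/

section Description

variable {S : Type*} [MeasurableSpace S] [MeasurableEq S] {T : ℝ≥0}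
  {K : Particle S → Particle S → ℝ≥0} {Υ : Kernel (Particle S × Particle S) S} {μ : Measure S}
  [IsProbabilityMeasure μ] [IsMarkovKernel Υ] {f : Measure (Traj1 S T) → ℝ≥0}

/-- The common series of the two expectations. -/
def poissonSeries (K : Particle S → Particle S → ℝ≥0) (Υ : Kernel (Particle S × Particle S) S)
    (μ : Measure S) (N : ℕ) (T : ℝ≥0) (f : Measure (Traj1 S T) → ℝ≥0) : ℝ≥0∞ :=
  ∑' k : ℕ, (k.factorial : ℝ≥0∞)⁻¹ * ∫⁻ x, expNeg (pairSum K fun i => (x i).1) *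
    (f ((N : ℝ≥0∞)⁻¹ • ∑ i, Measure.dirac (x i)) : ℝ≥0∞)
    ∂(Measure.pi fun _ : Fin k => singleTraj K Υ μ N T)

theorem map_smul_sum_dirac {k : ℕ} (x : Fin k → Traj1 S T) (c : ℝ≥0∞) :
    (c • ∑ i, Measure.dirac (x i)).map Subtype.val = c • ∑ i, Measure.dirac (x i).1 := by
  rw [Measure.map_smul, map_finsetSum _ _ measurable_subtype_coe]
  simp_rw [Measure.map_dirac' measurable_subtype_coe]

theorem measurable_measure_smul {X : Type*} [MeasurableSpace X] (c : ℝ≥0∞) :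
    Measurable fun Y : Measure X => c • Y :=
  Measure.measurable_of_measurable_coe _ fun A hA => by
    simp only [Measure.smul_apply, smul_eq_mul]
    exact (Measure.measurable_coe hA).const_mul _

/-- On good records `f` of the empirical measure is a measurable functional of the history measure
on the space of all paths. -/
theorem aemeasurable_empirical (hK : Measurable (Function.uncurry K)) (N : ℕ) (hf : Measurable f) :
    AEMeasurable (fun w => f (empirical N T w.2)) (poissonisedLaw K Υ N μ) := by
  obtain ⟨f', hf', h⟩ := exists_measurable_factor_map hf
  refine ⟨fun w => f' ((N : ℝ≥0∞)⁻¹ • historyMeasure T (stateAt w.2)),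
    hf'.comp ((measurable_measure_smul _).comp (measurable_historyMeasure_sigma T)), ?_⟩
  filter_upwards [ae_poissonisedLaw_mem_goodRecords hK N] with w hw
  rw [h, map_empirical hw N]

theorem lintegral_empirical (hK : Measurable (Function.uncurry K))
    (hKsymm : ∀ p q, K p q = K q p) (N : ℕ) (hf : Measurable f) :
    ∫⁻ w, (f (empirical N T w.2) : ℝ≥0∞) ∂(poissonisedLaw K Υ N μ) =
      ENNReal.ofReal (Real.exp (-N)) * poissonSeries K Υ μ N T f := by
  have hfin : IsFiniteMeasure (singleTraj K Υ μ N T) := isFiniteMeasure_singleTraj hK N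
  have hfin' : IsFiniteMeasure (singleLaw K Υ μ N T) := isFiniteMeasure_singleLaw hK N
  obtain ⟨f', hf', h⟩ := exists_measurable_factor_map hf
  have hF : Measurable fun Y : Measure (MeasurePath S T) => (f' ((N : ℝ≥0∞)⁻¹ • Y) : ℝ≥0∞) :=
    (hf'.comp (measurable_measure_smul _)).coe_nnreal_ennreal
  have hae : ∫⁻ w, (f (empirical N T w.2) : ℝ≥0∞) ∂(poissonisedLaw K Υ N μ) =
      ∫⁻ w, (f' ((N : ℝ≥0∞)⁻¹ • historyMeasure T (stateAt w.2)) : ℝ≥0∞)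
        ∂(poissonisedLaw K Υ N μ) := by
    refine lintegral_congr_ae ?_
    filter_upwards [ae_poissonisedLaw_mem_goodRecords hK N] with w hw
    rw [h, map_empirical hw N]
  rw [hae, lintegral_poissonisedLaw_historyMeasure hK hKsymm N hF, poissonSeries]
  congr 1
  refine tsum_congr fun k => ?_
  congr 1
  -- Transfers the product integral from paths back to trajectories, where `f` itself is defined.
  have hpi : (Measure.pi fun _ : Fin k => singleLaw K Υ μ N T) =
      (Measure.pi fun _ : Fin k => singleTraj K Υ μ N T).map
        fun (x : Fin k → Traj1 S T) i => (x i).1 := by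
    have hs : ∀ _ : Fin k, SigmaFinite ((singleTraj K Υ μ N T).map Subtype.val) := fun _ => by
      rw [map_singleTraj hK N]; infer_instance
    rw [Measure.pi_map_pi (f := fun _ => Subtype.val) fun _ => measurable_subtype_coe.aemeasurable]
    simp_rw [map_singleTraj hK N]
  have hval : Measurable fun (x : Fin k → Traj1 S T) i => (x i).1 :=
    measurable_pi_lambda _ fun i => measurable_subtype_coe.comp (measurable_pi_apply i)
  rw [hpi]
  refine (lintegral_map ((measurable_expNeg.comp (measurable_pairSum hK k)).mul
    (hF.comp (measurable_sum_dirac k))) hval).trans (lintegral_congr fun x => ?_)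
  simp only [Pi.mul_apply, Function.comp_apply]
  rw [h, map_smul_sum_dirac]

variable {Ω : Type*} [MeasurableSpace Ω] {Q : Measure Ω} [IsProbabilityMeasure Q] {n : Ω → ℕ}
  {Ξ : ℕ → Ω → Traj1 S T}

theorem lintegral_tiltedFunctional (hK : Measurable (Function.uncurry K))
    (hKsymm : ∀ p q, K p q = K q p) {N : ℕ} (hN : 0 < N) (hf : Measurable f) {b : ℝ≥0} (hb : 0 < b)
    (h : IsPoissonPointProcess ((N : ℝ≥0∞) • refMeasure K Υ b μ N T) Q n Ξ) :
    ∫⁻ ω, ENNReal.ofReal (tiltedFunctional K b N f (pointMeasure (n ω) fun i => Ξ i ω)) ∂Q =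
      ENNReal.ofReal (Real.exp (-((N : ℝ≥0∞) • refMeasure K Υ b μ N T).real Set.univ)) *
        poissonSeries K Υ μ N T f := by
  have hfin : IsFiniteMeasure ((N : ℝ≥0∞) • refMeasure K Υ b μ N T) :=
    ⟨smul_refMeasure_univ_lt_top hK hN b⟩
  have hfin' : IsFiniteMeasure (singleTraj K Υ μ N T) := isFiniteMeasure_singleTraj hK N
  have hG : Measurable fun Y => ENNReal.ofReal (tiltedFunctional K b N f Y) :=
    (measurable_tiltedFunctional hK b N hf).ennreal_ofReal
  rw [h.lintegral_eq hG, poissonSeries, ← ENNReal.tsum_mul_left]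
  refine tsum_congr fun k => ?_
  rw [ENNReal.ofReal_div_of_pos (by positivity), ENNReal.ofReal_natCast, div_eq_mul_inv, mul_assoc]
  congr 2
  have hρ : Measurable fun ξ : Traj1 S T => atomWeight b (atomCount ξ.1).toReal :=
    (measurable_atomWeight b).comp
      (measurable_atomCount.comp measurable_subtype_coe).ennreal_toReal
  have heq := smul_refMeasure_eq (Υ := Υ) (μ := μ) (T := T) hK hN b
  rw [heq] at hfin ⊢
  refine (lintegral_pi_withDensity _ hρ k (hG.comp (measurable_sum_dirac k))).trans ?_
  exact lintegral_congr fun x => prod_atomWeight_mul_tiltedFunctional hK hKsymm hb N f x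

theorem tiltedFunctional_nonneg (b : ℝ≥0) (N : ℕ) (Y : Measure (Traj1 S T)) :
    0 ≤ tiltedFunctional K b N f Y := by
  unfold tiltedFunctional
  positivity

end Description

end Coag

end

/-! ### Comparison of the two expectations. -/

theorem theorem2p1 {S : Type*} [TopologicalSpace S] [PolishSpace S] [MeasurableSpace S]
    [BorelSpace S]
    (K : Coag.Particle S → Coag.Particle S → ℝ≥0) (hK : Measurable (Function.uncurry K))
    (hKsymm : ∀ p q, K p q = K q p)
    (Υ : Kernel (Coag.Particle S × Coag.Particle S) S) [IsMarkovKernel Υ]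
    (hΥsymm : ∀ p q, Υ (p, q) = Υ (q, p))
    (μ : Measure S) [IsProbabilityMeasure μ] (T : ℝ≥0) (hT : 0 < T) (N : ℕ) (hN : 0 < N)
    (f : Measure (Coag.Traj1 S T) → ℝ≥0) (hf : Measurable f) (hfb : ∃ c, ∀ ν, f ν ≤ c)
    (b : ℝ≥0) (hb : 0 < b) :
    -- the reference measure is finite
    Coag.refMeasure K Υ b μ N T Set.univ < ∞ ∧
    -- the expectation on the left-hand side is well-defined
    Integrable (fun w => (f (Coag.empirical N T w.2) : ℝ)) (Coag.poissonisedLaw K Υ N μ) ∧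
    -- for every Poisson point process with intensity measure `N M_{bμ,N}`
    ∀ {Ω : Type*} [MeasurableSpace Ω] (Q : Measure Ω) [IsProbabilityMeasure Q]
      (n : Ω → ℕ) (Ξ : ℕ → Ω → Coag.Traj1 S T),
      Coag.IsPoissonPointProcess ((N : ℝ≥0∞) • Coag.refMeasure K Υ b μ N T) Q n Ξ →
      let G : Ω → ℝ := fun ω =>
        Real.exp (-(1 / 2 : ℝ) * ∑ i ∈ Finset.range (n ω), ∑ j ∈ Finset.range (n ω),
            if i = j then 0 else Coag.interaction K (Ξ i ω) (Ξ j ω)) *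
          Real.exp (((b : ℝ) - 1) * (n ω : ℝ)) *
          (b : ℝ) ^ (-∑ i ∈ Finset.range (n ω), Coag.numAtoms (Ξ i ω)) *
          (f ((N : ℝ≥0∞)⁻¹ • Coag.pointMeasure (n ω) (fun i => Ξ i ω)) : ℝ)
      Integrable G Q ∧
      ∫ w, (f (Coag.empirical N T w.2) : ℝ) ∂(Coag.poissonisedLaw K Υ N μ) =
        (∫ ω, G ω ∂Q) *
          Real.exp ((N : ℝ) * ((Coag.refMeasure K Υ b μ N T Set.univ).toReal - 1)) := by
  have hprob := Coag.isProbabilityMeasure_poissonisedLaw (Υ := Υ) (μ := μ) hK (N : ℝ≥0)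
  have hfin := Coag.smul_refMeasure_univ_lt_top (Υ := Υ) (μ := μ) (T := T) hK hN b
  have hN0 : (N : ℝ≥0∞) ≠ 0 := by exact_mod_cast hN.ne'
  have hM : Coag.refMeasure K Υ b μ N T Set.univ < ∞ := by
    rw [Measure.smul_apply, smul_eq_mul] at hfin
    exact ENNReal.lt_top_of_mul_ne_top_right hfin.ne hN0
  obtain ⟨c, hc⟩ := hfb
  have hl : Integrable (fun w => (f (Coag.empirical N T w.2) : ℝ))
      (Coag.poissonisedLaw K Υ N μ) := by
    refine Integrable.of_bound (C := c)
      (Coag.aemeasurable_empirical hK N hf).coe_nnreal_real.aestronglyMeasurable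
      (Filter.Eventually.of_forall fun w => ?_)
    rw [Real.norm_of_nonneg (NNReal.coe_nonneg _)]
    exact_mod_cast hc _
  refine ⟨hM, hl, ?_⟩
  intro Ω _ Q _ n Ξ h G
  have hG : ∀ ω, G ω = Coag.tiltedFunctional K b N f
      (Coag.pointMeasure (n ω) fun i => Ξ i ω) := fun ω => by
    rw [Coag.pointMeasure, Coag.tiltedFunctional_sum_dirac hK, Finset.card_range]
    rfl
  have hfin' : IsFiniteMeasure ((N : ℝ≥0∞) • Coag.refMeasure K Υ b μ N T) := ⟨hfin⟩
  have hGm : Measurable G := by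
    rw [funext hG]
    exact (Coag.measurable_tiltedFunctional hK b N hf).comp h.measurable
  have hG0 : ∀ ω, 0 ≤ G ω := fun ω => by
    rw [hG]
    exact Coag.tiltedFunctional_nonneg b N _
  have hL := Coag.lintegral_empirical (Υ := Υ) (μ := μ) hK hKsymm N hf
  have hR := Coag.lintegral_tiltedFunctional hK hKsymm hN hf hb h
  simp_rw [← hG] at hR
  -- Finiteness is read off from the left-hand side, where `f` is bounded and the law is a
  -- probability measure; the weight `e^{(b-1)|I|} b^{-∑|Ξ_{i,0}|}` on the right need not be
  -- bounded.
  have hs : Coag.poissonSeries K Υ μ N T f ≠ ∞ := by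
    intro htop
    have hlt : ∫⁻ w, (f (Coag.empirical N T w.2) : ℝ≥0∞) ∂(Coag.poissonisedLaw K Υ N μ) < ∞ := by
      refine (lintegral_mono fun w => (ENNReal.coe_le_coe.2 (hc _))).trans_lt ?_
      rw [lintegral_const, measure_univ, mul_one]
      exact ENNReal.coe_lt_top
    rw [hL, htop, ENNReal.mul_top (ENNReal.ofReal_pos.2 (Real.exp_pos _)).ne'] at hlt
    exact lt_irrefl _ hlt
  refine ⟨⟨hGm.aestronglyMeasurable, ?_⟩, ?_⟩
  · rw [hasFiniteIntegral_iff_ofReal (Filter.Eventually.of_forall hG0), hR]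
    exact ENNReal.mul_lt_top ENNReal.ofReal_lt_top hs.lt_top
  · rw [integral_eq_lintegral_of_nonneg_ae (Filter.Eventually.of_forall hG0)
      hGm.aestronglyMeasurable, hR,
      integral_eq_lintegral_of_nonneg_ae (Filter.Eventually.of_forall fun w => NNReal.coe_nonneg _)
        hl.aestronglyMeasurable]
    simp_rw [ENNReal.ofReal_coe_nnreal]
    -- The prefactors match: `e^{-N|M|} · e^{N(|M|-1)} = e^{-N}`.
    rw [hL, ENNReal.toReal_mul, ENNReal.toReal_mul, ENNReal.toReal_ofReal (Real.exp_pos _).le,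
      ENNReal.toReal_ofReal (Real.exp_pos _).le, mul_right_comm, ← Real.exp_add, measureReal_def,
      Measure.smul_apply, smul_eq_mul, ENNReal.toReal_mul, ENNReal.toReal_natCast]
    congr 2
    ring
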